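/- **Setting.** Let $m,n\ge 0$ and fix $\mathbf I=\{0=i_0<i_1<\dots<i_r=m\}$ and $\mathbf J=\{0=j_0<j_1<\dots<j_s=n\}$. Let $\mathfrak X\subseteq \mathsf{Mat}_{m,n}(\mathbb C)$ be a (possibly reducible) affine variety with vanishing ideal $I(\mathfrak X)\subseteq S=\mathbb C[z_{ij}]$. For a term order $<$, let $\mathsf{Std}=\mathsf{Std}_<(S/I(\mathfrak X))$ be the set of monomials not in the initial ideal of $I(\mathfrak X)$, each identified with its exponent matrix in $\mathsf{Mat}_{m,n}(\mathbb Z_{\ge0})$. **Words and matrices.** For a word $w$, write ")" for each letter $i$ and "(" for each letter $i+1$. The operator $f_i$ changes the letter at the rightmost unmatched ")" to $i+1$, and $e_i$ changes the letter at the leftmost unmatched "(" to $i$; the value is $\varnothing$ if there is no such letter. For $M\in\mathsf{Mat}_{m,n}(\mathbb Z_{\ge 0})$, $\mathsf{row}(M)$ lists $m_{ij}$ copies of $i$ for each entry, read down the columns, left to right; $\mathsf{col}(M)$ lists $m_{ij}$ copies of $j$ for each entry, read along the rows, top to bottom. For $1\le i<m$, if $f_i$ alters the letter of $\mathsf{row}(M)$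 that comes from the entry $(i,a)$, then $f_i^{\mathsf{row}}(M)$ is obtained by moving one unit from entry $(i,a)$ to entry $(i+1,a)$; if $e_i$ alters the letter that comes from the entry $(i+1,b)$, then $e_i^{\mathsf{row}}(M)$ is obtained by moving one unit from $(i+1,b)$ to $(i,b)$; otherwise they are $\varnothing$. For $1\le j<n$ put $f_j^{\mathsf{col}}(M)=(f_j^{\mathsf{row}}(M^t))^t$ and $e_j^{\mathsf{col}}(M)=(e_j^{\mathsf{row}}(M^t))^t$. The variety $\mathfrak X$ is *$\mathbf L_{\mathbf I|\mathbf J}$-bicrystal closed*, as witnessed by $<$, if for all $M\in\mathsf{Std}$ the values $e_i^{\mathsf{row}}(M),f_i^{\mathsf{row}}(M)$ ($i\notin\mathbf I$) and $e_j^{\mathsf{col}}(M),f_j^{\mathsf{col}}(M)$ ($j\notin\mathbf J$) lie in $\mathsf{Std}\cup\{\varnothing\}$. **Graphs.** A pre-crystal graph is a directed graph with labelled edges and a weight (a tuple of nonnegative integers) on each vertex; an isomorphism is a bijection on vertices that, together with its inverse, preserves weights and labelled edges. $\oplus$ is disjoint union; $\mathcal G\,\Box\,\mathcal H$ is the Cartesian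 product, in which an edge moves exactly one coordinate along an edge of that factor, the label sets are made disjoint and the weights are concatenated. The filtered matrix bicrystal graph $\mathcal M^{\mathbf I|\mathbf J}_{m,n}$ has vertex set $\mathsf{Mat}_{m,n}(\mathbb Z_{\ge0})$, edges $M\xrightarrow{i^{\mathsf{row}}}f_i^{\mathsf{row}}(M)$ for $i\notin\mathbf I$ and $M\xrightarrow{j^{\mathsf{col}}}f_j^{\mathsf{col}}(M)$ for $j\notin\mathbf J$, and weight the vector of row sums followed by the vector of column sums. A matrix has *highest weight* if it is a source of this graph. For a partition $\lambda$, $\mathcal B_{\lambda,[a,b]}$ has as vertices the semistandard tableaux of shape $\lambda$ with entries in $[a,b]$, an edge $T\xrightarrow{i}T'$ ($a\le i<b$) when $f_i(\mathsf{word}(T))=\mathsf{word}(T')$, and as weight the numbers of entries $a,\dots,b$; here $\mathsf{word}$ reads the columns from left to right, each from bottom to top. A partition-tuple $\underline\lambda=(\lambda^{(1)},\dots,\lambda^{(r)})$ for $\mathbf I$ consists of partitions $\lambda^{(k)}$ with at most $i_k-i_{k-1}$ rows; put $\mathcal B_{\underline\lambda,m}=\mathcal B_{\lambda^{(1)},[1,i_1]}\Box\cdots\Box\mathcal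 B_{\lambda^{(r)},[i_{r-1}+1,m]}$, and let $T_{\underline\lambda}$ be the tuple of tableaux of shapes $\lambda^{(k)}$ whose $p$-th row is constantly $i_{k-1}+p$. Partition-tuples $\underline\mu$ for $\mathbf J$, $\mathcal B_{\underline\mu,n}$ and $T_{\underline\mu}$ are defined likewise. **Filtered RSK.** $\mathsf{filterRSK}_{\mathbf I|\mathbf J}(M)=(P^{(1)},\dots,P^{(r)}|Q^{(1)},\dots,Q^{(s)})$, where $P^{(k)}$ is the unique semistandard tableau whose reading word is Knuth equivalent to the subword of $\mathsf{row}(M)$ of letters in $[i_{k-1}+1,i_k]$, and $Q^{(k)}$ the one whose reading word is Knuth equivalent to the subword of $\mathsf{col}(M)$ of letters in $[j_{k-1}+1,j_k]$. (Knuth equivalence is generated by $yzx\leftrightarrow yxz$ for $x<y\le z$ and $zxy\leftrightarrow xzy$ for $x\le y<z$.) The tuple of shapes of these tableaux is the *shape* of $M$. **Theorem.** Suppose that $\mathfrak X$ is $\mathbf L_{\mathbf I|\mathbf J}$-bicrystal closed, as witnessed by $<$. Let $\mathcal S_{\mathfrak X}$ be the subgraph of $\mathcal M^{\mathbf I|\mathbf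 J}_{m,n}$ induced on $\mathsf{Std}$, and let $c^{\mathfrak X}_{\underline\lambda|\underline\mu}=\#\{M\in\mathsf{Std}:\mathsf{filterRSK}_{\mathbf I|\mathbf J}(M)=(T_{\underline\lambda}|T_{\underline\mu})\}$. These numbers are finite, and there is an isomorphism of pre-crystal graphs $$\mathcal S_{\mathfrak X}\;\cong\;\bigoplus_{\underline\lambda|\underline\mu}\bigl(\mathcal B_{\underline\lambda,m}\,\Box\,\mathcal B_{\underline\mu,n}\bigr)^{\oplus c^{\mathfrak X}_{\underline\lambda|\underline\mu}},$$ the sum being over all pairs of partition-tuples for $\mathbf I$ and $\mathbf J$, that sends each $M\in\mathsf{Std}$ to the vertex $\mathsf{filterRSK}_{\mathbf I|\mathbf J}(M)$ in one of the copies. Moreover, $c^{\mathfrak X}_{\underline\lambda|\underline\mu}$ is the number of highest-weight matrices $M\in\mathsf{Std}$ of shape $(\underline\lambda|\underline\mu)$. -/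

import Mathlib

universe v

/-! ### Words, brackets, crystal operators -/

/-- One letter of the left-to-right scan of the `i`-th bracket word (`i + 1` is read as an opening
and `i` as a closing bracket). The state consists of the current position, the positions of the
opening brackets that are still unmatched (most recent first), and the positions of the unmatched
closing brackets (most recent first). -/
def bracketStep (i : ℕ) (s : ℕ × List ℕ × List ℕ) (x : ℕ) : ℕ × List ℕ × List ℕ :=
  if x = i + 1 then (s.1 + 1, s.1 :: s.2.1, s.2.2)
  else if x = i then
    match s.2.1 with
    | [] => (s.1 + 1, [], s.1 :: s.2.2)
    | _ :: opens => (s.1 + 1, opens, s.2.2)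
  else (s.1 + 1, s.2.1, s.2.2)

/-- The result of scanning the whole word. -/
def bracketScan (i : ℕ) (w : List ℕ) : ℕ × List ℕ × List ℕ :=
  w.foldl (bracketStep i) (0, [], [])

/-- Position (from `0`) of the leftmost unmatched opening bracket, i.e. of the letter altered by the
raising operator `e_i`. -/
def raisingPos (i : ℕ) (w : List ℕ) : Option ℕ := (bracketScan i w).2.1.getLast?

/-- Position (from `0`) of the rightmost unmatched closing bracket, i.e. of the letter altered by
the lowering operator `f_i`. -/
def loweringPos (i : ℕ) (w : List ℕ) : Option ℕ := (bracketScan i w).2.2.head?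

/-- The crystal lowering operator `f_i` on words; `none` is the symbol `∅`. -/
def wordLower (i : ℕ) (w : List ℕ) : Option (List ℕ) :=
  (loweringPos i w).map fun p => w.set p (i + 1)

/-! ### Pre-crystal graphs -/

/-- The data of a pre-crystal graph: a directed graph with edge labels in `L`, and a tuple of
nonnegative integers attached to each vertex. All the graphs built below are countable and simple
and have weight tuples of constant length; these properties do not enter the definition of
homomorphisms and isomorphisms. -/
structure PreCrystalGraph (L : Type) where
  /-- vertices -/
  V : Type
  /-- `edge l x y`: there is an edge labelled `l` from `x` to `y` -/
  edge : L → V → V → Prop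
  /-- combinatorial weight -/
  cwt : V → List ℕ

namespace PreCrystalGraph

variable {L L' : Type}

/-- Pre-crystal graph homomorphisms: maps on vertices preserving weights and labelled edges. -/
def IsHom (G H : PreCrystalGraph L) (f : G.V → H.V) : Prop :=
  (∀ x, H.cwt (f x) = G.cwt x) ∧ ∀ l x y, G.edge l x y → H.edge l (f x) (f y)

/-- Pre-crystal graph isomorphisms: invertible homomorphisms whose inverse is a homomorphism. -/
def IsIso (G H : PreCrystalGraph L) (f : G.V ≃ H.V) : Prop :=
  IsHom G H f ∧ IsHom H G f.symm

/-- The pre-crystal graph obtained by relabelling (some of) the vertices of `G` through `f`. For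
injective `f` this is the induced subgraph on the range of `f`. -/
def pullback (G : PreCrystalGraph L) {W : Type} (f : W → G.V) : PreCrystalGraph L where
  V := W
  edge l x y := G.edge l (f x) (f y)
  cwt x := G.cwt (f x)

/-- The induced subgraph on a set of vertices. -/
def induce (G : PreCrystalGraph L) (S : Set G.V) : PreCrystalGraph L :=
  G.pullback (Subtype.val : S → G.V)

/-- A source: a vertex without incoming edges. -/
def IsSource (G : PreCrystalGraph L) (x : G.V) : Prop := ∀ l y, ¬ G.edge l y x

/-- Edges of a disjoint union. -/
inductive DirectSumEdge {ι : Type} (G : ι → PreCrystalGraph L) (l : L) :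
    (Σ a, (G a).V) → (Σ a, (G a).V) → Prop
  | mk (a : ι) (x y : (G a).V) (h : (G a).edge l x y) : DirectSumEdge G l ⟨a, x⟩ ⟨a, y⟩

/-- The direct sum (disjoint union) of a family of pre-crystal graphs. -/
def directSum {ι : Type} (G : ι → PreCrystalGraph L) : PreCrystalGraph L where
  V := Σ a, (G a).V
  edge := DirectSumEdge G
  cwt x := (G x.1).cwt x.2

/-- The direct sum of `c` copies of `G`. -/
def copies (c : ℕ) (G : PreCrystalGraph L) : PreCrystalGraph L := directSum fun _ : Fin c => G

/-- The Cartesian product of two pre-crystal graphs: the label sets are made disjoint, the weights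
are concatenated. -/
def box (G : PreCrystalGraph L) (H : PreCrystalGraph L') : PreCrystalGraph (L ⊕ L') where
  V := G.V × H.V
  edge l x y := match l with
    | .inl i => G.edge i x.1 y.1 ∧ x.2 = y.2
    | .inr j => x.1 = y.1 ∧ H.edge j x.2 y.2
  cwt x := G.cwt x.1 ++ H.cwt x.2

/-- The iterated Cartesian product of `r` pre-crystal graphs whose edges carry labels from pairwise
disjoint subsets of `L` (so that the disjoint union of the label sets is their union in `L`). -/
def boxPi {r : ℕ} (G : Fin r → PreCrystalGraph L) : PreCrystalGraph L where
  V := (k : Fin r) → (G k).V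
  edge l x y := ∃ k, (G k).edge l (x k) (y k) ∧ ∀ k', k' ≠ k → x k' = y k'
  cwt x := (List.ofFn fun k => (G k).cwt (x k)).flatten

end PreCrystalGraph

/-! ### The crystal of words -/

/-- The tuple recording how often each of `a, a + 1, …, b` occurs in the word `w`. -/
def content (a b : ℕ) (w : List ℕ) : List ℕ := (List.range' a (b + 1 - a)).map fun x => w.count x

/-- The word crystal graph `W_{[a,b]}`. -/
def wordCrystal (a b : ℕ) : PreCrystalGraph ℕ where
  V := {w : List ℕ // ∀ x ∈ w, a ≤ x ∧ x ≤ b}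
  edge i w w' := a ≤ i ∧ i < b ∧ wordLower i w.1 = some w'.1
  cwt w := content a b w.1

/-! ### Tableaux and Knuth equivalence -/

/-- Column reading word of a semistandard tableau: the columns from left to right, each read from
bottom to top. -/
def SemistandardYoungTableau.word {lam : YoungDiagram} (T : SemistandardYoungTableau lam) :
    List ℕ :=
  (List.range (lam.rowLen 0)).flatMap fun j =>
    (List.range (lam.colLen j)).reverse.map fun i => T i j

theorem SemistandardYoungTableau.exists_of_mem_word {lam : YoungDiagram}
    (T : SemistandardYoungTableau lam) {x : ℕ} (hx : x ∈ T.word) :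
    ∃ i j, (i, j) ∈ lam ∧ T i j = x := by
  simp only [SemistandardYoungTableau.word, List.mem_flatMap, List.mem_map, List.mem_reverse,
    List.mem_range] at hx
  obtain ⟨j, -, i, hi, rfl⟩ := hx
  exact ⟨i, j, YoungDiagram.mem_iff_lt_colLen.2 hi, rfl⟩

/-- `SSYT(lam, [a,b])`: semistandard tableaux of shape `lam` with entries in `[a,b]`. -/
def SSYTIn (lam : YoungDiagram) (a b : ℕ) : Type :=
  {T : SemistandardYoungTableau lam // ∀ i j, (i, j) ∈ lam → a ≤ T i j ∧ T i j ≤ b}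

/-- The reading word of a tableau with entries in `[a,b]`, as a vertex of `W_{[a,b]}`. -/
def SSYTIn.word {lam : YoungDiagram} {a b : ℕ} (T : SSYTIn lam a b) : (wordCrystal a b).V :=
  ⟨T.1.word, fun _ hx => by
    obtain ⟨i, j, hij, rfl⟩ := T.1.exists_of_mem_word hx
    exact T.2 i j hij⟩

/-- The tableau crystal graph `B_{lam,[a,b]}`: the subgraph of `W_{[a,b]}` induced on the reading
words of the tableaux in `SSYT(lam, [a,b])`, with the vertices named by the tableaux. -/
def tableauCrystal (lam : YoungDiagram) (a b : ℕ) : PreCrystalGraph ℕ :=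
  (wordCrystal a b).pullback (SSYTIn.word (lam := lam))

/-- The tableau of shape `lam` with constant value `a + i` in the row with index `i = 0, 1, …`: the
highest-weight tableau of shape `lam` with smallest letter `a`. -/
def highestTableau (lam : YoungDiagram) (a : ℕ) : SemistandardYoungTableau lam where
  entry i j := if (i, j) ∈ lam then a + i else 0
  row_weak' hj hcell := by
    rw [if_pos hcell, if_pos (lam.up_left_mem le_rfl hj.le hcell)]
  col_strict' hi hcell := by
    rw [if_pos hcell, if_pos (lam.up_left_mem hi.le le_rfl hcell)]
    exact Nat.add_lt_add_left hi a
  zeros' not_cell := if_neg not_cell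

/-- Elementary Knuth moves: `yzx → yxz` for `x < y ≤ z` and `zxy → xzy` for `x ≤ y < z`, inside an
arbitrary word. -/
inductive KnuthMove : List ℕ → List ℕ → Prop
  | left (u u' : List ℕ) (x y z : ℕ) (hxy : x < y) (hyz : y ≤ z) :
      KnuthMove (u ++ [y, z, x] ++ u') (u ++ [y, x, z] ++ u')
  | right (u u' : List ℕ) (x y z : ℕ) (hxy : x ≤ y) (hyz : y < z) :
      KnuthMove (u ++ [z, x, y] ++ u') (u ++ [x, z, y] ++ u')

/-- Knuth equivalence of words. -/
def KnuthEquiv : List ℕ → List ℕ → Prop := Relation.EqvGen KnuthMove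

/-- Semistandard tableaux of arbitrary shape. -/
abbrev Tableau : Type := Σ lam : YoungDiagram, SemistandardYoungTableau lam

noncomputable instance : Nonempty Tableau := ⟨⟨⊥, default⟩⟩

/-- The unique semistandard tableau whose reading word is Knuth equivalent to `w`. -/
noncomputable def knuthTableau (w : List ℕ) : Tableau :=
  Classical.epsilon fun T : Tableau => KnuthEquiv w T.2.word

/-! ### Filtrations -/

/-- A sequence of integers `0 = i_0 < i_1 < … < i_r = m`. -/
structure Cuts (m : ℕ) where
  /-- number of blocks -/
  r : ℕ
  /-- the sequence -/
  cut : Fin (r + 1) → ℕ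
  strictMono : StrictMono cut
  cut_zero : cut 0 = 0
  cut_last : cut (Fin.last r) = m

namespace Cuts

variable {m : ℕ} (I : Cuts m)

/-- The set underlying the sequence. -/
def toSet : Set ℕ := Set.range I.cut

/-- First letter of the `k`-th block, `i_{k-1} + 1`. -/
def lo (k : Fin I.r) : ℕ := I.cut k.castSucc + 1

/-- Last letter of the `k`-th block, `i_k`. -/
def hi (k : Fin I.r) : ℕ := I.cut k.succ

/-- The `I`-filtration of a word: its subwords of letters in the successive blocks. -/
def filterWord (w : List ℕ) (k : Fin I.r) : List ℕ :=
  w.filter fun x => I.lo k ≤ x ∧ x ≤ I.hi k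

/-- `I`-filtered partition-tuples: the `k`-th partition has at most `i_k - i_{k-1}` rows. -/
def PartitionTuple : Type :=
  (k : Fin I.r) → {lam : YoungDiagram // I.cut k.castSucc + lam.colLen 0 ≤ I.cut k.succ}

/-- The `I`-filtered tableau crystal graph of a partition-tuple. -/
def tableauCrystal (lam : I.PartitionTuple) : PreCrystalGraph ℕ :=
  PreCrystalGraph.boxPi fun k => _root_.tableauCrystal (lam k).1 (I.lo k) (I.hi k)

/-- The highest-weight tableau-tuple of a given shape. -/
def highestTuple (lam : I.PartitionTuple) (k : Fin I.r) : Tableau :=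
  ⟨(lam k).1, highestTableau (lam k).1 (I.lo k)⟩

/-- The tuple of tableaux named by a vertex of the filtered tableau crystal graph. -/
def tableaux {lam : I.PartitionTuple} (P : (I.tableauCrystal lam).V) (k : Fin I.r) : Tableau :=
  ⟨(lam k).1, (show SSYTIn (lam k).1 (I.lo k) (I.hi k) from P k).1⟩

end Cuts

/-! ### Bicrystals of matrices -/

section Bicrystal

variable {m n : ℕ}

/-- The cells of `M`, each listed as often as its entry says, read along columns from top to
bottom, left to right. -/
def rowCells (M : Matrix (Fin m) (Fin n) ℕ) : List (Fin m × Fin n) :=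
  (List.finRange n).flatMap fun j => (List.finRange m).flatMap fun i =>
    List.replicate (M i j) (i, j)

/-- The row word of `M`, in the letters `1, …, m`. -/
def rowWord (M : Matrix (Fin m) (Fin n) ℕ) : List ℕ := (rowCells M).map fun c => c.1.val + 1

/-- The column word of `M`, in the letters `1, …, n`, read along rows from left to right, top to
bottom. -/
def colWord (M : Matrix (Fin m) (Fin n) ℕ) : List ℕ :=
  (List.finRange m).flatMap fun i => (List.finRange n).flatMap fun j =>
    List.replicate (M i j) (j.val + 1)

/-- Move one unit from row `s` to row `t` of `M` within the column `a`. -/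
def moveUnit (M : Matrix (Fin m) (Fin n) ℕ) (s t : Fin m) (a : Fin n) :
    Matrix (Fin m) (Fin n) ℕ := fun x y =>
  if y = a then (if x = s then M x y - 1 else if x = t then M x y + 1 else M x y) else M x y

/-- The row crystal lowering operator `f_i^row` for `1 ≤ i ≤ m - 1`; `none` is the symbol `∅`
(and the value for other `i`). The row with number `i + 1` has index `i` in `Fin m`. -/
def rowLower (i : ℕ) (M : Matrix (Fin m) (Fin n) ℕ) : Option (Matrix (Fin m) (Fin n) ℕ) :=
  if h : 1 ≤ i ∧ i < m then
    (loweringPos i (rowWord M)).bind fun p =>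
      ((rowCells M)[p]?).map fun c => moveUnit M c.1 ⟨i, h.2⟩ c.2
  else none

/-- The row crystal raising operator `e_i^row`. -/
def rowRaise (i : ℕ) (M : Matrix (Fin m) (Fin n) ℕ) : Option (Matrix (Fin m) (Fin n) ℕ) :=
  if h : 1 ≤ i ∧ i < m then
    (raisingPos i (rowWord M)).bind fun p =>
      ((rowCells M)[p]?).map fun c => moveUnit M c.1 ⟨i - 1, by omega⟩ c.2
  else none

/-- The column crystal lowering operator `f_j^col`. -/
def colLower (j : ℕ) (M : Matrix (Fin m) (Fin n) ℕ) : Option (Matrix (Fin m) (Fin n) ℕ) :=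
  (rowLower j M.transpose).map Matrix.transpose

/-- The column crystal raising operator `e_j^col`. -/
def colRaise (j : ℕ) (M : Matrix (Fin m) (Fin n) ℕ) : Option (Matrix (Fin m) (Fin n) ℕ) :=
  (rowRaise j M.transpose).map Matrix.transpose

variable (m n) in
/-- The matrix bicrystal graph; the label `Sum.inl i` stands for `i^row`, the label `Sum.inr j` for
`j^col`. -/
def matrixBicrystal : PreCrystalGraph (ℕ ⊕ ℕ) where
  V := Matrix (Fin m) (Fin n) ℕ
  edge l M M' := match l with
    | .inl i => rowLower i M = some M'
    | .inr j => colLower j M = some M'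
  cwt M := content 1 m (rowWord M) ++ content 1 n (colWord M)

/-- The filtered matrix bicrystal graph: the edges `i^row` with `i ∈ I` and `j^col` with `j ∈ J`
are deleted. -/
def filteredBicrystal (I : Cuts m) (J : Cuts n) : PreCrystalGraph (ℕ ⊕ ℕ) where
  V := Matrix (Fin m) (Fin n) ℕ
  edge l M M' := (match l with
    | .inl i => i ∉ I.toSet
    | .inr j => j ∉ J.toSet) ∧ (matrixBicrystal m n).edge l M M'
  cwt := (matrixBicrystal m n).cwt

/-- Filtered RSK: the pair of tuples of tableaux that are Knuth equivalent to the components of the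
filtrations of the row word and of the column word. -/
noncomputable def filterRSK (I : Cuts m) (J : Cuts n) (M : Matrix (Fin m) (Fin n) ℕ) :
    (Fin I.r → Tableau) × (Fin J.r → Tableau) :=
  (fun k => knuthTableau (I.filterWord (rowWord M) k),
   fun k => knuthTableau (J.filterWord (colWord M) k))

/-! ### Varieties and standard monomials -/

/-- A set of matrices as a set of points of the affine space with coordinates `z_{ij}`. -/
def points (X : Set (Matrix (Fin m) (Fin n) ℂ)) : Set (Fin m × Fin n → ℂ) :=
  (fun (A : Matrix (Fin m) (Fin n) ℂ) p => A p.1 p.2) '' X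

/-- `X` is a (possibly reducible) affine variety: the zero set of some polynomials. -/
def IsVariety (X : Set (Matrix (Fin m) (Fin n) ℂ)) : Prop :=
  ∃ K : Ideal (MvPolynomial (Fin m × Fin n) ℂ), points X = MvPolynomial.zeroLocus ℂ K

/-- The initial ideal: the ideal generated by the lead terms of the elements of `K`. -/
noncomputable def initialIdeal (ord : MonomialOrder.{0, v} (Fin m × Fin n))
    (K : Ideal (MvPolynomial (Fin m × Fin n) ℂ)) : Ideal (MvPolynomial (Fin m × Fin n) ℂ) :=
  Ideal.span (ord.leadingTerm '' (K : Set (MvPolynomial (Fin m × Fin n) ℂ)))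

/-- The exponent matrices of the standard monomials of the coordinate ring of `X`, i.e. of the
monomials that do not lie in the initial ideal of the vanishing ideal of `X`. -/
def stdMonomials (ord : MonomialOrder.{0, v} (Fin m × Fin n))
    (X : Set (Matrix (Fin m) (Fin n) ℂ)) : Set (Matrix (Fin m) (Fin n) ℕ) :=
  {M | MvPolynomial.monomial (Finsupp.equivFunOnFinite.symm fun p : Fin m × Fin n => M p.1 p.2)
      (1 : ℂ) ∉ initialIdeal ord (MvPolynomial.vanishingIdeal ℂ (points X))}

/-- `X` is bicrystal closed for the block sequences `I`, `J`, as witnessed by the term order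
`ord`. -/
def IsBicrystalClosed (ord : MonomialOrder.{0, v} (Fin m × Fin n)) (I : Cuts m) (J : Cuts n)
    (X : Set (Matrix (Fin m) (Fin n) ℂ)) : Prop :=
  ∀ M ∈ stdMonomials ord X,
    (∀ i, i ∉ I.toSet → ∀ M', rowRaise i M = some M' ∨ rowLower i M = some M' →
      M' ∈ stdMonomials ord X) ∧
    (∀ j, j ∉ J.toSet → ∀ M', colRaise j M = some M' ∨ colLower j M = some M' →
      M' ∈ stdMonomials ord X)

/-- The pre-crystal graph `S_X`: the subgraph of the filtered matrix bicrystal graph induced on the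
standard monomials. -/
def stdGraph (ord : MonomialOrder.{0, v} (Fin m × Fin n)) (I : Cuts m) (J : Cuts n)
    (X : Set (Matrix (Fin m) (Fin n) ℂ)) : PreCrystalGraph (ℕ ⊕ ℕ) :=
  (filteredBicrystal I J).induce (stdMonomials ord X)

/-- The standard monomials that filtered RSK sends to the highest-weight tableau-tuple of shape
`(lam|mu)`. -/
def highestStd (ord : MonomialOrder.{0, v} (Fin m × Fin n)) (I : Cuts m) (J : Cuts n)
    (X : Set (Matrix (Fin m) (Fin n) ℂ)) (lam : I.PartitionTuple) (mu : J.PartitionTuple) :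
    Set (Matrix (Fin m) (Fin n) ℕ) :=
  {M ∈ stdMonomials ord X | filterRSK I J M = (I.highestTuple lam, J.highestTuple mu)}

/-- The multiplicity `c^X_{lam|mu}`. -/
noncomputable def stdMultiplicity (ord : MonomialOrder.{0, v} (Fin m × Fin n)) (I : Cuts m)
    (J : Cuts n) (X : Set (Matrix (Fin m) (Fin n) ℂ)) (lam : I.PartitionTuple)
    (mu : J.PartitionTuple) : ℕ :=
  (highestStd ord I J X lam mu).ncard

/-- `M` has highest weight: it is a source of the filtered matrix bicrystal graph. -/
def IsHighestWeight (I : Cuts m) (J : Cuts n) (M : Matrix (Fin m) (Fin n) ℕ) : Prop :=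
  (filteredBicrystal I J).IsSource M

/-- `M` has shape `(lam|mu)`: the tableaux of its filtered RSK image have these shapes. -/
def HasShape (I : Cuts m) (J : Cuts n) (M : Matrix (Fin m) (Fin n) ℕ)
    (lam : I.PartitionTuple) (mu : J.PartitionTuple) : Prop :=
  (∀ k, ((filterRSK I J M).1 k).1 = (lam k).1) ∧ ∀ k, ((filterRSK I J M).2 k).1 = (mu k).1

/-- The direct sum over all pairs of partition-tuples `(lam|mu)` of `c lam mu` copies of
`B_{lam,m} □ B_{mu,n}`. -/
def tableauGraph (I : Cuts m) (J : Cuts n) (c : I.PartitionTuple → J.PartitionTuple → ℕ) :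
    PreCrystalGraph (ℕ ⊕ ℕ) :=
  PreCrystalGraph.directSum fun s : I.PartitionTuple × J.PartitionTuple =>
    PreCrystalGraph.copies (c s.1 s.2)
      (PreCrystalGraph.box (I.tableauCrystal s.1) (J.tableauCrystal s.2))

/-- The pair of tuples of tableaux named by a vertex of this direct sum (forgetting in which copy
it lies). -/
def tableauPair {I : Cuts m} {J : Cuts n} {c : I.PartitionTuple → J.PartitionTuple → ℕ}
    (x : (tableauGraph I J c).V) : (Fin I.r → Tableau) × (Fin J.r → Tableau) :=
  match x with
  | ⟨_, _, P, Q⟩ => (I.tableaux P, J.tableaux Q)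

end Bicrystal

/-! Bicrystal closedness says that the standard monomials form a set `S` of matrices stable under
the raising and lowering operators of both directions; the decomposition is proved for every such
`S`. Filtered RSK commutes with the operators, separates the points of each connected component, and
maps each component inside `S` onto a full product of tableau crystals. Each component then contains
exactly one highest-weight matrix, and counting these gives the multiplicities.

On words, a Knuth move at a fixed position is a partial bijection commuting with all crystal
operators (`KnuthAt.crystalBisimulation`). The reading words of a given shape are stable under the
operators, and a highest-weight word is Knuth equivalent to the reading word of a highest-weight
tableau whose shape is dictated by its content. Raising to highest weight, with the sum of the
letters as measure, gives existence and uniqueness of the tableau of a Knuth class without any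
insertion algorithm. Transporting paths along the partial bijections shows that a word is determined
by its tableau and its component (`WordConnected.eq_of_knuthEquiv`).

On matrices, the operator for two adjacent rows acts in the first column where a height function is
maximal. For two adjacent rows and two adjacent columns, the relevant increments of the row height
and of the column height are opposite numbers, and this makes row operators commute with column
operators, also when reversed (`rowLower_comm_val`, `exists_common_source`). Hence column operators
preserve the Knuth class of the row word: raise in the row direction on both ends of a column step
until neither can be raised, and there equal content suffices (`knuthEquiv_rowWord_of_colLower`). So
row steps change only the row tableaux and column steps only the column tableaux.

By commutation every path can be rearranged into row steps followed by column steps, which reduces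
injectivity on components to one direction at a time (`Biconnected.eq_of_filterRSK_eq`). Blocks of
letters cause no further trouble, since operators with index outside the cuts act on one filtered
subword and leave the others alone. The isomorphism pairs a matrix with the tableaux that filtered
RSK assigns to it, in the copy named by the highest-weight matrix of its component (`Corresponds`).
-/

/-! ### Signatures of words -/

/-- Number of unmatched closing brackets in the `i`-th bracket word. -/
def wordPhi (i : ℕ) : List ℕ → ℕ
  | [] => 0
  | x :: w => if x = i + 1 then wordPhi i w - 1 else if x = i then wordPhi i w + 1 else wordPhi i w

/-- Number of unmatched opening brackets in the `i`-th bracket word. -/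
def wordEps (i : ℕ) : List ℕ → ℕ
  | [] => 0
  | x :: w => if x = i + 1 then wordEps i w + (1 - wordPhi i w) else wordEps i w

@[simp] theorem wordPhi_nil (i : ℕ) : wordPhi i [] = 0 := rfl
@[simp] theorem wordEps_nil (i : ℕ) : wordEps i [] = 0 := rfl

theorem wordPhi_cons (i x : ℕ) (w : List ℕ) : wordPhi i (x :: w) =
    if x = i + 1 then wordPhi i w - 1 else if x = i then wordPhi i w + 1 else wordPhi i w := rfl

theorem wordEps_cons (i x : ℕ) (w : List ℕ) : wordEps i (x :: w) =
    if x = i + 1 then wordEps i w + (1 - wordPhi i w) else wordEps i w := rfl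

@[simp] theorem wordPhi_cons_open (i : ℕ) (w : List ℕ) :
    wordPhi i ((i + 1) :: w) = wordPhi i w - 1 := by simp [wordPhi_cons]
@[simp] theorem wordPhi_cons_close (i : ℕ) (w : List ℕ) :
    wordPhi i (i :: w) = wordPhi i w + 1 := by simp [wordPhi_cons]
@[simp] theorem wordEps_cons_open (i : ℕ) (w : List ℕ) :
    wordEps i ((i + 1) :: w) = wordEps i w + (1 - wordPhi i w) := by simp [wordEps_cons]
@[simp] theorem wordEps_cons_close (i : ℕ) (w : List ℕ) :
    wordEps i (i :: w) = wordEps i w := by simp [wordEps_cons]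

/-- Unmatched openings of the left word cancel against unmatched closings of the right word; the
truncated differences are what remains on either side. The two counts are proved together because
the recursion for `wordEps` involves `wordPhi`. -/
theorem word_signature_append (i : ℕ) (u w : List ℕ) :
    wordPhi i (u ++ w) = wordPhi i u + (wordPhi i w - wordEps i u) ∧
      wordEps i (u ++ w) = wordEps i w + (wordEps i u - wordPhi i w) := by
  induction u with
  | nil => simp
  | cons x u ih =>
    obtain ⟨h1, h2⟩ := ih
    simp only [List.cons_append, wordPhi_cons, wordEps_cons, h1, h2]
    split_ifs <;> omega

theorem wordPhi_append (i : ℕ) (u w : List ℕ) :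
    wordPhi i (u ++ w) = wordPhi i u + (wordPhi i w - wordEps i u) :=
  (word_signature_append i u w).1

theorem wordEps_append (i : ℕ) (u w : List ℕ) :
    wordEps i (u ++ w) = wordEps i w + (wordEps i u - wordPhi i w) :=
  (word_signature_append i u w).2

theorem word_signature_eq_zero {i : ℕ} {w : List ℕ} (h : ∀ x ∈ w, x ≠ i ∧ x ≠ i + 1) :
    wordPhi i w = 0 ∧ wordEps i w = 0 := by
  induction w with
  | nil => simp
  | cons x w ih =>
    have hx := h x (by simp)
    have := ih fun y hy => h y (by simp [hy])
    simp [wordPhi_cons, wordEps_cons, hx.1, hx.2, this]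

theorem wordPhi_eq_zero_of_notMem {i : ℕ} {w : List ℕ} (h : i ∉ w) : wordPhi i w = 0 := by
  induction w with
  | nil => simp
  | cons x w ih =>
    simp only [List.mem_cons, not_or] at h
    simp [wordPhi_cons, Ne.symm h.1, ih h.2]

theorem wordEps_eq_zero_of_notMem {i : ℕ} {w : List ℕ} (h : i + 1 ∉ w) : wordEps i w = 0 := by
  induction w with
  | nil => simp
  | cons x w ih =>
    simp only [List.mem_cons, not_or] at h
    simp [wordEps_cons, Ne.symm h.1, ih h.2]

/-- Both signature counts only see the letters `i` and `i + 1`. -/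
theorem word_signature_filter {i : ℕ} {p : ℕ → Bool} (h0 : p i = true) (h1 : p (i + 1) = true)
    (w : List ℕ) :
    wordPhi i (w.filter p) = wordPhi i w ∧ wordEps i (w.filter p) = wordEps i w := by
  induction w with
  | nil => simp
  | cons x w ih =>
    by_cases hx : p x
    · simp [hx, wordPhi_cons, wordEps_cons, ih]
    · have hi : x ≠ i := by rintro rfl; exact hx h0
      have hi' : x ≠ i + 1 := by rintro rfl; exact hx h1
      simp [hx, wordPhi_cons, wordEps_cons, ih, hi, hi']

/-- The crystal lowering operator as a relation. -/
def WordLower (i : ℕ) (w w' : List ℕ) : Prop :=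
  ∃ u t, w = u ++ i :: t ∧ w' = u ++ (i + 1) :: t ∧ wordEps i u = 0 ∧ wordPhi i t = 0

theorem exists_split_of_wordPhi_pos {i : ℕ} {w : List ℕ} (h : 0 < wordPhi i w) :
    ∃ u t, w = u ++ i :: t ∧ wordEps i u = 0 ∧ wordPhi i t = 0 := by
  induction w with
  | nil => simp at h
  | cons x w ih =>
    by_cases hw : wordPhi i w = 0
    · refine ⟨[], w, ?_, rfl, hw⟩
      have : x = i := by
        by_contra hx
        simp only [wordPhi_cons, hw, hx] at h
        split_ifs at h; all_goals omega
      rw [this]; rfl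
    · obtain ⟨u, t, rfl, hu, ht⟩ := ih (by omega)
      refine ⟨x :: u, t, rfl, ?_, ht⟩
      rw [wordEps_cons]
      split_ifs with hx
      -- Positivity in `h` forces an unmatched closing bracket inside `u`, and this one absorbs the
      -- new opening bracket.
      · subst hx
        simp [wordPhi_append, ht, hu] at h
        omega
      · exact hu

theorem exists_split_of_wordEps_pos {i : ℕ} {w : List ℕ} (h : 0 < wordEps i w) :
    ∃ u t, w = u ++ (i + 1) :: t ∧ wordEps i u = 0 ∧ wordPhi i t = 0 := by
  induction w with
  | nil => simp at h
  | cons x w ih =>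
    by_cases hx : x = i + 1 ∧ wordPhi i w = 0
    · exact ⟨[], w, by rw [hx.1]; rfl, rfl, hx.2⟩
    · have hw : 0 < wordEps i w := by
        rw [wordEps_cons] at h
        split_ifs at h with h1
        · have : wordPhi i w ≠ 0 := fun h2 => hx ⟨h1, h2⟩
          omega
        · exact h
      obtain ⟨u, t, rfl, hu, ht⟩ := ih hw
      refine ⟨x :: u, t, rfl, ?_, ht⟩
      rw [wordEps_cons]
      split_ifs with h1
      · have : wordPhi i (u ++ (i + 1) :: t) ≠ 0 := fun h2 => hx ⟨h1, h2⟩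
        simp [wordPhi_append, ht, hu] at this
        omega
      · exact hu

/-! ### Bracket scans in terms of signatures -/

theorem foldl_bracketStep_close {i : ℕ} {w : List ℕ} : ∀ {p : ℕ} {ops cl : List ℕ},
    wordPhi i w ≤ ops.length → (w.foldl (bracketStep i) (p, ops, cl)).2.2 = cl := by
  induction w with
  | nil => intros; rfl
  | cons x w ih =>
    intro p ops cl h
    rw [wordPhi_cons] at h
    simp only [List.foldl_cons, bracketStep]
    split_ifs at h ⊢ with h1 h2
    · exact ih (by simp; omega)
    · cases ops with
      | nil => simp at h
      | cons o ops => exact ih (by simpa using h)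
    · exact ih h

/-- Closing brackets pop the stack from the front, so its last entry `q` is consumed only after all
of `ops`; new openings are also pushed in front of it. -/
theorem foldl_bracketStep_open {i : ℕ} {w : List ℕ} : ∀ {p q : ℕ} {ops cl : List ℕ},
    wordPhi i w ≤ ops.length →
      (w.foldl (bracketStep i) (p, ops ++ [q], cl)).2.1.getLast? = some q := by
  induction w with
  | nil => intros; simp
  | cons x w ih =>
    intro p q ops cl h
    rw [wordPhi_cons] at h
    simp only [List.foldl_cons, bracketStep]
    split_ifs at h ⊢ with h1 h2
    · exact ih (ops := p :: ops) (by simp; omega)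
    · cases ops with
      | nil => simp at h
      | cons o ops => exact ih (by simpa using h)
    · exact ih h

theorem foldl_bracketStep_length {i : ℕ} {w : List ℕ} : ∀ {p : ℕ} {ops cl : List ℕ},
    (w.foldl (bracketStep i) (p, ops, cl)).2.1.length =
      wordEps i w + (ops.length - wordPhi i w) ∧
    (w.foldl (bracketStep i) (p, ops, cl)).1 = p + w.length := by
  induction w with
  | nil => intros; simp
  | cons x w ih =>
    intro p ops cl
    simp only [List.foldl_cons, bracketStep, wordPhi_cons, wordEps_cons]
    split_ifs with h1 h2
    · rw [ih.1, ih.2]; simp; omega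
    · cases ops with
      | nil => rw [ih.1, ih.2]; simp; omega
      | cons o ops => rw [ih.1, ih.2]; simp; omega
    · rw [ih.1, ih.2]; simp; omega

theorem loweringPos_split {i : ℕ} {u t : List ℕ} (hu : wordEps i u = 0) (ht : wordPhi i t = 0) :
    loweringPos i (u ++ i :: t) = some u.length := by
  have hlen := foldl_bracketStep_length (i := i) (w := u) (p := 0) (ops := []) (cl := [])
  simp only [List.length_nil, Nat.zero_sub, hu, Nat.zero_add, List.length_eq_zero_iff] at hlen
  unfold loweringPos bracketScan
  rw [List.foldl_append, List.foldl_cons]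
  generalize hs : List.foldl (bracketStep i) (0, [], []) u = s at hlen
  obtain ⟨p, ops, cl⟩ := s
  simp only at hlen
  obtain ⟨rfl, rfl⟩ := hlen
  have : bracketStep i (u.length, [], cl) i = (u.length + 1, [], u.length :: cl) := by
    simp [bracketStep]
  rw [this, foldl_bracketStep_close (by omega)]
  rfl

theorem raisingPos_split {i : ℕ} {u t : List ℕ} (hu : wordEps i u = 0) (ht : wordPhi i t = 0) :
    raisingPos i (u ++ (i + 1) :: t) = some u.length := by
  have hlen := foldl_bracketStep_length (i := i) (w := u) (p := 0) (ops := []) (cl := [])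
  simp only [List.length_nil, Nat.zero_sub, hu, Nat.zero_add, List.length_eq_zero_iff] at hlen
  unfold raisingPos bracketScan
  rw [List.foldl_append, List.foldl_cons]
  generalize hs : List.foldl (bracketStep i) (0, [], []) u = s at hlen
  obtain ⟨p, ops, cl⟩ := s
  simp only at hlen
  obtain ⟨rfl, rfl⟩ := hlen
  have : bracketStep i (u.length, [], cl) (i + 1) = (u.length + 1, [] ++ [u.length], cl) := by
    simp [bracketStep]
  rw [this, foldl_bracketStep_open (by omega)]

theorem loweringPos_eq_some_iff {i p : ℕ} {w : List ℕ} : loweringPos i w = some p ↔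
    ∃ u t, w = u ++ i :: t ∧ u.length = p ∧ wordEps i u = 0 ∧ wordPhi i t = 0 := by
  constructor
  · intro h
    by_cases hw : wordPhi i w = 0
    · have := foldl_bracketStep_close (i := i) (w := w) (p := 0) (ops := []) (cl := []) (by omega)
      simp [loweringPos, bracketScan, this] at h
    · obtain ⟨u, t, rfl, hu, ht⟩ := exists_split_of_wordPhi_pos (Nat.pos_of_ne_zero hw)
      rw [loweringPos_split hu ht] at h
      exact ⟨u, t, rfl, by simpa using h, hu, ht⟩
  · rintro ⟨u, t, rfl, rfl, hu, ht⟩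
    exact loweringPos_split hu ht

theorem raisingPos_eq_some_iff {i p : ℕ} {w : List ℕ} : raisingPos i w = some p ↔
    ∃ u t, w = u ++ (i + 1) :: t ∧ u.length = p ∧ wordEps i u = 0 ∧ wordPhi i t = 0 := by
  constructor
  · intro h
    by_cases hw : wordEps i w = 0
    · have := (foldl_bracketStep_length (i := i) (w := w) (p := 0) (ops := []) (cl := [])).1
      simp only [hw, List.length_nil, Nat.zero_sub, Nat.zero_add, List.length_eq_zero_iff] at this
      simp [raisingPos, bracketScan, this] at h
    · obtain ⟨u, t, rfl, hu, ht⟩ := exists_split_of_wordEps_pos (Nat.pos_of_ne_zero hw)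
      rw [raisingPos_split hu ht] at h
      exact ⟨u, t, rfl, by simpa using h, hu, ht⟩
  · rintro ⟨u, t, rfl, rfl, hu, ht⟩
    exact raisingPos_split hu ht

/-- Positions are traded here for splittings. The same splitting describes the letter altered by
lowering in `w` and the letter altered by raising in `w'`, so the two operators become one relation
read in two directions. -/
theorem wordLower_eq_some_iff {i : ℕ} {w w' : List ℕ} :
    wordLower i w = some w' ↔ WordLower i w w' := by
  unfold wordLower WordLower
  rw [Option.map_eq_some_iff]
  constructor
  · rintro ⟨p, hp, rfl⟩
    obtain ⟨u, t, rfl, rfl, hu, ht⟩ := loweringPos_eq_some_iff.1 hp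
    exact ⟨u, t, rfl, by simp, hu, ht⟩
  · rintro ⟨u, t, rfl, rfl, hu, ht⟩
    exact ⟨_, loweringPos_split hu ht, by simp⟩

namespace WordLower

variable {i : ℕ} {w w' w₁ w₂ : List ℕ}

theorem right_unique (h₁ : WordLower i w w₁) (h₂ : WordLower i w w₂) : w₁ = w₂ := by
  rw [← wordLower_eq_some_iff] at h₁ h₂
  simpa [h₁] using h₂

theorem left_unique (h₁ : WordLower i w₁ w) (h₂ : WordLower i w₂ w) : w₁ = w₂ := by
  obtain ⟨u, t, rfl, rfl, hu, ht⟩ := h₁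
  obtain ⟨u', t', rfl, h, hu', ht'⟩ := h₂
  have h1 := raisingPos_split hu ht
  have h2 := raisingPos_split hu' ht'
  rw [h, h2] at h1
  have hl : u.length = u'.length := by simpa using h1.symm
  obtain ⟨rfl, h'⟩ := List.append_inj h hl
  simp only [List.cons.injEq, true_and] at h'
  rw [h']

theorem wordPhi_pos (h : WordLower i w w') : 0 < wordPhi i w := by
  obtain ⟨u, t, rfl, rfl, hu, ht⟩ := h
  simp [wordPhi_append, hu, ht]

theorem wordEps_pos (h : WordLower i w w') : 0 < wordEps i w' := by
  obtain ⟨u, t, rfl, rfl, hu, ht⟩ := h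
  simp [wordEps_append, hu, ht]

/-- This supplies the measure for the inductions that climb to highest weight: raising decreases the
sum of the letters. -/
theorem sum_eq (h : WordLower i w w') : w'.sum = w.sum + 1 := by
  obtain ⟨u, t, rfl, rfl, hu, ht⟩ := h
  simp; omega

theorem filter {p : ℕ → Bool} (h : WordLower i w w') (h0 : p i = true) (h1 : p (i + 1) = true) :
    WordLower i (w.filter p) (w'.filter p) := by
  obtain ⟨u, t, rfl, rfl, hu, ht⟩ := h
  refine ⟨u.filter p, t.filter p, by simp [h0], by simp [h1],
    ?_, ?_⟩
  · rw [(word_signature_filter h0 h1 u).2, hu]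
  · rw [(word_signature_filter h0 h1 t).1, ht]

theorem filter_eq {p : ℕ → Bool} (h : WordLower i w w') (h0 : p i = false)
    (h1 : p (i + 1) = false) : w.filter p = w'.filter p := by
  obtain ⟨u, t, rfl, rfl, hu, ht⟩ := h
  simp [h0, h1]

theorem forall_mem_iff {P : ℕ → Prop} (h : WordLower i w w') (h0 : P i) (h1 : P (i + 1)) :
    (∀ x ∈ w, P x) ↔ ∀ x ∈ w', P x := by
  obtain ⟨u, t, rfl, rfl, -, -⟩ := h
  simp [or_imp, forall_and, h0, h1]

end WordLower

theorem exists_wordLower_iff {i : ℕ} {w : List ℕ} :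
    (∃ w', WordLower i w w') ↔ 0 < wordPhi i w := by
  refine ⟨fun ⟨_, h⟩ => h.wordPhi_pos, fun h => ?_⟩
  obtain ⟨u, t, rfl, hu, ht⟩ := exists_split_of_wordPhi_pos h
  exact ⟨_, u, t, rfl, rfl, hu, ht⟩

theorem exists_wordLower_to_iff {i : ℕ} {w : List ℕ} :
    (∃ w', WordLower i w' w) ↔ 0 < wordEps i w := by
  refine ⟨fun ⟨_, h⟩ => h.wordEps_pos, fun h => ?_⟩
  obtain ⟨u, t, rfl, hu, ht⟩ := exists_split_of_wordEps_pos h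
  exact ⟨_, u, t, rfl, rfl, hu, ht⟩

/-! ### Knuth moves and crystal operators -/

/-- Knuth moves on three-letter words, directed so that the descent moves to the left. -/
inductive KnuthTriple : List ℕ → List ℕ → Prop
  | left (x y z : ℕ) (hxy : x < y) (hyz : y ≤ z) : KnuthTriple [y, z, x] [y, x, z]
  | right (x y z : ℕ) (hxy : x ≤ y) (hyz : y < z) : KnuthTriple [x, z, y] [z, x, y]

namespace KnuthTriple

variable {t t' t₁ t₂ : List ℕ}

theorem length_left (h : KnuthTriple t t') : t.length = 3 := by cases h <;> rfl
theorem length_right (h : KnuthTriple t t') : t'.length = 3 := by cases h <;> rfl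

/-- The order of the first and third letters tells the two kinds of move apart. Fixing the direction
of the descent is what makes the moves single-valued. -/
theorem right_unique (h₁ : KnuthTriple t t₁) (h₂ : KnuthTriple t t₂) : t₁ = t₂ := by
  cases h₁ <;> cases h₂ <;> first | rfl | omega

theorem left_unique (h₁ : KnuthTriple t₁ t) (h₂ : KnuthTriple t₂ t) : t₁ = t₂ := by
  cases h₁ <;> cases h₂ <;> first | rfl | omega

theorem perm (h : KnuthTriple t t') : t.Perm t' := by
  cases h with
  | left x y z => exact (List.Perm.swap _ _ _).cons _
  | right x y z => exact List.Perm.swap _ _ _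

theorem signature_eq (h : KnuthTriple t t') (i : ℕ) :
    wordPhi i t = wordPhi i t' ∧ wordEps i t = wordEps i t' := by
  cases h <;> simp only [wordPhi_cons, wordEps_cons, wordPhi_nil, wordEps_nil] <;>
    split_ifs <;> omega

theorem signature_append_eq (h : KnuthTriple t t') (i : ℕ) (u s : List ℕ) :
    wordPhi i (u ++ t ++ s) = wordPhi i (u ++ t' ++ s) ∧
      wordEps i (u ++ t ++ s) = wordEps i (u ++ t' ++ s) := by
  simp [wordPhi_append, wordEps_append, h.signature_eq]

/-- Only the order of the three letters and their coincidences with `i` and `i + 1` matter, so this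
is a finite check. The alternative `hab` treats lowering and raising at once. -/
theorem exists_modify (h : KnuthTriple t t') {i a b : ℕ} {u s s₁ s₂ : List ℕ}
    (hab : (a = i ∧ b = i + 1) ∨ (a = i + 1 ∧ b = i))
    (ht : t = s₁ ++ a :: s₂) (hu : wordEps i (u ++ s₁) = 0) (hs : wordPhi i (s₂ ++ s) = 0) :
    ∃ s₁' s₂', t' = s₁' ++ a :: s₂' ∧ wordEps i (u ++ s₁') = 0 ∧ wordPhi i (s₂' ++ s) = 0 ∧
      KnuthTriple (s₁ ++ b :: s₂) (s₁' ++ b :: s₂') := by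
  have key : ∀ x y z : ℕ, t' = [x, y, z] →
      (x = a ∧ wordEps i u = 0 ∧ wordPhi i (y :: z :: s) = 0 ∧
        KnuthTriple (s₁ ++ b :: s₂) [b, y, z]) ∨
      (y = a ∧ wordEps i (u ++ [x]) = 0 ∧ wordPhi i (z :: s) = 0 ∧
        KnuthTriple (s₁ ++ b :: s₂) [x, b, z]) ∨
      (z = a ∧ wordEps i (u ++ [x, y]) = 0 ∧ wordPhi i s = 0 ∧
        KnuthTriple (s₁ ++ b :: s₂) [x, y, b]) → 
      ∃ s₁' s₂', t' = s₁' ++ a :: s₂' ∧ wordEps i (u ++ s₁') = 0 ∧ wordPhi i (s₂' ++ s) = 0 ∧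
        KnuthTriple (s₁ ++ b :: s₂) (s₁' ++ b :: s₂') := by
    rintro x y z rfl (⟨rfl, h⟩ | ⟨rfl, h⟩ | ⟨rfl, h⟩)
    · exact ⟨[], [y, z], rfl, by simpa using h⟩
    · exact ⟨[x], [z], rfl, by simpa using h⟩
    · exact ⟨[x, y], [], rfl, by simpa using h⟩
  -- Rewriting the inductive relation as linear inequalities lets `omega` settle every case.
  have conv : ∀ a b c x y z : ℕ, KnuthTriple [a, b, c] [x, y, z] ↔
      (c < a ∧ a ≤ b ∧ x = a ∧ y = c ∧ z = b) ∨ (a ≤ c ∧ c < b ∧ x = b ∧ y = a ∧ z = c) := by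
    intro a b c x y z
    constructor
    · rintro (h | h) <;> omega
    · rintro (⟨h1, h2, rfl, rfl, rfl⟩ | ⟨h1, h2, rfl, rfl, rfl⟩)
      · exact .left _ _ _ h1 h2
      · exact .right _ _ _ h1 h2
  have tri : ∀ x : ℕ, x = i ∨ x = i + 1 ∨ (x ≠ i ∧ x ≠ i + 1) := by omega
  cases h with
  | left x y z hxy hyz =>
    apply key _ _ _ rfl
    rcases s₁ with _ | ⟨c, _ | ⟨d, _ | ⟨e, s₁⟩⟩⟩
    · obtain ⟨rfl, rfl⟩ : y = a ∧ [z, x] = s₂ := by simpa using ht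
      rcases hab with ⟨h1, rfl⟩ | ⟨h1, rfl⟩ <;> rcases tri x with hx | hx | hx <;>
        rcases tri y with hy | hy | hy <;> rcases tri z with hz | hz | hz <;> first
        | omega
        | (simp [conv, wordPhi_cons, wordEps_append, wordEps_cons, hx, hy, hz] at hu hs ⊢ <;> omega)
    · obtain ⟨rfl, rfl, rfl⟩ : y = c ∧ z = a ∧ [x] = s₂ := by simpa using ht
      rcases hab with ⟨h1, rfl⟩ | ⟨h1, rfl⟩ <;> rcases tri x with hx | hx | hx <;>
        rcases tri y with hy | hy | hy <;> rcases tri z with hz | hz | hz <;> first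
        | omega
        | (simp [conv, wordPhi_cons, wordEps_append, wordEps_cons, hx, hy, hz] at hu hs ⊢ <;> omega)
    · obtain ⟨rfl, rfl, rfl, rfl⟩ : y = c ∧ z = d ∧ x = a ∧ [] = s₂ := by
        simpa using ht
      rcases hab with ⟨h1, rfl⟩ | ⟨h1, rfl⟩ <;> rcases tri x with hx | hx | hx <;>
        rcases tri y with hy | hy | hy <;> rcases tri z with hz | hz | hz <;> first
        | omega
        | (simp [conv, wordPhi_cons, wordEps_append, wordEps_cons, hx, hy, hz] at hu hs ⊢ <;> omega)
    · simp at ht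
  | right x y z hxy hyz =>
    apply key _ _ _ rfl
    rcases s₁ with _ | ⟨c, _ | ⟨d, _ | ⟨e, s₁⟩⟩⟩
    · obtain ⟨rfl, rfl⟩ : x = a ∧ [z, y] = s₂ := by simpa using ht
      rcases hab with ⟨h1, rfl⟩ | ⟨h1, rfl⟩ <;> rcases tri x with hx | hx | hx <;>
        rcases tri y with hy | hy | hy <;> rcases tri z with hz | hz | hz <;> first
        | omega
        | (simp [conv, wordPhi_cons, wordEps_append, wordEps_cons, hx, hy, hz] at hu hs ⊢ <;> omega)
    · obtain ⟨rfl, rfl, rfl⟩ : x = c ∧ z = a ∧ [y] = s₂ := by simpa using ht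
      rcases hab with ⟨h1, rfl⟩ | ⟨h1, rfl⟩ <;> rcases tri x with hx | hx | hx <;>
        rcases tri y with hy | hy | hy <;> rcases tri z with hz | hz | hz <;> first
        | omega
        | (simp [conv, wordPhi_cons, wordEps_append, wordEps_cons, hx, hy, hz] at hu hs ⊢ <;> omega)
    · obtain ⟨rfl, rfl, rfl, rfl⟩ : x = c ∧ z = d ∧ y = a ∧ [] = s₂ := by
        simpa using ht
      rcases hab with ⟨h1, rfl⟩ | ⟨h1, rfl⟩ <;> rcases tri x with hx | hx | hx <;>
        rcases tri y with hy | hy | hy <;> rcases tri z with hz | hz | hz <;> first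
        | omega
        | (simp [conv, wordPhi_cons, wordEps_append, wordEps_cons, hx, hy, hz] at hu hs ⊢ <;> omega)
    · simp at ht

end KnuthTriple

/-- A directed Knuth move on the three letters that follow the first `p` letters. -/
def KnuthAt (p : ℕ) (w w' : List ℕ) : Prop :=
  ∃ u t t' s, u.length = p ∧ w = u ++ t ++ s ∧ w' = u ++ t' ++ s ∧ KnuthTriple t t'

namespace KnuthAt

variable {p i : ℕ} {w w' v v' v₁ v₂ : List ℕ}

theorem right_unique (h₁ : KnuthAt p w v₁) (h₂ : KnuthAt p w v₂) : v₁ = v₂ := by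
  obtain ⟨u, t, t', s, hu, rfl, rfl, ht⟩ := h₁
  obtain ⟨u₁, t₁, t₁', s₁, hu₁, h, rfl, ht₁⟩ := h₂
  obtain ⟨h', rfl⟩ := List.append_inj h (by simp [hu, hu₁, ht.length_left, ht₁.length_left])
  obtain ⟨rfl, rfl⟩ := List.append_inj h' (by rw [hu, hu₁])
  rw [ht.right_unique ht₁]

theorem left_unique (h₁ : KnuthAt p v₁ w) (h₂ : KnuthAt p v₂ w) : v₁ = v₂ := by
  obtain ⟨u, t, t', s, hu, rfl, rfl, ht⟩ := h₁
  obtain ⟨u₁, t₁, t₁', s₁, hu₁, rfl, h, ht₁⟩ := h₂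
  obtain ⟨h', rfl⟩ := List.append_inj h (by simp [hu, hu₁, ht.length_right, ht₁.length_right])
  obtain ⟨rfl, rfl⟩ := List.append_inj h' (by rw [hu, hu₁])
  rw [ht.left_unique ht₁]

theorem knuthEquiv (h : KnuthAt p w v) : KnuthEquiv w v := by
  obtain ⟨u, t, t', s, -, rfl, rfl, ht⟩ := h
  cases ht with
  | left x y z hxy hyz => exact .rel _ _ (.left u s x y z hxy hyz)
  | right x y z hxy hyz => exact .symm _ _ (.rel _ _ (.right u s x y z hxy hyz))

theorem signature_eq (h : KnuthAt p w v) (i : ℕ) :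
    wordPhi i w = wordPhi i v ∧ wordEps i w = wordEps i v := by
  obtain ⟨u, t, t', s, -, rfl, rfl, ht⟩ := h
  exact ht.signature_append_eq i u s

/-- An altered letter outside the triple stays in place, because the move does not change the
signature of its surroundings; an altered letter inside is handled by the three-letter case. -/
theorem exists_modify {a b : ℕ} {x y : List ℕ} (hab : (a = i ∧ b = i + 1) ∨ (a = i + 1 ∧ b = i))
    (h : KnuthAt p w v) (hw : w = x ++ a :: y) (hx : wordEps i x = 0) (hy : wordPhi i y = 0) :
    ∃ x' y', v = x' ++ a :: y' ∧ wordEps i x' = 0 ∧ wordPhi i y' = 0 ∧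
      KnuthAt p (x ++ b :: y) (x' ++ b :: y') := by
  obtain ⟨u, t, t', s, hu, rfl, rfl, ht⟩ := h
  rw [List.append_assoc, List.append_eq_append_iff] at hw
  rcases hw with ⟨z, rfl, hz⟩ | ⟨z, rfl, hz⟩
  · rw [List.append_eq_append_iff] at hz
    rcases hz with ⟨z', rfl, hz'⟩ | ⟨z', rfl, hz'⟩
    · refine ⟨u ++ t' ++ z', y, by simp [hz'], ?_, hy, ?_⟩
      · rw [← hx, ← List.append_assoc, (ht.signature_append_eq i u z').2]
      · exact ⟨u, t, t', z' ++ b :: y, hu, by simp, by simp, ht⟩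
    · cases z' with
      | nil =>
        simp only [List.nil_append] at hz'
        refine ⟨u ++ t', y, by simp [← hz'], ?_, hy, ?_⟩
        · have := (ht.signature_append_eq i u []).2
          simp only [List.append_nil] at this hx ⊢
          rw [← this, hx]
        · exact ⟨u, _, t', b :: y, hu, by simp, by simp, ht⟩
      | cons c z' =>
        simp only [List.cons_append, List.cons.injEq] at hz'
        obtain ⟨rfl, rfl⟩ := hz'
        obtain ⟨s₁, s₂, rfl, h1, h2, h3⟩ := ht.exists_modify hab rfl hx hy
        exact ⟨u ++ s₁, s₂ ++ s, by simp, h1, h2, u, _, _, s, hu, by simp, by simp, h3⟩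
  · cases z with
    | nil =>
      simp only [List.nil_append] at hz hx
      cases t with
      | nil => simpa using ht.length_left
      | cons c t =>
        simp only [List.cons_append, List.cons.injEq] at hz
        obtain ⟨rfl, rfl⟩ := hz
        obtain ⟨s₁, s₂, rfl, h1, h2, h3⟩ :=
          ht.exists_modify (s₁ := []) (u := x) hab rfl (by simpa using hx) hy
        exact ⟨x ++ s₁, s₂ ++ s, by simp, h1, h2, x, _, _, s, by simpa using hu, by simp, by simp, h3⟩
    | cons c z =>
      simp only [List.cons_append, List.cons.injEq] at hz
      obtain ⟨rfl, rfl⟩ := hz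
      refine ⟨x, z ++ t' ++ s, by simp, hx, ?_, ?_⟩
      · rw [← hy, ← (ht.signature_append_eq i z s).1, List.append_assoc]
      · exact ⟨x ++ b :: z, t, t', s, by simpa using hu, by simp, by simp, ht⟩

theorem exists_wordLower (h : KnuthAt p w v) (hw : WordLower i w w') :
    ∃ v', WordLower i v v' ∧ KnuthAt p w' v' := by
  obtain ⟨x, y, hw, rfl, hx, hy⟩ := hw
  obtain ⟨x', y', rfl, hx', hy', hk⟩ := h.exists_modify (.inl ⟨rfl, rfl⟩) hw hx hy
  exact ⟨_, ⟨x', y', rfl, rfl, hx', hy'⟩, hk⟩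

theorem exists_wordRaise (h : KnuthAt p w v) (hw : WordLower i w' w) :
    ∃ v', WordLower i v' v ∧ KnuthAt p w' v' := by
  obtain ⟨x, y, rfl, hw, hx, hy⟩ := hw
  obtain ⟨x', y', rfl, hx', hy', hk⟩ := h.exists_modify (.inr ⟨rfl, rfl⟩) hw hx hy
  exact ⟨_, ⟨x', y', rfl, rfl, hx', hy'⟩, hk⟩

end KnuthAt

/-- A partial bijection between words that is compatible with all crystal operators and whose graph
consists of Knuth equivalent pairs. -/
structure CrystalBisimulation (θ : List ℕ → List ℕ → Prop) : Prop where
  right_unique : ∀ {w v v'}, θ w v → θ w v' → v = v'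
  left_unique : ∀ {w w' v}, θ w v → θ w' v → w = w'
  knuthEquiv : ∀ {w v}, θ w v → KnuthEquiv w v
  lower : ∀ {i w w' v}, θ w v → WordLower i w w' → ∃ v', WordLower i v v' ∧ θ w' v'
  raise : ∀ {i w w' v}, θ w v → WordLower i w' w → ∃ v', WordLower i v' v ∧ θ w' v'
  lower_symm : ∀ {i w v v'}, θ w v → WordLower i v v' → ∃ w', WordLower i w w' ∧ θ w' v'
  raise_symm : ∀ {i w v v'}, θ w v → WordLower i v' v → ∃ w', WordLower i w' w ∧ θ w' v'

theorem KnuthAt.crystalBisimulation (p : ℕ) : CrystalBisimulation (KnuthAt p) where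
  right_unique := right_unique
  left_unique := left_unique
  knuthEquiv := knuthEquiv
  lower := exists_wordLower
  raise := exists_wordRaise
  -- No second case analysis is needed: equal signatures let the operator act on `w`, and uniqueness
  -- of its value on `v` identifies the transported step.
  lower_symm {i w v v'} h hv := by
    obtain ⟨w', hw⟩ := exists_wordLower_iff.2 ((h.signature_eq i).1 ▸ hv.wordPhi_pos)
    obtain ⟨v'', hv'', hk⟩ := h.exists_wordLower hw
    exact ⟨w', hw, hv.right_unique hv'' ▸ hk⟩
  raise_symm {i w v v'} h hv := by
    obtain ⟨w', hw⟩ := exists_wordLower_to_iff.2 ((h.signature_eq i).2 ▸ hv.wordEps_pos)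
    obtain ⟨v'', hv'', hk⟩ := h.exists_wordRaise hw
    exact ⟨w', hw, hv.left_unique hv'' ▸ hk⟩

theorem CrystalBisimulation.symm {θ : List ℕ → List ℕ → Prop} (h : CrystalBisimulation θ) :
    CrystalBisimulation fun w v => θ v w where
  right_unique := h.left_unique
  left_unique := h.right_unique
  knuthEquiv hw := .symm _ _ (h.knuthEquiv hw)
  lower := h.lower_symm
  raise := h.raise_symm
  lower_symm := h.lower
  raise_symm := h.raise

theorem CrystalBisimulation.comp {θ η : List ℕ → List ℕ → Prop} (h : CrystalBisimulation θ)
    (h' : CrystalBisimulation η) : CrystalBisimulation (Relation.Comp θ η) where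
  right_unique := by
    rintro w v v' ⟨x, hx, hv⟩ ⟨x', hx', hv'⟩
    obtain rfl := h.right_unique hx hx'
    exact h'.right_unique hv hv'
  left_unique := by
    rintro w v v' ⟨x, hx, hv⟩ ⟨x', hx', hv'⟩
    obtain rfl := h'.left_unique hv hv'
    exact h.left_unique hx hx'
  knuthEquiv := fun ⟨_, hx, hv⟩ => .trans _ _ _ (h.knuthEquiv hx) (h'.knuthEquiv hv)
  lower := by
    rintro i w w' v ⟨x, hx, hv⟩ hw
    obtain ⟨x', hx', h1⟩ := h.lower hx hw
    obtain ⟨v', hv', h2⟩ := h'.lower hv hx'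
    exact ⟨v', hv', x', h1, h2⟩
  raise := by
    rintro i w w' v ⟨x, hx, hv⟩ hw
    obtain ⟨x', hx', h1⟩ := h.raise hx hw
    obtain ⟨v', hv', h2⟩ := h'.raise hv hx'
    exact ⟨v', hv', x', h1, h2⟩
  lower_symm := by
    rintro i w v v' ⟨x, hx, hv⟩ hw
    obtain ⟨x', hx', h1⟩ := h'.lower_symm hv hw
    obtain ⟨w', hw', h2⟩ := h.lower_symm hx hx'
    exact ⟨w', hw', x', h2, h1⟩
  raise_symm := by
    rintro i w v v' ⟨x, hx, hv⟩ hw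
    obtain ⟨x', hx', h1⟩ := h'.raise_symm hv hw
    obtain ⟨w', hw', h2⟩ := h.raise_symm hx hx'
    exact ⟨w', hw', x', h2, h1⟩

theorem CrystalBisimulation.eq : CrystalBisimulation Eq where
  right_unique h h' := h.symm.trans h'
  left_unique h h' := h.trans h'.symm
  knuthEquiv := by rintro w _ rfl; exact .refl _
  lower := by rintro i w w' _ rfl h; exact ⟨w', h, rfl⟩
  raise := by rintro i w w' _ rfl h; exact ⟨w', h, rfl⟩
  lower_symm := by rintro i w _ w' rfl h; exact ⟨w', h, rfl⟩
  raise_symm := by rintro i w _ w' rfl h; exact ⟨w', h, rfl⟩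

namespace KnuthEquiv

variable {w v w' v' : List ℕ} {i : ℕ}

theorem refl (w : List ℕ) : KnuthEquiv w w := Relation.EqvGen.refl w

theorem symm (h : KnuthEquiv w v) : KnuthEquiv v w := Relation.EqvGen.symm _ _ h

theorem trans (h : KnuthEquiv w v) (h' : KnuthEquiv v w') : KnuthEquiv w w' :=
  Relation.EqvGen.trans _ _ _ h h'

theorem of_move (h : KnuthMove w v) : KnuthEquiv w v := Relation.EqvGen.rel _ _ h

/-- A chosen chain of moves is remembered as the composite of their partial bijections. Knuth
equivalence itself is not injective, and injectivity is needed to pull equalities of words back. -/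
theorem exists_crystalBisimulation (h : KnuthEquiv w v) :
    ∃ θ, CrystalBisimulation θ ∧ θ w v := by
  induction h with
  | rel w v h =>
    cases h with
    | left u u' x y z hxy hyz =>
      exact ⟨_, KnuthAt.crystalBisimulation u.length, u, _, _, u', rfl, rfl, rfl, .left x y z hxy hyz⟩
    | right u u' x y z hxy hyz =>
      exact ⟨_, (KnuthAt.crystalBisimulation u.length).symm, u, _, _, u', rfl, rfl, rfl,
        .right x y z hxy hyz⟩
  | refl w => exact ⟨_, .eq, rfl⟩
  | symm _ _ _ ih => obtain ⟨θ, hθ, h⟩ := ih; exact ⟨_, hθ.symm, h⟩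
  | trans _ _ _ _ _ ih ih' =>
    obtain ⟨θ, hθ, h⟩ := ih
    obtain ⟨η, hη, h'⟩ := ih'
    exact ⟨_, hθ.comp hη, _, h, h'⟩

theorem perm (h : KnuthEquiv w v) : w.Perm v := by
  induction h with
  | rel w v h =>
    cases h with
    | left u u' x y z hxy hyz =>
      exact ((KnuthTriple.left x y z hxy hyz).perm.append_left u).append_right u'
    | right u u' x y z hxy hyz =>
      exact ((KnuthTriple.right x y z hxy hyz).perm.symm.append_left u).append_right u'
  | refl w => exact .refl _
  | symm _ _ _ ih => exact ih.symm
  | trans _ _ _ _ _ ih ih' => exact ih.trans ih'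

theorem exists_wordLower (h : KnuthEquiv w v) (hw : WordLower i w w') :
    ∃ v', WordLower i v v' ∧ KnuthEquiv w' v' := by
  obtain ⟨θ, hθ, h⟩ := h.exists_crystalBisimulation
  obtain ⟨v', hv, h'⟩ := hθ.lower h hw
  exact ⟨v', hv, hθ.knuthEquiv h'⟩

theorem exists_wordRaise (h : KnuthEquiv w v) (hw : WordLower i w' w) :
    ∃ v', WordLower i v' v ∧ KnuthEquiv w' v' := by
  obtain ⟨θ, hθ, h⟩ := h.exists_crystalBisimulation
  obtain ⟨v', hv, h'⟩ := hθ.raise h hw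
  exact ⟨v', hv, hθ.knuthEquiv h'⟩

theorem of_wordLower (h : KnuthEquiv w v) (hw : WordLower i w w') (hv : WordLower i v v') :
    KnuthEquiv w' v' := by
  obtain ⟨v'', h1, h2⟩ := h.exists_wordLower hw
  rwa [hv.right_unique h1]

theorem wordEps_eq_zero_iff (h : KnuthEquiv w v) (i : ℕ) : wordEps i w = 0 ↔ wordEps i v = 0 := by
  rw [← not_iff_not, ← ne_eq, ← ne_eq, ← Nat.pos_iff_ne_zero, ← Nat.pos_iff_ne_zero,
    ← exists_wordLower_to_iff, ← exists_wordLower_to_iff]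
  constructor
  · rintro ⟨_, hw⟩
    exact (h.exists_wordRaise hw).imp fun _ h => h.1
  · rintro ⟨_, hw⟩
    exact (h.symm.exists_wordRaise hw).imp fun _ h => h.1

theorem append (h : KnuthEquiv w v) (h' : KnuthEquiv w' v') :
    KnuthEquiv (w ++ w') (v ++ v') := by
  have key : ∀ (a b : List ℕ) {w v : List ℕ}, KnuthEquiv w v →
      KnuthEquiv (a ++ w ++ b) (a ++ v ++ b) := by
    intro a b w v h
    induction h with
    | rel w v h =>
      cases h with
      | left u u' x y z hxy hyz =>
        simpa using of_move (KnuthMove.left (a ++ u) (u' ++ b) x y z hxy hyz)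
      | right u u' x y z hxy hyz =>
        simpa using of_move (KnuthMove.right (a ++ u) (u' ++ b) x y z hxy hyz)
    | refl w => exact KnuthEquiv.refl _
    | symm _ _ _ ih => exact KnuthEquiv.symm ih
    | trans _ _ _ _ _ ih ih' => exact KnuthEquiv.trans ih ih'
  have h1 := key [] w' h
  have h2 := key v [] h'
  simp only [List.nil_append, List.append_nil] at h1 h2
  exact h1.trans h2

/-- Restricting to an interval of letters preserves Knuth equivalence. -/
theorem filter (h : KnuthEquiv w v) (a b : ℕ) :
    KnuthEquiv (w.filter fun x => a ≤ x ∧ x ≤ b) (v.filter fun x => a ≤ x ∧ x ≤ b) := by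
  induction h with
  | rel w v h =>
    cases h with
    | left u u' x y z hxy hyz =>
      simp only [List.filter_append]
      refine append (append (KnuthEquiv.refl _) ?_) (KnuthEquiv.refl _)
      -- The move transposes `x` and `z`. If both survive the restriction, so does `y` between them;
      -- if one is deleted, the two sides become equal.
      by_cases hx : a ≤ x ∧ x ≤ b
      · by_cases hz : a ≤ z ∧ z ≤ b
        · have hy : a ≤ y ∧ y ≤ b := by omega
          simpa [List.filter_cons, hx, hy, hz] using
            of_move (KnuthMove.left [] [] x y z hxy hyz)
        · simpa [List.filter_cons, hx, hz] using KnuthEquiv.refl _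
      · simpa [List.filter_cons, hx] using KnuthEquiv.refl _
    | right u u' x y z hxy hyz =>
      simp only [List.filter_append]
      refine append (append (KnuthEquiv.refl _) ?_) (KnuthEquiv.refl _)
      by_cases hx : a ≤ x ∧ x ≤ b
      · by_cases hz : a ≤ z ∧ z ≤ b
        · have hy : a ≤ y ∧ y ≤ b := by omega
          simpa [List.filter_cons, hx, hy, hz] using
            of_move (KnuthMove.right [] [] x y z hxy hyz)
        · simpa [List.filter_cons, hx, hz] using KnuthEquiv.refl _
      · simpa [List.filter_cons, hx] using KnuthEquiv.refl _
  | refl w => exact KnuthEquiv.refl _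
  | symm _ _ _ ih => exact KnuthEquiv.symm ih
  | trans _ _ _ _ _ ih ih' => exact KnuthEquiv.trans ih ih'

end KnuthEquiv

/-! ### Normal form of highest-weight words -/

/-- The word `a + k - 1, …, a + 1, a`. -/
def descendingRun (a k : ℕ) : List ℕ := (List.range k).reverse.map fun i => a + i

theorem descendingRun_succ (a k : ℕ) : descendingRun a (k + 1) = (a + k) :: descendingRun a k := by
  simp [descendingRun, List.range_succ]

theorem mem_descendingRun {a k x : ℕ} : x ∈ descendingRun a k ↔ a ≤ x ∧ x < a + k := by
  simp only [descendingRun, List.mem_map, List.mem_reverse, List.mem_range]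
  constructor
  · rintro ⟨i, hi, rfl⟩; omega
  · intro h; exact ⟨x - a, by omega, by omega⟩

theorem KnuthEquiv.cons {w v : List ℕ} (x : ℕ) (h : KnuthEquiv w v) :
    KnuthEquiv (x :: w) (x :: v) :=
  (KnuthEquiv.refl [x]).append h

/-- The large letter `x` slides through the run one step at a time, the letter just before it
serving as the middle value of the Knuth move. -/
theorem knuthEquiv_cons_cons_descendingRun (a : ℕ) {j x y : ℕ} (hy : y = a + j) (hyx : y ≤ x) :
    KnuthEquiv (y :: x :: descendingRun a j) (y :: (descendingRun a j ++ [x])) := by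
  induction j generalizing y with
  | zero => exact .refl _
  | succ j ih =>
    rw [descendingRun_succ]
    have h1 : KnuthEquiv (y :: x :: (a + j) :: descendingRun a j)
        (y :: (a + j) :: x :: descendingRun a j) :=
      .of_move (.left [] _ (a + j) y x (by omega) hyx)
    exact h1.trans ((ih rfl (by omega)).cons y)

/-- A letter of a descending run commutes with the run. -/
theorem knuthEquiv_cons_descendingRun (a : ℕ) {k h : ℕ} (hk : h < k) :
    KnuthEquiv ((a + h) :: descendingRun a k) (descendingRun a k ++ [a + h]) := by
  induction k with
  | zero => omega
  | succ k ih =>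
    rw [descendingRun_succ]
    rcases Nat.lt_succ_iff_lt_or_eq.1 hk with hk | rfl
    -- A letter below the top of the run first passes the top letter, with the second letter of the
    -- run as the third participant of the move.
    · obtain ⟨l, rfl⟩ : ∃ l, k = l + 1 := ⟨k - 1, by omega⟩
      have h1 : KnuthEquiv ((a + h) :: (a + (l + 1)) :: descendingRun a (l + 1))
          ((a + (l + 1)) :: (a + h) :: descendingRun a (l + 1)) := by
        rw [descendingRun_succ]
        exact (KnuthEquiv.of_move (.right [] _ (a + h) (a + l) (a + (l + 1))
          (by omega) (by omega))).symm
      exact h1.trans ((ih hk).cons _)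
    · exact knuthEquiv_cons_cons_descendingRun a rfl le_rfl

/-- A word in letters `≥ a` without unmatched opening brackets. -/
def IsHighestWord (a : ℕ) (w : List ℕ) : Prop :=
  (∀ x ∈ w, a ≤ x) ∧ ∀ i, a ≤ i → wordEps i w = 0

namespace IsHighestWord

variable {a : ℕ} {w v : List ℕ}

theorem of_append (h : IsHighestWord a (w ++ v)) : IsHighestWord a v := by
  refine ⟨fun x hx => h.1 x (by simp [hx]), fun i hi => ?_⟩
  have := h.2 i hi
  rw [wordEps_append] at this
  omega

theorem of_knuthEquiv (h : IsHighestWord a w) (hw : KnuthEquiv w v) : IsHighestWord a v :=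
  ⟨fun x hx => h.1 x (hw.perm.mem_iff.2 hx), fun i hi => (hw.wordEps_eq_zero_iff i).1 (h.2 i hi)⟩

/-- For the index `x - 1 ≥ a` the leading `x` would be an opening bracket that only a later `x - 1`
can close. -/
theorem le_of_notMem {x : ℕ} (h : IsHighestWord a (x :: w)) (hx : x - 1 ∉ w) : x = a := by
  have h1 := h.1 x (by simp)
  by_contra hne
  have h2 := h.2 (x - 1) (by omega)
  obtain ⟨y, rfl⟩ : ∃ y, x = y + 1 := ⟨x - 1, by omega⟩
  simp only [Nat.add_sub_cancel] at hx h2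
  rw [wordEps_cons_open, wordPhi_eq_zero_of_notMem hx] at h2
  omega

/-- The letter `a + d` commutes past runs longer than `d` and extends the first run of length `d`;
if all runs are used up it must be `a` and starts a new one. Meeting a run shorter than `d` would
leave it unmatched. The clause about `B` keeps the lengths sorted when a passed run is put back in
front. -/
theorem exists_cons {ks : List ℕ} : ∀ {x : ℕ}, IsHighestWord a (x :: ks.flatMap (descendingRun a)) →
    ks.SortedGE → (∀ k ∈ ks, 0 < k) →
    ∃ ks' : List ℕ, ks'.SortedGE ∧ (∀ k ∈ ks', 0 < k) ∧
      KnuthEquiv (x :: ks.flatMap (descendingRun a)) (ks'.flatMap (descendingRun a)) ∧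
      ∀ B, (∀ k ∈ ks, k ≤ B) → x + 1 ≤ a + B → ∀ k ∈ ks', k ≤ B := by
  induction ks with
  | nil =>
    intro x h _ _
    obtain rfl := h.le_of_notMem (by simp)
    exact ⟨[1], (List.pairwise_singleton _ _).sortedGE, by simp, by simpa [descendingRun] using KnuthEquiv.refl _,
      fun B _ hB => by simp; omega⟩
  | cons k ks ih =>
    intro x h hs hpos
    have hsc := hs.pairwise
    rw [List.pairwise_cons] at hsc
    have hax := h.1 x (by simp)
    obtain ⟨d, rfl⟩ : ∃ d, x = a + d := ⟨x - a, by omega⟩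
    rcases lt_trichotomy d k with hd | rfl | hd
    · have h1 : KnuthEquiv ((a + d) :: (k :: ks).flatMap (descendingRun a))
          (descendingRun a k ++ ((a + d) :: ks.flatMap (descendingRun a))) := by
        simpa using (knuthEquiv_cons_descendingRun a hd).append
          (KnuthEquiv.refl (ks.flatMap (descendingRun a)))
      obtain ⟨ks', h2, h3, h4, h5⟩ := ih (h.of_knuthEquiv h1).of_append hsc.2.sortedGE
        fun y hy => hpos y (by simp [hy])
      refine ⟨k :: ks', ?_, ?_, ?_, ?_⟩
      · exact (List.pairwise_cons.2 ⟨h5 k hsc.1 (by omega), h2.pairwise⟩).sortedGE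
      · intro y hy
        rcases List.mem_cons.1 hy with rfl | hy
        · exact hpos _ (by simp)
        · exact h3 y hy
      · exact h1.trans (by simpa using (KnuthEquiv.refl (descendingRun a k)).append h4)
      · intro B hB hx y hy
        rcases List.mem_cons.1 hy with rfl | hy
        · exact hB _ (by simp)
        · exact h5 B (fun z hz => hB z (by simp [hz])) hx y hy
    · refine ⟨(d + 1) :: ks, ?_, ?_, ?_, ?_⟩
      · exact (List.pairwise_cons.2 ⟨fun y hy => (hsc.1 y hy).trans (by simp), hsc.2⟩).sortedGE
      · intro y hy
        rcases List.mem_cons.1 hy with rfl | hy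
        · omega
        · exact hpos y (by simp [hy])
      · simpa [descendingRun_succ] using KnuthEquiv.refl _
      · intro B hB hx y hy
        rcases List.mem_cons.1 hy with rfl | hy
        · omega
        · exact hB y (by simp [hy])
    · have := h.le_of_notMem (by
        simp only [List.mem_flatMap, not_exists, not_and, mem_descendingRun]
        intro l hl
        have : l ≤ k := by
          rcases List.mem_cons.1 hl with rfl | hl
          · exact le_rfl
          · exact hsc.1 l hl
        omega)
      omega

theorem exists_knuthEquiv_runs (h : IsHighestWord a w) : ∃ ks : List ℕ, ks.SortedGE ∧
    (∀ k ∈ ks, 0 < k) ∧ KnuthEquiv w (ks.flatMap (descendingRun a)) := by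
  induction w with
  | nil => exact ⟨[], List.Pairwise.nil.sortedGE, by simp, .refl _⟩
  | cons x w ih =>
    -- A suffix of a highest-weight word has highest weight, so the normal form can be built up from
    -- the right.
    obtain ⟨ks, h1, h2, h3⟩ := ih (of_append (w := [x]) h)
    obtain ⟨ks', h4, h5, h6, -⟩ := exists_cons (h.of_knuthEquiv (h3.cons x)) h1 h2
    exact ⟨ks', h4, h5, (h3.cons x).trans h6⟩

end IsHighestWord

/-! ### Reading words of tableaux -/

theorem List.flatMap_eq_append_cons {α β : Type*} {f : α → List β} {l : List α} {u t : List β}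
    {x : β} (h : l.flatMap f = u ++ x :: t) : ∃ l₁ c l₂ u' t', l = l₁ ++ c :: l₂ ∧
      f c = u' ++ x :: t' ∧ u = l₁.flatMap f ++ u' ∧ t = t' ++ l₂.flatMap f := by
  induction l generalizing u with
  | nil => simp at h
  | cons a l ih =>
    rw [List.flatMap_cons, List.append_eq_append_iff] at h
    rcases h with ⟨z, rfl, hz⟩ | ⟨z, hz, hz'⟩
    · obtain ⟨l₁, c, l₂, u', t', rfl, h1, rfl, rfl⟩ := ih hz
      exact ⟨a :: l₁, c, l₂, u', t', by simp, h1, by simp, by simp⟩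
    · cases z with
      | nil =>
        simp only [List.append_nil, List.nil_append] at hz hz'
        obtain ⟨l₁, c, l₂, u', t', rfl, h1, h2, rfl⟩ := ih (u := []) hz'.symm
        have h3 := List.append_eq_nil_iff.1 h2.symm
        exact ⟨a :: l₁, c, l₂, u', t', by simp, h1, by simp [h3, hz], by simp⟩
      | cons y z =>
        simp only [List.cons_append, List.cons.injEq] at hz'
        obtain ⟨rfl, rfl⟩ := hz'
        exact ⟨[], a, l, u, z, by simp, hz, by simp, by simp⟩

theorem List.range_split {n c : ℕ} (h : c < n) :
    List.range n = List.range c ++ c :: List.range' (c + 1) (n - (c + 1)) := by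
  obtain ⟨k, rfl⟩ : ∃ k, n = c + (k + 1) := ⟨n - (c + 1), by omega⟩
  rw [List.range_add, List.range_succ_eq_map]
  simp only [List.map_cons, List.map_map, Nat.add_zero]
  rw [List.range'_eq_map_range, show c + (k + 1) - (c + 1) = k by omega]
  congr 2
  apply List.map_congr_left
  intro x _
  simp; omega

theorem List.range_eq_append_cons {n c : ℕ} {l₁ l₂ : List ℕ} (h : List.range n = l₁ ++ c :: l₂) :
    c < n ∧ l₁ = List.range c ∧ l₂ = List.range' (c + 1) (n - (c + 1)) := by
  have hlen : l₁.length < n := by simpa using (congrArg List.length h).trans_gt (by simp)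
  have hc : c = l₁.length := by
    have h1 : (List.range n)[l₁.length]'(by simpa using hlen) = l₁.length := by simp
    rw [← h1]
    simp [h]
  subst hc
  rw [List.range_split hlen] at h
  obtain ⟨h1, h2⟩ := List.append_inj h (by simp)
  simp only [List.cons.injEq, true_and] at h2
  exact ⟨hlen, h1.symm, h2.symm⟩

namespace SemistandardYoungTableau

variable {lam mu : YoungDiagram}

/-- The letters of one column, from bottom to top. -/
def columnWord (lam : YoungDiagram) (g : ℕ → ℕ → ℕ) (c : ℕ) : List ℕ :=
  (List.range (lam.colLen c)).reverse.map fun i => g i c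

/-- The letters read before the cell `(r, c)`. -/
def wordBefore (lam : YoungDiagram) (g : ℕ → ℕ → ℕ) (r c : ℕ) : List ℕ :=
  (List.range c).flatMap (columnWord lam g) ++
    (List.range' (r + 1) (lam.colLen c - (r + 1))).reverse.map fun i => g i c

/-- The letters read after the cell `(r, c)`. -/
def wordAfter (lam : YoungDiagram) (g : ℕ → ℕ → ℕ) (r c : ℕ) : List ℕ :=
  (List.range r).reverse.map (fun i => g i c) ++
    (List.range' (c + 1) (lam.rowLen 0 - (c + 1))).flatMap (columnWord lam g)

theorem columnWord_split {g : ℕ → ℕ → ℕ} {r c : ℕ} (h : (r, c) ∈ lam) :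
    columnWord lam g c =
      (List.range' (r + 1) (lam.colLen c - (r + 1))).reverse.map (fun i => g i c) ++
        g r c :: (List.range r).reverse.map fun i => g i c := by
  rw [columnWord, List.range_split (YoungDiagram.mem_iff_lt_colLen.1 h)]
  simp

theorem word_split (T : SemistandardYoungTableau lam) {r c : ℕ} (h : (r, c) ∈ lam) :
    T.word = wordBefore lam T r c ++ T r c :: wordAfter lam T r c := by
  have hc : c < lam.rowLen 0 :=
    (YoungDiagram.mem_iff_lt_rowLen.1 h).trans_le (lam.rowLen_anti _ _ (Nat.zero_le _))
  change (List.range (lam.rowLen 0)).flatMap (columnWord lam T) = _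
  rw [List.range_split hc, List.flatMap_append, List.flatMap_cons, columnWord_split h]
  simp [wordBefore, wordAfter]

theorem exists_cell_of_word_eq (T : SemistandardYoungTableau lam) {u t : List ℕ} {x : ℕ}
    (h : T.word = u ++ x :: t) : ∃ r c, (r, c) ∈ lam ∧ u = wordBefore lam T r c ∧ x = T r c ∧
      t = wordAfter lam T r c := by
  change (List.range (lam.rowLen 0)).flatMap (columnWord lam T) = _ at h
  obtain ⟨l₁, c, l₂, u', t', h1, h2, rfl, rfl⟩ := List.flatMap_eq_append_cons h
  obtain ⟨hc, rfl, rfl⟩ := List.range_eq_append_cons h1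
  obtain ⟨m₁, m₂, h3, rfl, h4⟩ := List.map_eq_append_iff.1 h2
  obtain ⟨r, m₂, rfl, rfl, rfl⟩ := List.map_eq_cons_iff.1 h4
  rw [List.reverse_eq_iff] at h3
  simp only [List.reverse_append, List.reverse_cons, List.append_assoc, List.singleton_append]
    at h3
  obtain ⟨hr, h5, h6⟩ := List.range_eq_append_cons h3
  rw [List.reverse_eq_iff] at h5 h6
  exact ⟨r, c, YoungDiagram.mem_iff_lt_colLen.2 hr, by simp [wordBefore, h6], rfl,
    by simp [wordAfter, h5]⟩

/-- The position of a cell in the reading word depends on the shape alone, which lets two fillings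
be compared letter by letter. -/
theorem length_wordBefore (g g' : ℕ → ℕ → ℕ) (r c : ℕ) :
    (wordBefore lam g r c).length = (wordBefore lam g' r c).length := by
  simp [wordBefore, List.length_flatMap, columnWord]

theorem mem_word (T : SemistandardYoungTableau lam) {r c : ℕ} (h : (r, c) ∈ lam) :
    T r c ∈ T.word := by
  simp [T.word_split h]

theorem word_injective : Function.Injective (word (lam := lam)) := by
  intro T T' h
  ext r c
  by_cases hrc : (r, c) ∈ lam
  · rw [T.word_split hrc, T'.word_split hrc] at h
    have := List.append_inj h (length_wordBefore _ _ _ _)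
    exact (List.cons.inj this.2).1
  · rw [T.zeros hrc, T'.zeros hrc]

theorem mem_columnWord {g : ℕ → ℕ → ℕ} {c x : ℕ} :
    x ∈ columnWord lam g c ↔ ∃ r, (r, c) ∈ lam ∧ g r c = x := by
  simp [columnWord, YoungDiagram.mem_iff_lt_colLen]

/-- The letters read after a cell: those above it and those in the columns to the right. -/
theorem mem_wordAfter {g : ℕ → ℕ → ℕ} {r c x : ℕ} (h : x ∈ wordAfter lam g r c) :
    (∃ r' < r, g r' c = x) ∨ ∃ r' c', c < c' ∧ (r', c') ∈ lam ∧ g r' c' = x := by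
  simp only [wordAfter, List.mem_append, List.mem_map, List.mem_reverse, List.mem_range,
    List.mem_flatMap, List.mem_range', mem_columnWord] at h
  rcases h with ⟨r', h, rfl⟩ | ⟨c', ⟨k, -, rfl⟩, r', h, rfl⟩
  · exact .inl ⟨r', h, rfl⟩
  · exact .inr ⟨r', _, by omega, h, rfl⟩

theorem columnWord_congr {g g' : ℕ → ℕ → ℕ} {c : ℕ} (h : ∀ r, g r c = g' r c) :
    columnWord lam g c = columnWord lam g' c := by
  simp [columnWord, h]

theorem wordBefore_congr {g g' : ℕ → ℕ → ℕ} {r c : ℕ}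
    (h : ∀ r' c', (r', c') ≠ (r, c) → g r' c' = g' r' c') :
    wordBefore lam g r c = wordBefore lam g' r c := by
  unfold wordBefore
  congr 1
  · apply List.flatMap_congr
    intro c' hc'
    rw [List.mem_range] at hc'
    exact columnWord_congr fun r' => h _ _ (by simp; omega)
  · apply List.map_congr_left
    intro r' hr'
    rw [List.mem_reverse, List.mem_range'] at hr'
    exact h _ _ (by simp; omega)

theorem wordAfter_congr {g g' : ℕ → ℕ → ℕ} {r c : ℕ}
    (h : ∀ r' c', (r', c') ≠ (r, c) → g r' c' = g' r' c') :
    wordAfter lam g r c = wordAfter lam g' r c := by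
  unfold wordAfter
  congr 1
  · apply List.map_congr_left
    intro r' hr'
    rw [List.mem_reverse, List.mem_range] at hr'
    exact h _ _ (by simp; omega)
  · apply List.flatMap_congr
    intro c' hc'
    rw [List.mem_range'] at hc'
    exact columnWord_congr fun r' => h _ _ (by simp; omega)

theorem row_weak_le (T : SemistandardYoungTableau lam) {i j1 j2 : ℕ} (hj : j1 ≤ j2)
    (h : (i, j2) ∈ lam) : T i j1 ≤ T i j2 := T.row_weak_of_le hj h

/-- Replacing one entry of a tableau. -/
theorem exists_update (T : SemistandardYoungTableau lam) {r c : ℕ} (y : ℕ) (hrc : (r, c) ∈ lam)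
    (hright : (r, c + 1) ∈ lam → y ≤ T r (c + 1)) (hleft : ∀ c', c = c' + 1 → T r c' ≤ y)
    (hdown : (r + 1, c) ∈ lam → y < T (r + 1) c) (hup : ∀ r', r = r' + 1 → T r' c < y) :
    ∃ T' : SemistandardYoungTableau lam,
      T'.word = wordBefore lam T r c ++ y :: wordAfter lam T r c := by
  let T' : SemistandardYoungTableau lam :=
    { entry := fun i j => if (i, j) = (r, c) then y else T i j
      row_weak' := by
        intro i j1 j2 hj hcell
        simp only [Prod.mk.injEq]
        split_ifs with h1 h2 h2
        · rfl
        · obtain ⟨rfl, rfl⟩ := h1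
          exact (hright (lam.up_left_mem le_rfl hj hcell)).trans (T.row_weak_le hj hcell)
        · obtain ⟨rfl, rfl⟩ := h2
          have := hleft (j2 - 1) (by omega)
          exact (T.row_weak_le (by omega) (lam.up_left_mem le_rfl (Nat.sub_le _ 1) hcell)).trans this
        · exact T.row_weak hj hcell
      col_strict' := by
        intro i1 i2 j hi hcell
        simp only [Prod.mk.injEq]
        split_ifs with h1 h2 h2
        · omega
        · obtain ⟨rfl, rfl⟩ := h1
          exact (hdown (lam.up_left_mem hi le_rfl hcell)).trans_le (T.col_weak hi hcell)
        · obtain ⟨rfl, rfl⟩ := h2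
          have := hup (i2 - 1) (by omega)
          exact (T.col_weak (by omega) (lam.up_left_mem (Nat.sub_le _ 1) le_rfl hcell)).trans_lt this
        · exact T.col_strict hi hcell
      zeros' := by
        intro i j h
        rw [if_neg, T.zeros h]
        rintro ⟨⟩
        exact h hrc }
  have hT : ∀ i j, (i, j) ≠ (r, c) → T i j = T' i j := fun i j h => by
    change _ = if (i, j) = (r, c) then y else T i j
    rw [if_neg h]
  have hT' : T' r c = y := if_pos rfl
  exact ⟨T', by rw [T'.word_split hrc, wordBefore_congr hT, wordAfter_congr hT, hT']⟩

theorem wordPhi_map_eq_zero {i : ℕ} {l : List ℕ} {g : ℕ → ℕ} (h : ∀ x ∈ l, g x < i ∨ i + 1 < g x) :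
    wordPhi i (l.map g) = 0 ∧ wordEps i (l.map g) = 0 := by
  apply word_signature_eq_zero
  intro x hx
  obtain ⟨y, hy, rfl⟩ := List.mem_map.1 hx
  have := h y hy
  omega

/-- Raising the entry `i` to `i + 1` could only clash with an `i + 1` below it or an `i` to its
right. The former is read immediately before and would be an unmatched opening; the latter is read
later with no `i + 1` in between and would be an unmatched closing. -/
theorem exists_word_eq_of_wordLower (T : SemistandardYoungTableau lam) {i : ℕ} {w : List ℕ}
    (h : WordLower i T.word w) : ∃ T' : SemistandardYoungTableau lam, T'.word = w := by
  obtain ⟨u, t, hw, rfl, hu, ht⟩ := h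
  obtain ⟨r, c, hrc, rfl, hx, rfl⟩ := T.exists_cell_of_word_eq hw
  have hdown : (r + 1, c) ∈ lam → i + 1 < T (r + 1) c := by
    intro h
    have h1 : T r c < T (r + 1) c := T.col_strict (Nat.lt_succ_self r) h
    rcases Nat.lt_or_ge (i + 1) (T (r + 1) c) with h2 | h2
    · exact h2
    · exfalso
      have h3 : T (r + 1) c = i + 1 := by omega
      have h4 : lam.colLen c - (r + 1) = lam.colLen c - (r + 2) + 1 := by
        have := YoungDiagram.mem_iff_lt_colLen.1 h
        omega
      rw [wordBefore, h4, List.range'_succ] at hu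
      simp [wordEps_append, h3] at hu
  refine T.exists_update (i + 1) hrc ?_ ?_ hdown ?_
  · intro h
    have h1 : T r c ≤ T r (c + 1) := T.row_weak (Nat.lt_succ_self c) h
    by_contra h2
    have h3 : T r (c + 1) = i := by omega
    have hc : lam.rowLen 0 - (c + 1) = lam.rowLen 0 - (c + 2) + 1 := by
      have := (YoungDiagram.mem_iff_lt_rowLen.1 h).trans_le (lam.rowLen_anti _ _ (Nat.zero_le r))
      omega
    have hA := wordPhi_map_eq_zero (i := i) (l := (List.range r).reverse) (g := fun i => T i c) (by
      intro r' hr'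
      rw [List.mem_reverse, List.mem_range] at hr'
      have := T.col_strict hr' hrc
      omega)
    -- Entries below `(r, c + 1)` exceed `i + 1`, because by `hdown` this already holds below `(r,
    -- c)` and rows increase weakly.
    have hB := wordPhi_map_eq_zero (i := i)
      (l := (List.range' (r + 1) (lam.colLen (c + 1) - (r + 1))).reverse)
      (g := fun i => T i (c + 1)) (by
      intro r' hr'
      rw [List.mem_reverse, List.mem_range'] at hr'
      obtain ⟨k, hk, rfl⟩ := hr'
      have h4 : (r + 1 + 1 * k, c + 1) ∈ lam := YoungDiagram.mem_iff_lt_colLen.2 (by omega)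
      have h5 := hdown (lam.up_left_mem (by omega) (by omega) h4)
      have h6 : T (r + 1) c ≤ T (r + 1) (c + 1) :=
        T.row_weak (Nat.lt_succ_self c) (lam.up_left_mem (by omega) le_rfl h4)
      have h7 : T (r + 1) (c + 1) ≤ T (r + 1 + 1 * k) (c + 1) := T.col_weak (by omega) h4
      omega)
    rw [wordAfter, hc, List.range'_succ, List.flatMap_cons, columnWord_split h, h3] at ht
    simp only [wordPhi_append, hA, hB, wordPhi_cons_close, List.append_assoc, List.cons_append]
      at ht
    omega
  · intro c' hc'
    subst hc'
    have : T r c' ≤ T r (c' + 1) := T.row_weak (Nat.lt_succ_self c') hrc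
    omega
  · intro r' hr'
    subst hr'
    have : T r' c < T (r' + 1) c := T.col_strict (Nat.lt_succ_self r') hrc
    omega

/-- Mirror image of the lowering case: an `i` above the cell would be an unmatched closing read
immediately after it, and an `i + 1` to its left an unmatched opening read before it. -/
theorem exists_word_eq_of_wordRaise (T : SemistandardYoungTableau lam) {i : ℕ} {w : List ℕ}
    (h : WordLower i w T.word) : ∃ T' : SemistandardYoungTableau lam, T'.word = w := by
  obtain ⟨u, t, rfl, hw, hu, ht⟩ := h
  obtain ⟨r, c, hrc, rfl, hx, rfl⟩ := T.exists_cell_of_word_eq hw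
  have hup : ∀ r', r = r' + 1 → T r' c < i := by
    rintro r' rfl
    have h1 : T r' c < T (r' + 1) c := T.col_strict (Nat.lt_succ_self r') hrc
    rcases Nat.lt_or_ge (T r' c) i with h2 | h2
    · exact h2
    · exfalso
      have h3 : T r' c = i := by omega
      simp [wordAfter, List.range_succ, h3] at ht
  refine T.exists_update i hrc ?_ ?_ ?_ hup
  · intro h
    have h1 : T r c ≤ T r (c + 1) := T.row_weak (Nat.lt_succ_self c) h
    omega
  · rintro c' rfl
    have h1 : T r c' ≤ T r (c' + 1) := T.row_weak (Nat.lt_succ_self c') hrc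
    by_contra h2
    have h3 : T r c' = i + 1 := by omega
    have hrc' : (r, c') ∈ lam := lam.up_left_mem le_rfl (Nat.le_succ c') hrc
    have hA := wordPhi_map_eq_zero (i := i) (l := (List.range r).reverse) (g := fun i => T i c') (by
      intro r' hr'
      rw [List.mem_reverse, List.mem_range] at hr'
      have h4 := hup (r - 1) (by omega)
      have h5 : T (r - 1) c' ≤ T (r - 1) (c' + 1) :=
        T.row_weak (Nat.lt_succ_self c') (lam.up_left_mem (Nat.sub_le _ 1) le_rfl hrc)
      have h6 : T r' c' ≤ T (r - 1) c' :=
        T.col_weak (by omega) (lam.up_left_mem (Nat.sub_le _ 1) le_rfl hrc')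
      omega)
    have hB := wordPhi_map_eq_zero (i := i)
      (l := (List.range' (r + 1) (lam.colLen (c' + 1) - (r + 1))).reverse)
      (g := fun i => T i (c' + 1)) (by
      intro r' hr'
      rw [List.mem_reverse, List.mem_range'] at hr'
      obtain ⟨k, hk, rfl⟩ := hr'
      have h4 : (r + 1 + 1 * k, c' + 1) ∈ lam := YoungDiagram.mem_iff_lt_colLen.2 (by omega)
      have h7 : T r (c' + 1) < T (r + 1 + 1 * k) (c' + 1) := T.col_strict (by omega) h4
      omega)
    rw [wordBefore, List.range_succ, List.flatMap_append, List.flatMap_singleton,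
      columnWord_split hrc', h3] at hu
    simp only [wordEps_append, hA, hB, wordEps_cons_open, wordPhi_append, wordPhi_cons_open] at hu
    omega
  · intro h
    have : T r c < T (r + 1) c := T.col_strict (Nat.lt_succ_self r) h
    omega

end SemistandardYoungTableau

/-! ### Highest-weight tableaux -/

theorem wordEps_descendingRun {a i : ℕ} (h : a ≤ i) (k : ℕ) :
    wordEps i (descendingRun a k) = 0 := by
  induction k with
  | zero => rfl
  | succ k ih =>
    rw [descendingRun_succ, wordEps_cons, ih]
    split_ifs with hk
    · obtain ⟨l, rfl⟩ : ∃ l, k = l + 1 := ⟨k - 1, by omega⟩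
      obtain rfl : i = a + l := by omega
      rw [descendingRun_succ, wordPhi_cons_close]
      omega
    · rfl

theorem isHighestWord_runs (a : ℕ) (ks : List ℕ) :
    IsHighestWord a (ks.flatMap (descendingRun a)) := by
  constructor
  · intro x hx
    obtain ⟨k, -, hk⟩ := List.mem_flatMap.1 hx
    exact (mem_descendingRun.1 hk).1
  · intro i hi
    induction ks with
    | nil => rfl
    | cons k ks ih => simp [wordEps_append, ih, wordEps_descendingRun hi]

theorem highestTableau_apply {lam : YoungDiagram} {a r c : ℕ} (h : (r, c) ∈ lam) :
    highestTableau lam a r c = a + r := if_pos h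

theorem word_highestTableau (lam : YoungDiagram) (a : ℕ) :
    (highestTableau lam a).word = lam.transpose.rowLens.flatMap (descendingRun a) := by
  rw [YoungDiagram.rowLens, List.flatMap_map, YoungDiagram.colLen_transpose]
  apply List.flatMap_congr
  intro c _
  rw [YoungDiagram.rowLen_transpose]
  apply List.map_congr_left
  intro r hr
  rw [List.mem_reverse, List.mem_range] at hr
  exact highestTableau_apply (YoungDiagram.mem_iff_lt_colLen.2 hr)

theorem isHighestWord_highestTableau (lam : YoungDiagram) (a : ℕ) :
    IsHighestWord a (highestTableau lam a).word := by
  rw [word_highestTableau]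
  exact isHighestWord_runs _ _

theorem count_descendingRun (a k p : ℕ) :
    (descendingRun a k).count (a + p) = if p < k then 1 else 0 := by
  induction k with
  | zero => rfl
  | succ k ih =>
    rw [descendingRun_succ, List.count_cons, ih]
    simp only [beq_iff_eq]
    split_ifs <;> omega

theorem count_word_highestTableau (lam : YoungDiagram) (a p : ℕ) :
    (highestTableau lam a).word.count (a + p) = lam.rowLen p := by
  rw [word_highestTableau, List.count_flatMap, YoungDiagram.rowLens, List.map_map,
    YoungDiagram.colLen_transpose]
  have key : ∀ n k : ℕ, ((List.range n).map fun c => if c < k then 1 else 0).sum = min n k := by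
    intro n k
    induction n with
    | zero => simp
    | succ n ih =>
      rw [List.range_succ, List.map_append, List.sum_append, ih]
      simp only [List.map_cons, List.map_nil, List.sum_cons, List.sum_nil]
      split_ifs <;> omega
  have h : ((List.range (lam.rowLen 0)).map
      ((List.count (a + p) ∘ descendingRun a) ∘ lam.transpose.rowLen)) =
      (List.range (lam.rowLen 0)).map fun c => if c < lam.rowLen p then 1 else 0 := by
    apply List.map_congr_left
    intro c _
    simp only [Function.comp, count_descendingRun, YoungDiagram.rowLen_transpose,
      ← YoungDiagram.mem_iff_lt_colLen, ← YoungDiagram.mem_iff_lt_rowLen]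
  rw [h, key]
  exact min_eq_right (lam.rowLen_anti _ _ (Nat.zero_le p))

/-- The letter `a + p` occurs as often as row `p` is long, so the content recovers the shape. -/
theorem eq_of_perm_word_highestTableau {lam mu : YoungDiagram} {a : ℕ}
    (h : (highestTableau lam a).word.Perm (highestTableau mu a).word) : lam = mu := by
  have key : ∀ p, lam.rowLen p = mu.rowLen p := fun p => by
    rw [← count_word_highestTableau lam a, ← count_word_highestTableau mu a, h.count_eq]
  ext ⟨r, c⟩
  rw [YoungDiagram.mem_cells, YoungDiagram.mem_cells, YoungDiagram.mem_iff_lt_rowLen,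
    YoungDiagram.mem_iff_lt_rowLen, key]

theorem SemistandardYoungTableau.add_le_entry {lam : YoungDiagram} (T : SemistandardYoungTableau lam)
    {a : ℕ} (ha : ∀ r c, (r, c) ∈ lam → a ≤ T r c) {r c : ℕ} (h : (r, c) ∈ lam) :
    a + r ≤ T r c := by
  induction r with
  | zero => exact ha _ _ h
  | succ r ih =>
    have := ih (lam.up_left_mem (Nat.le_succ r) le_rfl h)
    have h1 : T r c < T (r + 1) c := T.col_strict (Nat.lt_succ_self r) h
    omega

/-- Column strictness bounds the entries from below. For the upper bound, an entry `i + 1 > a + r`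
at the right end of row `r` would be an unmatched opening bracket: everything read after it lies in
earlier rows, where by induction all entries are smaller than `i`. -/
theorem SemistandardYoungTableau.eq_highestTableau {lam : YoungDiagram}
    (T : SemistandardYoungTableau lam) {a : ℕ} (h : IsHighestWord a T.word) :
    T = highestTableau lam a := by
  have ha : ∀ r c, (r, c) ∈ lam → a ≤ T r c := fun r c hrc => h.1 _ (T.mem_word hrc)
  have key : ∀ r c, (r, c) ∈ lam → T r c ≤ a + r := by
    intro r
    induction r using Nat.strong_induction_on with
    | _ r ih =>
      intro c hrc
      have hc := YoungDiagram.mem_iff_lt_rowLen.1 hrc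
      set c₀ := lam.rowLen r - 1 with hc₀
      have hrc₀ : (r, c₀) ∈ lam := YoungDiagram.mem_iff_lt_rowLen.2 (by omega)
      refine (T.row_weak_le (show c ≤ c₀ by omega) hrc₀).trans ?_
      by_contra hlt
      obtain ⟨i, hi⟩ : ∃ i, T r c₀ = i + 1 := ⟨T r c₀ - 1, by omega⟩
      have hnot : i ∉ wordAfter lam T r c₀ := by
        intro hmem
        rcases mem_wordAfter hmem with ⟨r', hr', rfl⟩ | ⟨r', c', hc', hmem', rfl⟩
        · have := ih r' hr' c₀ (lam.up_left_mem hr'.le le_rfl hrc₀)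
          omega
        · have hr' : r' < r := by
            by_contra hge
            have := YoungDiagram.mem_iff_lt_rowLen.1
              (lam.up_left_mem (not_lt.1 hge) le_rfl hmem')
            omega
          have := ih r' hr' c' hmem'
          omega
      have := h.2 i (by omega)
      rw [T.word_split hrc₀, hi, wordEps_append, wordEps_cons_open,
        wordPhi_eq_zero_of_notMem hnot] at this
      omega
  ext r c
  by_cases hrc : (r, c) ∈ lam
  · rw [highestTableau_apply hrc]
    exact le_antisymm (key r c hrc) (T.add_le_entry ha hrc)
  · rw [T.zeros hrc, (highestTableau lam a).zeros hrc]

/-- The run lengths of the normal form are the column lengths of the shape, hence the transpose. -/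
theorem IsHighestWord.exists_knuthEquiv_highestTableau {a : ℕ} {w : List ℕ}
    (h : IsHighestWord a w) :
    ∃ lam : YoungDiagram, KnuthEquiv w (highestTableau lam a).word := by
  obtain ⟨ks, h1, h2, h3⟩ := h.exists_knuthEquiv_runs
  refine ⟨(YoungDiagram.ofRowLens ks h1).transpose, ?_⟩
  rwa [word_highestTableau, YoungDiagram.transpose_transpose,
    YoungDiagram.rowLens_ofRowLens_eq_self h2]

/-- Highest-weight words of the same content are Knuth equivalent. -/
theorem IsHighestWord.knuthEquiv_of_perm {a : ℕ} {w v : List ℕ} (hw : IsHighestWord a w)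
    (hv : IsHighestWord a v) (h : w.Perm v) : KnuthEquiv w v := by
  obtain ⟨lam, hlam⟩ := hw.exists_knuthEquiv_highestTableau
  obtain ⟨mu, hmu⟩ := hv.exists_knuthEquiv_highestTableau
  obtain rfl := eq_of_perm_word_highestTableau ((hlam.perm.symm.trans h).trans hmu.perm)
  exact hlam.trans hmu.symm

/-! ### Existence and uniqueness of the tableau of a Knuth class -/

theorem exists_wordLower_to_or_isHighestWord (w : List ℕ) :
    (∃ i w', WordLower i w' w) ∨ IsHighestWord 0 w := by
  by_cases h : ∃ i w', WordLower i w' w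
  · exact .inl h
  · refine .inr ⟨fun _ _ => Nat.zero_le _, fun i _ => ?_⟩
    by_contra hi
    exact h ⟨i, exists_wordLower_to_iff.2 (Nat.pos_of_ne_zero hi)⟩

/-- Raise `w` until the normal form provides a tableau, then lower that tableau back along the same
operators; reading words of a shape are stable under them. -/
theorem exists_knuthEquiv_tableau (w : List ℕ) : ∃ T : Tableau, KnuthEquiv w T.2.word := by
  induction hs : w.sum generalizing w with
  | zero =>
    rcases exists_wordLower_to_or_isHighestWord w with ⟨i, w', h⟩ | h
    · have := h.sum_eq
      omega
    · obtain ⟨lam, h⟩ := h.exists_knuthEquiv_highestTableau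
      exact ⟨⟨lam, _⟩, h⟩
  | succ n ih =>
    rcases exists_wordLower_to_or_isHighestWord w with ⟨i, w', h⟩ | h
    · have := h.sum_eq
      obtain ⟨⟨lam, T⟩, hT⟩ := ih w' (by omega)
      obtain ⟨v, hv, hwv⟩ := hT.exists_wordLower h
      obtain ⟨T', rfl⟩ := T.exists_word_eq_of_wordLower hv
      exact ⟨⟨lam, T'⟩, hwv⟩
    · obtain ⟨lam, h⟩ := h.exists_knuthEquiv_highestTableau
      exact ⟨⟨lam, _⟩, h⟩

/-- Equivalent tableaux can be raised in parallel until both have highest weight, where the common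
content fixes the shape. Lowering is single-valued, so the equality descends again. -/
theorem tableau_eq_of_knuthEquiv {T T' : Tableau} (h : KnuthEquiv T.2.word T'.2.word) : T = T' := by
  induction hs : T.2.word.sum using Nat.strong_induction_on generalizing T T' with
  | _ n ih =>
    obtain ⟨lam, T⟩ := T
    obtain ⟨mu, T'⟩ := T'
    rcases exists_wordLower_to_or_isHighestWord T.word with ⟨i, w, hw⟩ | hT
    · obtain ⟨v, hv, hwv⟩ := h.exists_wordRaise hw
      obtain ⟨S, rfl⟩ := T.exists_word_eq_of_wordRaise hw
      obtain ⟨S', rfl⟩ := T'.exists_word_eq_of_wordRaise hv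
      have := hw.sum_eq
      have hSS := ih S.word.sum (by simp only at hs; omega) (T := ⟨lam, S⟩) (T' := ⟨mu, S'⟩) hwv rfl
      obtain ⟨rfl, hSS⟩ := Sigma.mk.inj_iff.1 hSS
      obtain rfl := eq_of_heq hSS
      rw [SemistandardYoungTableau.word_injective (hw.right_unique hv)]
    · obtain rfl := T.eq_highestTableau hT
      obtain rfl := T'.eq_highestTableau (hT.of_knuthEquiv h)
      obtain rfl := eq_of_perm_word_highestTableau h.perm
      rfl

theorem knuthEquiv_knuthTableau (w : List ℕ) : KnuthEquiv w (knuthTableau w).2.word :=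
  Classical.epsilon_spec (exists_knuthEquiv_tableau w)

theorem knuthTableau_eq_of_knuthEquiv {w : List ℕ} {T : Tableau} (h : KnuthEquiv w T.2.word) :
    knuthTableau w = T :=
  tableau_eq_of_knuthEquiv ((knuthEquiv_knuthTableau w).symm.trans h)

theorem knuthTableau_eq_iff {w v : List ℕ} : knuthTableau w = knuthTableau v ↔ KnuthEquiv w v := by
  constructor
  · intro h
    exact (knuthEquiv_knuthTableau w).trans (h ▸ (knuthEquiv_knuthTableau v).symm)
  · intro h
    exact knuthTableau_eq_of_knuthEquiv (h.trans (knuthEquiv_knuthTableau v))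

/-- Connectedness in the word crystal with the operators whose index satisfies `p`. -/
def WordConnected (p : ℕ → Prop) : List ℕ → List ℕ → Prop :=
  Relation.EqvGen fun w w' => ∃ i, p i ∧ WordLower i w w'

/-- Paths are transported from either end, since the closure contains reversed steps. -/
theorem CrystalBisimulation.wordConnected {θ : List ℕ → List ℕ → Prop} {p : ℕ → Prop}
    {w w' : List ℕ} (hθ : CrystalBisimulation θ) (h : WordConnected p w w') :
    (∀ v, θ w v → ∃ v', WordConnected p v v' ∧ θ w' v') ∧
      ∀ v', θ w' v' → ∃ v, WordConnected p v v' ∧ θ w v := by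
  induction h with
  | rel w w' h =>
    obtain ⟨i, hi, h⟩ := h
    refine ⟨fun v hv => ?_, fun v hv => ?_⟩
    · obtain ⟨v', h1, h2⟩ := hθ.lower hv h
      exact ⟨v', .rel _ _ ⟨i, hi, h1⟩, h2⟩
    · obtain ⟨v', h1, h2⟩ := hθ.raise hv h
      exact ⟨v', .rel _ _ ⟨i, hi, h1⟩, h2⟩
  | refl w => exact ⟨fun v hv => ⟨v, .refl _, hv⟩, fun v hv => ⟨v, .refl _, hv⟩⟩
  | symm _ _ _ ih =>
    refine ⟨fun v hv => ?_, fun v hv => ?_⟩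
    · obtain ⟨v', h1, h2⟩ := ih.2 v hv
      exact ⟨v', .symm _ _ h1, h2⟩
    · obtain ⟨v', h1, h2⟩ := ih.1 v hv
      exact ⟨v', .symm _ _ h1, h2⟩
  | trans _ _ _ _ _ ih ih' =>
    refine ⟨fun v hv => ?_, fun v hv => ?_⟩
    · obtain ⟨v', h1, h2⟩ := ih.1 v hv
      obtain ⟨v'', h3, h4⟩ := ih'.1 v' h2
      exact ⟨v'', .trans _ _ _ h1 h3, h4⟩
    · obtain ⟨v', h1, h2⟩ := ih'.2 v hv
      obtain ⟨v'', h3, h4⟩ := ih.2 v' h2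
      exact ⟨v'', .trans _ _ _ h3 h1, h4⟩

theorem SemistandardYoungTableau.exists_word_eq_of_wordConnected {lam : YoungDiagram}
    {p : ℕ → Prop} {w w' : List ℕ} (h : WordConnected p w w') :
    (∃ T : SemistandardYoungTableau lam, T.word = w) ↔
      ∃ T : SemistandardYoungTableau lam, T.word = w' := by
  induction h with
  | rel w w' h =>
    obtain ⟨i, -, h⟩ := h
    constructor
    · rintro ⟨T, rfl⟩
      exact T.exists_word_eq_of_wordLower h
    · rintro ⟨T, rfl⟩
      exact T.exists_word_eq_of_wordRaise h
  | refl w => rfl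
  | symm _ _ _ ih => exact ih.symm
  | trans _ _ _ _ _ ih ih' => exact ih.trans ih'

/-- A word is determined by its tableau and its connected component. -/
theorem WordConnected.eq_of_knuthEquiv {p : ℕ → Prop} {w w' : List ℕ} (h : WordConnected p w w')
    (hk : KnuthEquiv w w') : w = w' := by
  obtain ⟨⟨lam, T⟩, hT⟩ := exists_knuthEquiv_tableau w
  -- The path is carried over to a tableau word. Its end is again a tableau word of the same shape,
  -- so uniqueness closes the path there, and injectivity of `θ` pulls the equality back.
  obtain ⟨θ, hθ, hw⟩ := hT.exists_crystalBisimulation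
  obtain ⟨v, hv, hwv⟩ := (hθ.wordConnected h).1 _ hw
  obtain ⟨T', rfl⟩ := (SemistandardYoungTableau.exists_word_eq_of_wordConnected (lam := lam) hv).1
    ⟨T, rfl⟩
  have : (⟨lam, T⟩ : Tableau) = ⟨lam, T'⟩ :=
    tableau_eq_of_knuthEquiv ((hT.symm.trans hk).trans (hθ.knuthEquiv hwv))
  obtain rfl : T = T' := by simpa using this
  exact hθ.left_unique hw hwv

/-! ### Row operators on matrices and signatures of columns -/

section RowOperators

variable {m n : ℕ}

/-- The letters of the row word coming from the column `j`. -/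
def columnLetters (M : Matrix (Fin m) (Fin n) ℕ) (j : Fin n) : List ℕ :=
  (List.finRange m).flatMap fun i => List.replicate (M i j) (i.val + 1)

theorem columnLetters_eq (M : Matrix (Fin m) (Fin n) ℕ) (j : Fin n) : columnLetters M j =
    (List.finRange m).flatMap fun i => List.replicate (M i j) (i.val + 1) := rfl

theorem rowWord_eq_flatMap (M : Matrix (Fin m) (Fin n) ℕ) :
    rowWord M = (List.finRange n).flatMap (columnLetters M) := by
  simp [rowWord, rowCells, List.map_flatMap, funext (columnLetters_eq M)]

theorem colWord_eq_rowWord_transpose (M : Matrix (Fin m) (Fin n) ℕ) :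
    colWord M = rowWord M.transpose := by
  rw [rowWord_eq_flatMap]
  rfl

theorem finRange_split {k : ℕ} {l₁ l₂ : List (Fin k)} {a : Fin k}
    (h : List.finRange k = l₁ ++ a :: l₂) :
    (∀ x, x ∈ l₁ ↔ x < a) ∧ ∀ x, x ∈ l₂ ↔ a < x := by
  have hp : (l₁ ++ a :: l₂).Pairwise (· < ·) := h ▸ List.pairwise_lt_finRange k
  rw [List.pairwise_append, List.pairwise_cons] at hp
  obtain ⟨-, ⟨h2, -⟩, h3⟩ := hp
  have hx : ∀ x, x ∈ l₁ ∨ x = a ∨ x ∈ l₂ := fun x => by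
    have := List.mem_finRange x
    rw [h] at this
    simpa using this
  refine ⟨fun x => ⟨fun hx => h3 x hx a (by simp), fun hxa => ?_⟩,
    fun x => ⟨h2 x, fun hxa => ?_⟩⟩
  · rcases hx x with h | rfl | h
    · exact h
    · exact absurd hxa (lt_irrefl _)
    · exact absurd (h2 x h) hxa.asymm
  · rcases hx x with h | rfl | h
    · exact absurd (h3 x h a (by simp)) hxa.asymm
    · exact absurd hxa (lt_irrefl _)
    · exact h

theorem exists_finRange_split {k : ℕ} (a : Fin k) :
    ∃ l₁ l₂, List.finRange k = l₁ ++ a :: l₂ :=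
  List.append_of_mem (List.mem_finRange a)

theorem exists_finRange_split_succ {k : ℕ} {p q : Fin k} (hpq : p.val + 1 = q.val)
    {l₁ l₂ : List (Fin k)} (h : List.finRange k = l₁ ++ p :: l₂) : ∃ l₃, l₂ = q :: l₃ := by
  have hq : q ∈ l₂ := ((finRange_split h).2 q).2 (Fin.lt_def.2 (by omega))
  obtain ⟨s, t, rfl⟩ := List.append_of_mem hq
  have h' : List.finRange k = (l₁ ++ p :: s) ++ q :: t := by simp [h]
  cases s with
  | nil => exact ⟨t, rfl⟩
  | cons x s =>
    exfalso
    have h1 := ((finRange_split h).2 x).1 (by simp)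
    have h2 := ((finRange_split h').1 x).1 (by simp)
    rw [Fin.lt_def] at h1 h2
    omega

/-! ### Brackets of constant runs and of matrix columns -/

theorem wordPhi_replicate (i k : ℕ) : wordPhi i (List.replicate k i) = k := by
  induction k with
  | zero => rfl
  | succ k ih => simp [List.replicate_succ, ih]

theorem wordEps_replicate (i k : ℕ) : wordEps i (List.replicate k i) = 0 :=
  wordEps_eq_zero_of_notMem (by simp [List.mem_replicate])

theorem wordPhi_replicate_succ (i k : ℕ) : wordPhi i (List.replicate k (i + 1)) = 0 :=
  wordPhi_eq_zero_of_notMem (by simp [List.mem_replicate])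

theorem wordEps_replicate_succ (i k : ℕ) : wordEps i (List.replicate k (i + 1)) = k := by
  induction k with
  | zero => rfl
  | succ k ih => simp [List.replicate_succ, ih, wordPhi_replicate_succ]

theorem signature_flatMap_replicate_eq_zero {i : ℕ} {l : List (Fin m)} (f : Fin m → ℕ)
    (h : ∀ r ∈ l, r.val + 1 ≠ i ∧ r.val ≠ i) :
    wordPhi i (l.flatMap fun r => List.replicate (f r) (r.val + 1)) = 0 ∧
      wordEps i (l.flatMap fun r => List.replicate (f r) (r.val + 1)) = 0 := by
  apply word_signature_eq_zero
  intro x hx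
  obtain ⟨r, hr, hx⟩ := List.mem_flatMap.1 hx
  obtain ⟨-, rfl⟩ := List.mem_replicate.1 hx
  have := h r hr
  omega

theorem signature_above {p q : Fin m} (hpq : p.val + 1 = q.val) {l₁ l₂ : List (Fin m)}
    (h : List.finRange m = l₁ ++ p :: l₂) (f : Fin m → ℕ) :
    wordPhi q.val (l₁.flatMap fun r => List.replicate (f r) (r.val + 1)) = 0 ∧
      wordEps q.val (l₁.flatMap fun r => List.replicate (f r) (r.val + 1)) = 0 := by
  apply signature_flatMap_replicate_eq_zero
  intro r hr
  have := Fin.lt_def.1 (((finRange_split h).1 r).1 hr)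
  omega

theorem signature_below {p q : Fin m} {l₁ l₃ : List (Fin m)}
    (h : List.finRange m = l₁ ++ p :: q :: l₃) (f : Fin m → ℕ) :
    wordPhi q.val (l₃.flatMap fun r => List.replicate (f r) (r.val + 1)) = 0 ∧
      wordEps q.val (l₃.flatMap fun r => List.replicate (f r) (r.val + 1)) = 0 := by
  apply signature_flatMap_replicate_eq_zero
  intro r hr
  have h' : List.finRange m = (l₁ ++ [p]) ++ q :: l₃ := by simp [h]
  have := Fin.lt_def.1 (((finRange_split h').2 r).1 hr)
  omega

/-- Within a column the closing brackets from row `p` precede the opening ones from row `q`, so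
nothing is matched there. Rows are indexed from `0` and letters from `1`: row `p` carries the letter
`q.val`, the index of the operator. -/
theorem signature_columnLetters {p q : Fin m} (hpq : p.val + 1 = q.val)
    (M : Matrix (Fin m) (Fin n) ℕ) (j : Fin n) :
    wordPhi q.val (columnLetters M j) = M p j ∧ wordEps q.val (columnLetters M j) = M q j := by
  obtain ⟨l₁, l₂, h⟩ := exists_finRange_split p
  obtain ⟨l₃, rfl⟩ := exists_finRange_split_succ hpq h
  simp only [columnLetters, h, List.flatMap_append, List.flatMap_cons, wordPhi_append,
    wordEps_append, signature_above hpq h, signature_below h, hpq, wordPhi_replicate,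
    wordEps_replicate, wordPhi_replicate_succ, wordEps_replicate_succ]
  omega

/-- Splitting the list of cells at one of its members. -/
theorem rowCells_eq_append_cons {M : Matrix (Fin m) (Fin n) ℕ} {A B : List (Fin m × Fin n)}
    {c : Fin m × Fin n} (h : rowCells M = A ++ c :: B) : ∃ l₁ l₂ m₁ m₂ x y,
      List.finRange n = l₁ ++ c.2 :: l₂ ∧ List.finRange m = m₁ ++ c.1 :: m₂ ∧
      M c.1 c.2 = x + 1 + y ∧
      A.map (fun c => c.1.val + 1) = l₁.flatMap (columnLetters M) ++
        (m₁.flatMap (fun r => List.replicate (M r c.2) (r.val + 1)) ++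
          List.replicate x (c.1.val + 1)) ∧
      B.map (fun c => c.1.val + 1) = List.replicate y (c.1.val + 1) ++
        (m₂.flatMap (fun r => List.replicate (M r c.2) (r.val + 1)) ++
          l₂.flatMap (columnLetters M)) := by
  obtain ⟨l₁, a, l₂, u, t, h1, h2, rfl, rfl⟩ := List.flatMap_eq_append_cons h
  obtain ⟨m₁, r, m₂, u', t', h3, h4, rfl, rfl⟩ := List.flatMap_eq_append_cons h2
  rw [List.replicate_eq_append_iff] at h4
  obtain ⟨h5, h6, h7⟩ := h4
  have h8 := List.eq_replicate_iff.1 h7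
  obtain rfl : c = (r, a) := h8.2 c (by simp)
  obtain ⟨y, hy⟩ : ∃ y, t'.length = y := ⟨_, rfl⟩
  obtain rfl : t' = List.replicate y (r, a) :=
    List.eq_replicate_iff.2 ⟨hy, fun b hb => h8.2 b (by simp [hb])⟩
  obtain ⟨x, hx⟩ : ∃ x, u'.length = x := ⟨_, rfl⟩
  rw [hx] at h6
  subst h6
  refine ⟨l₁, l₂, m₁, m₂, x, y, h1, h3, ?_, ?_, ?_⟩
  · simp at h5 ⊢
    omega
  · simp [List.map_flatMap, funext (columnLetters_eq M)]
  · simp [List.map_flatMap, funext (columnLetters_eq M)]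

theorem exists_rowCells_eq_append_cons {M : Matrix (Fin m) (Fin n) ℕ} {l₁ l₂ : List (Fin n)}
    {m₁ m₂ : List (Fin m)} {r : Fin m} {a : Fin n} {x y : ℕ}
    (h₁ : List.finRange n = l₁ ++ a :: l₂) (h₂ : List.finRange m = m₁ ++ r :: m₂)
    (h : M r a = x + 1 + y) : ∃ A B, rowCells M = A ++ (r, a) :: B ∧
      A.map (fun c => c.1.val + 1) = l₁.flatMap (columnLetters M) ++
        (m₁.flatMap (fun i => List.replicate (M i a) (i.val + 1)) ++
          List.replicate x (r.val + 1)) ∧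
      B.map (fun c => c.1.val + 1) = List.replicate y (r.val + 1) ++
        (m₂.flatMap (fun i => List.replicate (M i a) (i.val + 1)) ++
          l₂.flatMap (columnLetters M)) := by
  refine ⟨(l₁.flatMap fun j => (List.finRange m).flatMap fun i => List.replicate (M i j) (i, j)) ++
      (m₁.flatMap (fun i => List.replicate (M i a) (i, a)) ++ List.replicate x (r, a)),
    List.replicate y (r, a) ++ (m₂.flatMap (fun i => List.replicate (M i a) (i, a)) ++
      l₂.flatMap fun j => (List.finRange m).flatMap fun i => List.replicate (M i j) (i, j)),
    ?_, ?_, ?_⟩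
  · unfold rowCells
    rw [h₁, List.flatMap_append, List.flatMap_cons]
    have : (List.finRange m).flatMap (fun i => List.replicate (M i a) (i, a)) =
        m₁.flatMap (fun i => List.replicate (M i a) (i, a)) ++ (List.replicate x (r, a) ++
          (r, a) :: (List.replicate y (r, a) ++
            m₂.flatMap (fun i => List.replicate (M i a) (i, a)))) := by
      rw [h₂, List.flatMap_append, List.flatMap_cons, h, List.replicate_add, List.replicate_succ']
      simp
    rw [this]
    simp only [List.append_assoc, List.cons_append]
  · simp [List.map_flatMap, funext (columnLetters_eq M)]
  · simp [List.map_flatMap, funext (columnLetters_eq M)]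

theorem moveUnit_apply (M : Matrix (Fin m) (Fin n) ℕ) (s t : Fin m) (a : Fin n) (x : Fin m)
    (y : Fin n) : moveUnit M s t a x y =
      if y = a then (if x = s then M x y - 1 else if x = t then M x y + 1 else M x y)
      else M x y := rfl

section

variable {p q : Fin m} {M M' : Matrix (Fin m) (Fin n) ℕ}

theorem rowLower_val (hpq : p.val + 1 = q.val) (M : Matrix (Fin m) (Fin n) ℕ) :
    rowLower q.val M = (loweringPos q.val (rowWord M)).bind fun x =>
      ((rowCells M)[x]?).map fun c => moveUnit M c.1 q c.2 := by
  rw [rowLower, dif_pos ⟨by omega, q.isLt⟩]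

theorem rowRaise_val (hpq : p.val + 1 = q.val) (M : Matrix (Fin m) (Fin n) ℕ) :
    rowRaise q.val M = (raisingPos q.val (rowWord M)).bind fun x =>
      ((rowCells M)[x]?).map fun c => moveUnit M c.1 p c.2 := by
  rw [rowRaise, dif_pos ⟨by omega, q.isLt⟩]
  have hp : (⟨q.val - 1, by omega⟩ : Fin m) = p := Fin.ext (by simp; omega)
  simp only [hp]

theorem rowLower_eq_some_iff (hpq : p.val + 1 = q.val) :
    rowLower q.val M = some M' ↔ ∃ a l₁ l₂, List.finRange n = l₁ ++ a :: l₂ ∧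
      M' = moveUnit M p q a ∧ wordEps q.val (l₁.flatMap (columnLetters M)) < M p a ∧
      wordPhi q.val (l₂.flatMap (columnLetters M)) ≤ M q a := by
  rw [rowLower_val hpq]
  simp only [Option.bind_eq_some_iff, Option.map_eq_some_iff]
  constructor
  · rintro ⟨x, hx, c, hc, rfl⟩
    obtain ⟨u, t, hw, rfl, hu, ht⟩ := loweringPos_eq_some_iff.1 hx
    obtain ⟨A, B', hAB, rfl, hB'⟩ := List.map_eq_append_iff.1 hw
    obtain ⟨c', B, rfl, hc', rfl⟩ := List.map_eq_cons_iff.1 hB'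
    obtain rfl : c' = c := by simpa [hAB] using hc
    obtain ⟨l₁, l₂, m₁, m₂, x, y, h1, h2, h3, h4, h5⟩ := rowCells_eq_append_cons hAB
    obtain ⟨r, a⟩ := c'
    simp only at h1 h2 h3 h4 h5 hc'
    obtain rfl : r = p := Fin.ext (by omega)
    obtain ⟨m₃, rfl⟩ := exists_finRange_split_succ hpq h2
    refine ⟨a, l₁, l₂, h1, rfl, ?_, ?_⟩
    · rw [h4] at hu
      simp only [wordEps_append, wordPhi_append, signature_above hpq h2, hpq, wordPhi_replicate,
        wordEps_replicate] at hu
      omega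
    · rw [h5] at ht
      simp only [List.flatMap_cons, wordEps_append, wordPhi_append, signature_below h2, hpq,
        wordPhi_replicate, wordEps_replicate, wordPhi_replicate_succ, wordEps_replicate_succ] at ht
      omega
  · rintro ⟨a, l₁, l₂, h1, rfl, hu, ht⟩
    obtain ⟨m₁, m₂, h2⟩ := exists_finRange_split p
    obtain ⟨m₃, rfl⟩ := exists_finRange_split_succ hpq h2
    -- The rightmost unmatched closing bracket is the last copy of its cell, whence `y := 0`.
    obtain ⟨A, B, h3, h4, h5⟩ := exists_rowCells_eq_append_cons (M := M) h1 h2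
      (x := M p a - 1) (y := 0) (by omega)
    refine ⟨A.length, ?_, (p, a), by simp [h3], rfl⟩
    rw [rowWord, h3, List.map_append, List.map_cons, h4, h5, hpq, loweringPos_split, ← hpq, ← h4,
      List.length_map]
    · simp only [wordEps_append, wordPhi_append, signature_above hpq h2, wordPhi_replicate,
        wordEps_replicate]
      omega
    · simp only [List.flatMap_cons, wordEps_append, wordPhi_append, signature_below h2,
        wordPhi_replicate, wordEps_replicate, wordPhi_replicate_succ, wordEps_replicate_succ]
      omega

theorem rowRaise_eq_some_iff (hpq : p.val + 1 = q.val) :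
    rowRaise q.val M = some M' ↔ ∃ a l₁ l₂, List.finRange n = l₁ ++ a :: l₂ ∧
      M' = moveUnit M q p a ∧ wordEps q.val (l₁.flatMap (columnLetters M)) ≤ M p a ∧
      wordPhi q.val (l₂.flatMap (columnLetters M)) < M q a := by
  rw [rowRaise_val hpq]
  simp only [Option.bind_eq_some_iff, Option.map_eq_some_iff]
  constructor
  · rintro ⟨x, hx, c, hc, rfl⟩
    obtain ⟨u, t, hw, rfl, hu, ht⟩ := raisingPos_eq_some_iff.1 hx
    obtain ⟨A, B', hAB, rfl, hB'⟩ := List.map_eq_append_iff.1 hw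
    obtain ⟨c', B, rfl, hc', rfl⟩ := List.map_eq_cons_iff.1 hB'
    obtain rfl : c' = c := by simpa [hAB] using hc
    obtain ⟨l₁, l₂, m₁, m₃, x, y, h1, h2, h3, h4, h5⟩ := rowCells_eq_append_cons hAB
    obtain ⟨r, a⟩ := c'
    simp only at h1 h2 h3 h4 h5 hc'
    obtain rfl : r = q := Fin.ext (by omega)
    obtain ⟨m₀, m₂, h2'⟩ := exists_finRange_split p
    obtain ⟨m₃', rfl⟩ := exists_finRange_split_succ hpq h2'
    have h6 : (m₀ ++ [p]) ++ r :: m₃' = m₁ ++ r :: m₃ := by rw [← h2, h2']; simp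
    obtain ⟨rfl, h7⟩ : m₀ ++ [p] = m₁ ∧ r :: m₃' = r :: m₃ := by
      have hn : ((m₀ ++ [p]) ++ r :: m₃').Nodup := by
        have := List.nodup_finRange m
        rw [h2'] at this
        simpa using this
      refine List.append_inj h6 ?_
      have e1 : ((m₀ ++ [p]) ++ r :: m₃').idxOf r = (m₀ ++ [p]).length := by
        rw [List.idxOf_append_of_notMem]
        · simp
        · intro hmem
          exact List.disjoint_of_nodup_append hn hmem (by simp)
      have e2 : (m₁ ++ r :: m₃).idxOf r = m₁.length := by
        rw [List.idxOf_append_of_notMem]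
        · simp
        · intro hmem
          exact List.disjoint_of_nodup_append (h6 ▸ hn) hmem (by simp)
      rw [← e1, ← e2, h6]
    obtain rfl : m₃' = m₃ := by simpa using h7
    refine ⟨a, l₁, l₂, h1, rfl, ?_, ?_⟩
    · rw [h4] at hu
      simp only [List.flatMap_append, List.flatMap_singleton, wordEps_append, wordPhi_append,
        signature_above hpq h2', hpq, wordPhi_replicate, wordEps_replicate, wordPhi_replicate_succ,
        wordEps_replicate_succ] at hu
      omega
    · rw [h5] at ht
      simp only [wordPhi_append, signature_below h2', wordPhi_replicate_succ,
        wordEps_replicate_succ] at ht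
      omega
  · rintro ⟨a, l₁, l₂, h1, rfl, hu, ht⟩
    obtain ⟨m₁, m₂, h2⟩ := exists_finRange_split p
    obtain ⟨m₃, rfl⟩ := exists_finRange_split_succ hpq h2
    -- The leftmost unmatched opening bracket is the first copy of its cell, whence `x := 0`.
    obtain ⟨A, B, h3, h4, h5⟩ := exists_rowCells_eq_append_cons (M := M) (m₁ := m₁ ++ [p])
      (m₂ := m₃) (r := q) h1 (by simp [h2]) (x := 0) (y := M q a - 1) (by omega)
    refine ⟨A.length, ?_, (q, a), by simp [h3], rfl⟩
    rw [rowWord, h3, List.map_append, List.map_cons, h4, h5, raisingPos_split, ← h4,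
      List.length_map]
    · simp only [List.flatMap_append, List.flatMap_singleton, wordEps_append, wordPhi_append,
        signature_above hpq h2, hpq, wordPhi_replicate, wordEps_replicate, wordPhi_replicate_succ,
        wordEps_replicate_succ]
      omega
    · simp only [wordPhi_append, signature_below h2, wordPhi_replicate_succ,
        wordEps_replicate_succ]
      omega

theorem columnLetters_congr {j : Fin n} (h : ∀ i, M i j = M' i j) :
    columnLetters M j = columnLetters M' j := by
  simp [columnLetters, h]

theorem flatMap_columnLetters_congr {l : List (Fin n)} (h : ∀ j ∈ l, ∀ i, M i j = M' i j) :
    l.flatMap (columnLetters M) = l.flatMap (columnLetters M') :=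
  List.flatMap_congr fun j hj => columnLetters_congr (h j hj)

theorem flatMap_columnLetters_moveUnit {s t : Fin m} {a : Fin n} {l₁ l₂ : List (Fin n)}
    (h : List.finRange n = l₁ ++ a :: l₂) :
    l₁.flatMap (columnLetters (moveUnit M s t a)) = l₁.flatMap (columnLetters M) ∧
      l₂.flatMap (columnLetters (moveUnit M s t a)) = l₂.flatMap (columnLetters M) := by
  constructor
  · apply flatMap_columnLetters_congr
    intro j hj i
    rw [moveUnit_apply, if_neg (((finRange_split h).1 j).1 hj).ne]
  · apply flatMap_columnLetters_congr
    intro j hj i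
    rw [moveUnit_apply, if_neg (((finRange_split h).2 j).1 hj).ne']

theorem moveUnit_moveUnit {s t : Fin m} {a : Fin n} (hst : s ≠ t) (h : 0 < M s a) :
    moveUnit (moveUnit M s t a) t s a = M := by
  funext x y
  simp only [moveUnit_apply]
  split_ifs <;> first | rfl | (subst_vars; omega)

/-- Raising and lowering row operators are partial inverses of each other. -/
theorem rowRaise_eq_some_iff_rowLower (hpq : p.val + 1 = q.val) :
    rowRaise q.val M = some M' ↔ rowLower q.val M' = some M := by
  have hne : p ≠ q := by rintro rfl; omega
  rw [rowRaise_eq_some_iff hpq, rowLower_eq_some_iff hpq]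
  constructor
  · rintro ⟨a, l₁, l₂, h, rfl, hu, ht⟩
    refine ⟨a, l₁, l₂, h, (moveUnit_moveUnit hne.symm (by omega)).symm, ?_, ?_⟩
    · rw [(flatMap_columnLetters_moveUnit h).1]
      simp [moveUnit_apply, hne]
      omega
    · rw [(flatMap_columnLetters_moveUnit h).2]
      simp [moveUnit_apply]
      omega
  · rintro ⟨a, l₁, l₂, h, rfl, hu, ht⟩
    refine ⟨a, l₁, l₂, h, (moveUnit_moveUnit hne (by omega)).symm, ?_, ?_⟩
    · rw [(flatMap_columnLetters_moveUnit h).1]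
      simp [moveUnit_apply]
      omega
    · rw [(flatMap_columnLetters_moveUnit h).2]
      simp [moveUnit_apply, hne.symm]
      omega

/-- In column `a` the last letter of row `p` is adjacent to the letters of row `q`, so moving one
unit changes exactly one letter of the row word. -/
theorem wordLower_of_rowLower_val (hpq : p.val + 1 = q.val) (h : rowLower q.val M = some M') :
    WordLower q.val (rowWord M) (rowWord M') := by
  have hne : p ≠ q := by rintro rfl; omega
  obtain ⟨a, l₁, l₂, h1, rfl, hu, ht⟩ := (rowLower_eq_some_iff hpq).1 h
  obtain ⟨m₁, m₂, h2⟩ := exists_finRange_split p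
  obtain ⟨m₃, rfl⟩ := exists_finRange_split_succ hpq h2
  have h2' : List.finRange m = (m₁ ++ [p]) ++ q :: m₃ := by simp [h2]
  have e1 : ∀ i ∈ m₁, moveUnit M p q a i a = M i a := fun i hi => by
    have := ((finRange_split h2).1 i).1 hi
    have h3 : i ≠ q := by rintro rfl; rw [Fin.lt_def] at this; omega
    simp [moveUnit_apply, this.ne, h3]
  have e2 : ∀ i ∈ m₃, moveUnit M p q a i a = M i a := fun i hi => by
    have := ((finRange_split h2').2 i).1 hi
    have h3 : i ≠ p := by rintro rfl; rw [Fin.lt_def] at this; omega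
    simp [moveUnit_apply, this.ne', h3]
  have e3 : moveUnit M p q a p a = M p a - 1 := by simp [moveUnit_apply]
  have e4 : moveUnit M p q a q a = M q a + 1 := by simp [moveUnit_apply, hne.symm]
  obtain ⟨k, hk⟩ : ∃ k, M p a = k + 1 := ⟨M p a - 1, by omega⟩
  refine ⟨l₁.flatMap (columnLetters M) ++
      (m₁.flatMap (fun i => List.replicate (M i a) (i.val + 1)) ++ List.replicate k q.val),
    (List.replicate (M q a) (q.val + 1) ++
      m₃.flatMap (fun i => List.replicate (M i a) (i.val + 1))) ++
        l₂.flatMap (columnLetters M), ?_, ?_, ?_, ?_⟩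
  · rw [rowWord_eq_flatMap, h1, List.flatMap_append, List.flatMap_cons, columnLetters_eq, h2]
    simp only [List.flatMap_append, List.flatMap_cons, hk, hpq, List.replicate_succ']
    simp
  · rw [rowWord_eq_flatMap, h1, List.flatMap_append, List.flatMap_cons, columnLetters_eq, h2]
    simp only [List.flatMap_append, List.flatMap_cons, (flatMap_columnLetters_moveUnit h1).1,
      (flatMap_columnLetters_moveUnit h1).2, e3, e4, hk, hpq, Nat.add_sub_cancel,
      List.replicate_succ]
    rw [List.flatMap_congr (l := m₁) fun i hi => by rw [e1 i hi],
      List.flatMap_congr (l := m₃) fun i hi => by rw [e2 i hi]]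
    simp
  · simp only [wordEps_append, wordPhi_append, signature_above hpq h2, wordPhi_replicate,
      wordEps_replicate]
    omega
  · simp only [wordEps_append, wordPhi_append, signature_below h2,
      wordPhi_replicate_succ, wordEps_replicate_succ]
    omega

theorem exists_rowLower_val_iff (hpq : p.val + 1 = q.val) :
    (∃ M', rowLower q.val M = some M') ↔ 0 < wordPhi q.val (rowWord M) := by
  constructor
  · rintro ⟨M', h⟩
    exact (wordLower_of_rowLower_val hpq h).wordPhi_pos
  · intro h
    obtain ⟨u, t, hw, hu, ht⟩ := exists_split_of_wordPhi_pos h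
    have hpos := loweringPos_split hu ht
    rw [← hw] at hpos
    have hlen : u.length < (rowCells M).length := by
      have := congrArg List.length hw
      simp [rowWord] at this
      omega
    exact ⟨_, by rw [rowLower_val hpq, hpos, Option.bind_some, List.getElem?_eq_getElem hlen,
      Option.map_some]⟩

theorem exists_rowLower_to_val_iff (hpq : p.val + 1 = q.val) :
    (∃ M', rowLower q.val M' = some M) ↔ 0 < wordEps q.val (rowWord M) := by
  constructor
  · rintro ⟨M', h⟩
    exact (wordLower_of_rowLower_val hpq h).wordEps_pos
  · intro h
    obtain ⟨u, t, hw, hu, ht⟩ := exists_split_of_wordEps_pos h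
    have hpos := raisingPos_split hu ht
    rw [← hw] at hpos
    have hlen : u.length < (rowCells M).length := by
      have := congrArg List.length hw
      simp [rowWord] at this
      omega
    obtain ⟨M', hM'⟩ : ∃ M', rowRaise q.val M = some M' :=
      ⟨_, by rw [rowRaise_val hpq, hpos, Option.bind_some, List.getElem?_eq_getElem hlen,
        Option.map_some]⟩
    exact ⟨M', (rowRaise_eq_some_iff_rowLower hpq).1 hM'⟩

end

end RowOperators

/-! ### Height functions and commutation of row and column operators -/

section Commutation

variable {m n : ℕ} {p q : Fin m} {M M' : Matrix (Fin m) (Fin n) ℕ}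

/-- The surplus of closing over opening brackets in the bracket word of the rows `p`, `q`, after the
closing brackets of the column `c`. -/
def rowHeight (M : Matrix (Fin m) (Fin n) ℕ) (p q : Fin m) (c : Fin n) : ℤ :=
  ∑ k, (if k ≤ c then (M p k : ℤ) else 0) - ∑ k, (if k < c then (M q k : ℤ) else 0)

theorem sum_ite_le_of_split {l₁ l₂ : List (Fin n)} {c : Fin n}
    (h : List.finRange n = l₁ ++ c :: l₂) (f : Fin n → ℕ) :
    (∑ k, (if k ≤ c then (f k : ℤ) else 0) = (l₁.map f).sum + f c) ∧
      (∑ k, (if k < c then (f k : ℤ) else 0) = (l₁.map f).sum) ∧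
      ∑ k, (f k : ℤ) = (l₁.map f).sum + f c + (l₂.map f).sum := by
  obtain ⟨h1, h2⟩ := finRange_split h
  have e : ∀ (l : List (Fin n)) (g g' : Fin n → ℤ), (∀ x ∈ l, g x = g' x) →
      (l.map g).sum = (l.map g').sum := fun l g g' h => by rw [List.map_congr_left h]
  have z : ∀ l : List (Fin n), (l.map fun _ => (0 : ℤ)).sum = 0 := fun l => by simp
  have cast : ∀ l : List (Fin n), (l.map fun k => (f k : ℤ)).sum = ((l.map f).sum : ℕ) := by
    intro l
    induction l with
    | nil => rfl
    | cons x l ih => simp [ih]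
  simp only [Fin.sum_univ_def, h, List.map_append, List.map_cons, List.sum_append, List.sum_cons]
  refine ⟨?_, ?_, ?_⟩
  · rw [e l₁ _ (fun k => (f k : ℤ)) (fun x hx => if_pos ((h1 x).1 hx).le),
      e l₂ _ (fun _ => 0) (fun x hx => if_neg ((h2 x).1 hx).not_ge), z, cast]
    simp
  · rw [e l₁ _ (fun k => (f k : ℤ)) (fun x hx => if_pos ((h1 x).1 hx)),
      e l₂ _ (fun _ => 0) (fun x hx => if_neg ((h2 x).1 hx).asymm), z, cast]
    simp
  · rw [cast, cast]
    ring

theorem rowHeight_of_split {l₁ l₂ : List (Fin n)} {c : Fin n}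
    (h : List.finRange n = l₁ ++ c :: l₂) :
    rowHeight M p q c = (l₁.map (M p)).sum + M p c - (l₁.map (M q)).sum := by
  rw [rowHeight, (sum_ite_le_of_split h _).1, (sum_ite_le_of_split h _).2.1]

/-- The number of unmatched closings is the largest surplus of closings over openings in a prefix,
or zero; it suffices to test after the closings of each column. Comparing with a bound `K` avoids a
maximum over a possibly empty list. -/
theorem wordPhi_columns_le_iff (hpq : p.val + 1 = q.val) {l : List (Fin n)} {K : ℕ} :
    wordPhi q.val (l.flatMap (columnLetters M)) ≤ K ↔ ∀ s c t, l = s ++ c :: t →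
      (s.map (M p)).sum + M p c ≤ (s.map (M q)).sum + K := by
  induction l generalizing K with
  | nil => simp
  | cons x l ih =>
    have h1 : wordPhi q.val ((x :: l).flatMap (columnLetters M)) ≤ K ↔ M p x ≤ K ∧
        wordPhi q.val (l.flatMap (columnLetters M)) ≤ M q x + K - M p x := by
      rw [List.flatMap_cons, wordPhi_append, (signature_columnLetters hpq M x).1,
        (signature_columnLetters hpq M x).2]
      omega
    rw [h1, ih]
    constructor
    · rintro ⟨h2, h3⟩ s c t hs
      rcases List.cons_eq_append_iff.1 hs with ⟨rfl, hs⟩ | ⟨s, rfl, rfl⟩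
      · obtain ⟨rfl, rfl⟩ := List.cons.inj hs
        simpa using h2
      · have := h3 s c t rfl
        simp only [List.map_cons, List.sum_cons]
        omega
    · intro h
      have h2 := h [] x l rfl
      simp only [List.map_nil, List.sum_nil, Nat.zero_add] at h2
      refine ⟨h2, fun s c t hs => ?_⟩
      have := h (x :: s) c t (by rw [hs]; rfl)
      simp only [List.map_cons, List.sum_cons] at this
      omega

theorem wordEps_columns_le_iff (hpq : p.val + 1 = q.val) {l : List (Fin n)} {K : ℕ} :
    wordEps q.val (l.flatMap (columnLetters M)) ≤ K ↔ ∀ s c t, l = s ++ c :: t →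
      M q c + (t.map (M q)).sum ≤ (t.map (M p)).sum + K := by
  induction l using List.reverseRecOn generalizing K with
  | nil => simp
  | append_singleton l x ih =>
    have h1 : wordEps q.val ((l ++ [x]).flatMap (columnLetters M)) ≤ K ↔ M q x ≤ K ∧
        wordEps q.val (l.flatMap (columnLetters M)) ≤ M p x + K - M q x := by
      rw [List.flatMap_append, List.flatMap_singleton, wordEps_append,
        (signature_columnLetters hpq M x).1, (signature_columnLetters hpq M x).2]
      omega
    rw [h1, ih]
    constructor
    · rintro ⟨h2, h3⟩ s c t hs
      rcases List.eq_nil_or_concat t with rfl | ⟨t, y, rfl⟩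
      · obtain ⟨rfl, h4⟩ := List.append_inj' hs rfl
        obtain rfl : x = c := by simpa using h4
        simpa using h2
      · obtain ⟨rfl, h4⟩ := List.append_inj' (t₁ := [x]) (s₂ := s ++ c :: t) (t₂ := [y])
          (by simpa using hs) rfl
        obtain rfl : x = y := by simpa using h4
        have := h3 s c t rfl
        simp only [List.map_append, List.sum_append, List.map_cons, List.map_nil, List.sum_cons,
          List.sum_nil, List.concat_eq_append]
        omega
    · intro h
      have h2 := h l x [] rfl
      simp only [List.map_nil, List.sum_nil, Nat.zero_add, Nat.add_zero] at h2
      refine ⟨h2, fun s c t hs => ?_⟩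
      have := h s c (t ++ [x]) (by rw [hs]; simp)
      simp only [List.map_append, List.sum_append, List.map_cons, List.map_nil, List.sum_cons,
          List.sum_nil] at this
      omega

theorem wordPhi_rowWord_eq_zero_iff (hpq : p.val + 1 = q.val) :
    wordPhi q.val (rowWord M) = 0 ↔ ∀ c, rowHeight M p q c ≤ 0 := by
  rw [← Nat.le_zero, rowWord_eq_flatMap, wordPhi_columns_le_iff hpq]
  constructor
  · intro h c
    obtain ⟨s, t, hs⟩ := exists_finRange_split c
    have := h s c t hs
    rw [rowHeight_of_split hs]
    omega
  · intro h s c t hs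
    have := h c
    rw [rowHeight_of_split hs] at this
    omega

/-- The surplus of openings in a suffix that begins with the openings of column `c` is the height at
`c` minus the total surplus. -/
theorem wordEps_rowWord_eq_zero_iff (hpq : p.val + 1 = q.val) :
    wordEps q.val (rowWord M) = 0 ↔
      ∀ c, rowHeight M p q c ≤ ∑ k, (M p k : ℤ) - ∑ k, (M q k : ℤ) := by
  rw [← Nat.le_zero, rowWord_eq_flatMap, wordEps_columns_le_iff hpq]
  constructor
  · intro h c
    obtain ⟨s, t, hs⟩ := exists_finRange_split c
    have := h s c t hs
    rw [rowHeight_of_split hs, (sum_ite_le_of_split hs _).2.2, (sum_ite_le_of_split hs _).2.2]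
    omega
  · intro h s c t hs
    have := h c
    rw [rowHeight_of_split hs, (sum_ite_le_of_split hs _).2.2, (sum_ite_le_of_split hs _).2.2]
      at this
    omega

/-- The lowering operator moves a unit in the first column where the height is maximal. -/
theorem rowLower_eq_some_iff_rowHeight (hpq : p.val + 1 = q.val) :
    rowLower q.val M = some M' ↔ ∃ a, M' = moveUnit M p q a ∧ 0 < M p a ∧
      (∀ c < a, rowHeight M p q c < rowHeight M p q a) ∧
      ∀ c > a, rowHeight M p q c ≤ rowHeight M p q a := by
  have key : ∀ {a l₁ l₂}, List.finRange n = l₁ ++ a :: l₂ →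
      ((wordEps q.val (l₁.flatMap (columnLetters M)) < M p a ↔ 0 < M p a ∧
        ∀ c < a, rowHeight M p q c < rowHeight M p q a) ∧
      (wordPhi q.val (l₂.flatMap (columnLetters M)) ≤ M q a ↔
        ∀ c > a, rowHeight M p q c ≤ rowHeight M p q a)) := by
    intro a l₁ l₂ h
    have ha := rowHeight_of_split (M := M) (p := p) (q := q) h
    constructor
    · rw [show wordEps q.val (l₁.flatMap (columnLetters M)) < M p a ↔ 0 < M p a ∧
        wordEps q.val (l₁.flatMap (columnLetters M)) ≤ M p a - 1 by omega,
        wordEps_columns_le_iff hpq]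
      refine and_congr_right fun hpos => ⟨fun h1 c hc => ?_, fun h1 s c t hs => ?_⟩
      · obtain ⟨s, t, rfl⟩ := List.append_of_mem (((finRange_split h).1 c).2 hc)
        have h2 := h1 s c t rfl
        rw [rowHeight_of_split (l₁ := s) (l₂ := t ++ a :: l₂) (by simp [h]), ha]
        simp only [List.map_append, List.sum_append, List.map_cons, List.sum_cons]
        omega
      · subst hs
        have h2 := h1 c (((finRange_split h).1 c).1 (by simp))
        rw [rowHeight_of_split (l₁ := s) (l₂ := t ++ a :: l₂) (by simp [h]), ha] at h2
        simp only [List.map_append, List.sum_append, List.map_cons, List.sum_cons] at h2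
        omega
    · rw [wordPhi_columns_le_iff hpq]
      refine ⟨fun h1 c hc => ?_, fun h1 s c t hs => ?_⟩
      · obtain ⟨s, t, rfl⟩ := List.append_of_mem (((finRange_split h).2 c).2 hc)
        have h2 := h1 s c t rfl
        rw [rowHeight_of_split (l₁ := l₁ ++ a :: s) (l₂ := t) (by simp [h]), ha]
        simp only [List.map_append, List.sum_append, List.map_cons, List.sum_cons]
        omega
      · subst hs
        have h2 := h1 c (((finRange_split h).2 c).1 (by simp))
        rw [rowHeight_of_split (l₁ := l₁ ++ a :: s) (l₂ := t) (by simp [h]), ha] at h2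
        simp only [List.map_append, List.sum_append, List.map_cons, List.sum_cons] at h2
        omega
  rw [rowLower_eq_some_iff hpq]
  constructor
  · rintro ⟨a, l₁, l₂, h, rfl, h1, h2⟩
    obtain ⟨h3, h4⟩ := (key h).1.1 h1
    exact ⟨a, rfl, h3, h4, (key h).2.1 h2⟩
  · rintro ⟨a, rfl, h1, h2, h3⟩
    obtain ⟨l₁, l₂, h⟩ := exists_finRange_split a
    exact ⟨a, l₁, l₂, h, rfl, (key h).1.2 ⟨h1, h2⟩, (key h).2.2 h3⟩

/-- Used for `M` and for its transpose, this gives the increments `M p j' - M q j` and `M q j - M p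
j'`. That they are opposite is the source of the commutation. -/
theorem rowHeight_succ {j j' : Fin n} (hj : j.val + 1 = j'.val) :
    rowHeight M p q j' = rowHeight M p q j + M p j' - M q j := by
  obtain ⟨l₁, l₂, h⟩ := exists_finRange_split j
  obtain ⟨l₃, rfl⟩ := exists_finRange_split_succ hj h
  rw [rowHeight_of_split h, rowHeight_of_split (l₁ := l₁ ++ [j]) (l₂ := l₃) (by simp [h])]
  simp
  ring

/-! ### Heights after a step in the other direction -/

theorem transpose_moveUnit_apply {j j' : Fin n} (hjj : j ≠ j') {b : Fin m} (hb : 0 < M b j)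
    (x : Fin m) (y : Fin n) : ((moveUnit M.transpose j j' b).transpose x y : ℤ) =
      M x y - (if x = b ∧ y = j then 1 else 0) + (if x = b ∧ y = j' then 1 else 0) := by
  by_cases hx : x = b
  · subst hx
    by_cases hy : y = j
    · subst hy
      simp [moveUnit_apply, hjj]
      omega
    · by_cases hy' : y = j'
      · subst hy'
        simp [moveUnit_apply, hy]
      · simp [moveUnit_apply, hy, hy']
  · simp [moveUnit_apply, hx]

theorem sum_ite_transpose_moveUnit {j j' : Fin n} (hjj : j ≠ j') {b : Fin m} (hb : 0 < M b j)
    (P : Fin n → Prop) [DecidablePred P] (x : Fin m) :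
    ∑ k, (if P k then ((moveUnit M.transpose j j' b).transpose x k : ℤ) else 0) =
      ∑ k, (if P k then (M x k : ℤ) else 0) - (if x = b ∧ P j then 1 else 0) +
        (if x = b ∧ P j' then 1 else 0) := by
  have h1 : ∀ y : Fin n, ∑ k, (if k = y then (if x = b ∧ P y then (1 : ℤ) else 0) else 0) =
      if x = b ∧ P y then 1 else 0 := fun y => by simp
  rw [← h1 j, ← h1 j', ← Finset.sum_sub_distrib, ← Finset.sum_add_distrib]
  refine Finset.sum_congr rfl fun k _ => ?_
  rw [transpose_moveUnit_apply hjj hb]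
  by_cases hk : k = j
  · subst hk
    by_cases hP : P k <;> simp [hP, hjj]
  · by_cases hk' : k = j'
    · subst hk'
      by_cases hP : P k <;> simp [hP, hk]
    · by_cases hP : P k <;> simp [hP, hk, hk']

theorem sum_transpose_moveUnit {j j' : Fin n} (hjj : j ≠ j') {b : Fin m}
    (hb : 0 < M b j) (x : Fin m) :
    ∑ k, ((moveUnit M.transpose j j' b).transpose x k : ℤ) = ∑ k, (M x k : ℤ) := by
  simpa using sum_ite_transpose_moveUnit hjj hb (fun _ => True) x

/-- The height function after a unit has moved from the column `j` to the next one. -/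
theorem rowHeight_transpose_moveUnit (hpq : p ≠ q) {j j' : Fin n} (hj : j.val + 1 = j'.val)
    {b : Fin m} (hb : 0 < M b j) (c : Fin n) :
    rowHeight (moveUnit M.transpose j j' b).transpose p q c = rowHeight M p q c -
      (if b = p ∧ c = j then 1 else 0) + (if b = q ∧ c = j' then 1 else 0) := by
  have hjj : j ≠ j' := by rintro rfl; omega
  have hle : j' ≤ c ↔ j < c := by rw [Fin.le_def, Fin.lt_def]; omega
  have hle' : j ≤ c ↔ j < c ∨ c = j := by rw [Fin.le_def, Fin.lt_def, Fin.ext_iff]; omega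
  have hlt : j < c ↔ j' < c ∨ c = j' := by rw [Fin.lt_def, Fin.lt_def, Fin.ext_iff]; omega
  have hcj : c = j → ¬ j < c := by rintro rfl; exact lt_irrefl _
  have hcj' : c = j' → ¬ j' < c := by rintro rfl; exact lt_irrefl _
  rw [rowHeight, rowHeight, sum_ite_transpose_moveUnit hjj hb (fun k => k ≤ c),
    sum_ite_transpose_moveUnit hjj hb (fun k => k < c)]
  simp only [hle, hle']
  by_cases h1 : b = p
  · have h2 : q ≠ b := by rintro rfl; exact hpq h1.symm
    by_cases h3 : c = j
    · simp [h1, h3, h1 ▸ h2, h1 ▸ h2.symm]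
      ring
    · simp [h1, h3, h1 ▸ h2, h1 ▸ h2.symm]
  · by_cases h2 : b = q
    · by_cases h3 : c = j'
      · have h4 : j < c := hlt.2 (.inr h3)
        have h5 : ¬ j' < c := hcj' h3
        subst h3
        simp [h2, Ne.symm hpq, h4]
        ring
      · have h4 : j < c ↔ j' < c := by rw [hlt]; simp [h3]
        simp [h2, Ne.symm hpq, hpq, h3, h4]
    · simp [h1, h2, Ne.symm h1, Ne.symm h2]

/-- A lowering operator in one direction does not increase the maximal height in the other. -/
theorem rowHeight_le_of_rowLower (hpq : p.val + 1 = q.val) {j j' : Fin n}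
    (hj : j.val + 1 = j'.val) (h : rowLower q.val M = some M') {K : ℤ}
    (hK : ∀ r, rowHeight M.transpose j j' r ≤ K) (r : Fin m) :
    rowHeight M'.transpose j j' r ≤ K := by
  have hjj : j ≠ j' := by rintro rfl; omega
  obtain ⟨a, rfl, hpos, h1, -⟩ := (rowLower_eq_some_iff_rowHeight hpq).1 h
  have h2 := rowHeight_transpose_moveUnit (M := M.transpose) hjj hpq (b := a) hpos r
  rw [Matrix.transpose_transpose] at h2
  rw [h2]
  have h3 := hK r
  split_ifs with h4 h5 h5
  · omega
  · omega
  -- The height grows only at row `q`, when the unit moves in column `j'`. That column is the first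
  -- maximum of the row height, which increases strictly from `j` to `j'`; the opposite increment
  -- leaves room for `+1` at `q` below the value at `p`.
  · obtain ⟨rfl, rfl⟩ := h5
    have h6 := h1 j (Fin.lt_def.2 (by omega))
    rw [rowHeight_succ hj] at h6
    have h7 := rowHeight_succ (M := M.transpose) (p := j) (q := a) hpq
    have h8 := hK p
    simp only [Matrix.transpose_apply] at h7
    omega
  · omega

/-- A column step lowers the row height at `j` if it acts in row `p`, and raises it at `j'` if it
acts in row `q`; in the latter case the opposite increments keep `j'` from overtaking `j`. So the
first maximum moves only if both operators claim the cell `(p, j)`. Then both heights are tied, and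
each operator acts one place further after the other. -/
theorem rowLower_comm_val (hpq : p.val + 1 = q.val) {j j' : Fin n} (hj : j.val + 1 = j'.val)
    {M₁ M₂ : Matrix (Fin m) (Fin n) ℕ} (h₁ : rowLower q.val M = some M₁)
    (h₂ : rowLower j'.val M.transpose = some M₂.transpose) :
    ∃ M₃, rowLower j'.val M₁.transpose = some (Matrix.transpose M₃) ∧
      rowLower q.val M₂ = some M₃ := by
  have hjj : j ≠ j' := by rintro rfl; omega
  have hpq' : p ≠ q := by rintro rfl; omega
  obtain ⟨a, rfl, ha, ha1, ha2⟩ := (rowLower_eq_some_iff_rowHeight hpq).1 h₁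
  obtain ⟨b, hM₂, hb, hb1, hb2⟩ := (rowLower_eq_some_iff_rowHeight hj).1 h₂
  obtain rfl : M₂ = (moveUnit M.transpose j j' b).transpose := by
    rw [← hM₂, Matrix.transpose_transpose]
  have hF := rowHeight_transpose_moveUnit (M := M) hpq' hj (b := b) hb
  have hG := rowHeight_transpose_moveUnit (M := M.transpose) hjj hpq (b := a) ha
  rw [Matrix.transpose_transpose] at hG
  have hF' := rowHeight_succ (M := M) (p := p) (q := q) hj
  have hG' := rowHeight_succ (M := M.transpose) (p := j) (q := j') hpq
  simp only [Matrix.transpose_apply] at hG' hb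
  have hlj : j < j' := Fin.lt_def.2 (by omega)
  have hlp : p < q := Fin.lt_def.2 (by omega)
  have hlj' : ∀ c, c < j' ↔ c < j ∨ c = j := fun c => by rw [Fin.lt_def, Fin.lt_def, Fin.ext_iff]; omega
  have hlp' : ∀ c, c < q ↔ c < p ∨ c = p := fun c => by rw [Fin.lt_def, Fin.lt_def, Fin.ext_iff]; omega
  -- `a'` and `b'` are the column and row in which each operator acts after the other; they differ
  -- from `a` and `b` only when the cell is shared.
  obtain ⟨a', b', hab⟩ : ∃ a' b', (a = j ∧ b = p ∧ a' = j' ∧ b' = q) ∨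
      (¬ (a = j ∧ b = p) ∧ a' = a ∧ b' = b) := by
    by_cases hc : a = j ∧ b = p
    · exact ⟨j', q, .inl ⟨hc.1, hc.2, rfl, rfl⟩⟩
    · exact ⟨a, b, .inr ⟨hc, rfl, rfl⟩⟩
  refine ⟨(moveUnit (moveUnit M p q a).transpose j j' b').transpose,
    (rowLower_eq_some_iff_rowHeight hj).2 ⟨b', by rw [Matrix.transpose_transpose], ?_, ?_, ?_⟩,
    (rowLower_eq_some_iff_rowHeight hpq).2 ⟨a', ?_, ?_, ?_, ?_⟩⟩
  · clear hF hG ha1 ha2 hb1 hb2 h₁ h₂ hF' hG' hM₂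
    simp only [Matrix.transpose_apply, moveUnit_apply]
    grind
  · intro c hc
    rw [hG, hG]
    clear hF hG h₁ h₂ hM₂
    generalize rowHeight M.transpose j j' = G at *
    generalize rowHeight M p q = F at *
    grind
  · intro c hc
    rw [hG, hG]
    clear hF hG h₁ h₂ hM₂
    generalize rowHeight M.transpose j j' = G at *
    generalize rowHeight M p q = F at *
    grind
  · clear hF hG ha1 ha2 hb1 hb2 h₁ h₂ hF' hG' hM₂
    funext x y
    simp only [Matrix.transpose_apply, moveUnit_apply]
    grind
  · clear hF hG ha1 ha2 hb1 hb2 h₁ h₂ hF' hG' hM₂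
    simp only [Matrix.transpose_apply, moveUnit_apply]
    grind
  · intro c hc
    rw [hF, hF]
    clear hF hG h₁ h₂ hM₂
    generalize rowHeight M.transpose j j' = G at *
    generalize rowHeight M p q = F at *
    grind
  · intro c hc
    rw [hF, hF]
    clear hF hG h₁ h₂ hM₂
    generalize rowHeight M.transpose j j' = G at *
    generalize rowHeight M p q = F at *
    grind

end Commutation

/-! ### Row operators with arbitrary index -/

section Operators

variable {m n : ℕ} {M M' M₁ M₂ N N₁ : Matrix (Fin m) (Fin n) ℕ} {i j : ℕ}

theorem exists_rows_of_index (h : 1 ≤ i ∧ i < m) :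
    ∃ p q : Fin m, p.val + 1 = q.val ∧ q.val = i :=
  ⟨⟨i - 1, by omega⟩, ⟨i, h.2⟩, by simp; omega, rfl⟩

theorem index_of_rowLower (h : rowLower i M = some M') : 1 ≤ i ∧ i < m := by
  by_contra hi
  rw [rowLower, dif_neg hi] at h
  cases h

theorem index_of_rowRaise (h : rowRaise i M = some M') : 1 ≤ i ∧ i < m := by
  by_contra hi
  rw [rowRaise, dif_neg hi] at h
  cases h

theorem rowRaise_iff : rowRaise i M = some M' ↔ rowLower i M' = some M := by
  constructor
  · intro h
    obtain ⟨p, q, hpq, rfl⟩ := exists_rows_of_index (index_of_rowRaise h)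
    exact (rowRaise_eq_some_iff_rowLower hpq).1 h
  · intro h
    obtain ⟨p, q, hpq, rfl⟩ := exists_rows_of_index (index_of_rowLower h)
    exact (rowRaise_eq_some_iff_rowLower hpq).2 h

theorem rowLower_left_unique (h₁ : rowLower i M₁ = some M) (h₂ : rowLower i M₂ = some M) :
    M₁ = M₂ := by
  rw [← rowRaise_iff] at h₁ h₂
  simpa [h₁] using h₂

theorem wordLower_of_rowLower (h : rowLower i M = some M') :
    WordLower i (rowWord M) (rowWord M') := by
  obtain ⟨p, q, hpq, rfl⟩ := exists_rows_of_index (index_of_rowLower h)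
  exact wordLower_of_rowLower_val hpq h

theorem exists_rowLower_iff (hi : 1 ≤ i ∧ i < m) :
    (∃ M', rowLower i M = some M') ↔ 0 < wordPhi i (rowWord M) := by
  obtain ⟨p, q, hpq, rfl⟩ := exists_rows_of_index hi
  exact exists_rowLower_val_iff hpq

theorem exists_rowLower_to_iff (hi : 1 ≤ i ∧ i < m) :
    (∃ M', rowLower i M' = some M) ↔ 0 < wordEps i (rowWord M) := by
  obtain ⟨p, q, hpq, rfl⟩ := exists_rows_of_index hi
  exact exists_rowLower_to_val_iff hpq

theorem colLower_iff : colLower j M = some M' ↔ rowLower j M.transpose = some M'.transpose := by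
  rw [colLower, Option.map_eq_some_iff]
  constructor
  · rintro ⟨N, h, rfl⟩
    exact h
  · intro h
    exact ⟨_, h, M'.transpose_transpose⟩

theorem colRaise_iff : colRaise j M = some M' ↔ colLower j M' = some M := by
  rw [colLower_iff, ← rowRaise_iff, colRaise, Option.map_eq_some_iff]
  constructor
  · rintro ⟨N, h, rfl⟩
    exact h
  · intro h
    exact ⟨_, h, M'.transpose_transpose⟩

theorem sum_row_of_colLower (h : colLower j M = some M') (r : Fin m) :
    ∑ k, (M' r k : ℤ) = ∑ k, (M r k : ℤ) := by
  rw [colLower_iff] at h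
  obtain ⟨p, q, hpq, rfl⟩ := exists_rows_of_index (index_of_rowLower h)
  obtain ⟨b, hb, hpos, -⟩ := (rowLower_eq_some_iff_rowHeight hpq).1 h
  have hpq' : p ≠ q := by rintro rfl; omega
  obtain rfl : M' = (moveUnit M.transpose p q b).transpose := by rw [← hb, M'.transpose_transpose]
  exact sum_transpose_moveUnit hpq' hpos r

theorem rowLower_colLower_comm (h₁ : rowLower i M = some M₁) (h₂ : colLower j M = some M₂) :
    ∃ M₃, colLower j M₁ = some M₃ ∧ rowLower i M₂ = some M₃ := by
  rw [colLower_iff] at h₂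
  obtain ⟨p, q, hpq, rfl⟩ := exists_rows_of_index (index_of_rowLower h₁)
  obtain ⟨p', q', hpq', rfl⟩ := exists_rows_of_index (index_of_rowLower h₂)
  obtain ⟨M₃, h3, h4⟩ := rowLower_comm_val hpq hpq' h₁ h₂
  exact ⟨M₃, colLower_iff.2 h3, h4⟩

/-- If the column operator vanished on `M`, all its heights would be nonpositive; a row step does
not increase their maximum, so it would vanish on `M₁` as well. The square is then completed by
commutation. -/
theorem exists_colLower_of_rowLower (h₁ : rowLower i M = some M₁) (h₂ : colLower j M₁ = some M₂) :
    ∃ N, colLower j M = some N ∧ rowLower i N = some M₂ := by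
  have h₃ := h₂
  rw [colLower_iff] at h₃
  have hj := index_of_rowLower h₃
  obtain ⟨N, hN⟩ : ∃ N, rowLower j M.transpose = some N := by
    rw [exists_rowLower_iff hj]
    by_contra h0
    obtain ⟨p, q, hpq, rfl⟩ := exists_rows_of_index (index_of_rowLower h₁)
    obtain ⟨p', q', hpq', rfl⟩ := exists_rows_of_index hj
    have h4 := (wordPhi_rowWord_eq_zero_iff hpq').1 (Nat.eq_zero_of_not_pos h0)
    have h5 := (wordPhi_rowWord_eq_zero_iff hpq').2 (rowHeight_le_of_rowLower hpq hpq' h₁ h4)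
    have h6 := (wordLower_of_rowLower h₃).wordPhi_pos
    omega
  have hN' : colLower j M = some N.transpose := colLower_iff.2 hN
  obtain ⟨M₃, h4, h5⟩ := rowLower_colLower_comm h₁ hN'
  rw [h₂, Option.some_inj] at h4
  exact ⟨_, hN', h4 ▸ h5⟩

theorem exists_rowLower_of_colLower (h₁ : colLower j M = some M₁) (h₂ : rowLower i M₁ = some M₂) :
    ∃ N, rowLower i M = some N ∧ colLower j N = some M₂ := by
  have h1 : rowLower j M.transpose = some M₁.transpose := colLower_iff.1 h₁
  have h2 : colLower i M₁.transpose = some M₂.transpose := colLower_iff.2 h₂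
  obtain ⟨N, h3, h4⟩ := exists_colLower_of_rowLower h1 h2
  exact ⟨N.transpose, colLower_iff.1 h3, colLower_iff.2 h4⟩

/-- Being unraisable means that the heights do not exceed the total surplus. A column step keeps row
sums and does not increase the maximal height, so it would pass this property from `M₂` to `M`,
contrary to `h₁`. -/
theorem exists_common_source (h₁ : rowLower i M₁ = some M) (h₂ : colLower j M₂ = some M) :
    ∃ N, colLower j N = some M₁ ∧ rowLower i N = some M₂ := by
  have hi := index_of_rowLower h₁
  obtain ⟨N, hN⟩ : ∃ N, rowLower i N = some M₂ := by
    rw [exists_rowLower_to_iff hi]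
    by_contra h0
    obtain ⟨p, q, hpq, rfl⟩ := exists_rows_of_index hi
    have h₃ := colLower_iff.1 h₂
    obtain ⟨p', q', hpq', rfl⟩ := exists_rows_of_index (index_of_rowLower h₃)
    have h4 := (wordEps_rowWord_eq_zero_iff hpq).1 (Nat.eq_zero_of_not_pos h0)
    rw [← sum_row_of_colLower h₂, ← sum_row_of_colLower h₂] at h4
    have h5 : wordEps q.val (rowWord M) = 0 := (wordEps_rowWord_eq_zero_iff hpq).2 (rowHeight_le_of_rowLower hpq' hpq h₃ h4)
    have h6 := (wordLower_of_rowLower h₁).wordEps_pos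
    omega
  obtain ⟨M', h3, h4⟩ := exists_colLower_of_rowLower hN h₂
  obtain rfl := rowLower_left_unique h₁ h4
  exact ⟨N, h3, hN⟩

/-! ### Contents and Knuth classes of row words -/

theorem count_columnLetters (M : Matrix (Fin m) (Fin n) ℕ) (r : Fin m) (c : Fin n) :
    (columnLetters M c).count (r.val + 1) = M r c := by
  obtain ⟨l₁, l₂, h⟩ := exists_finRange_split r
  have h1 : ∀ l : List (Fin m), (∀ x ∈ l, x ≠ r) →
      (l.flatMap fun x => List.replicate (M x c) (x.val + 1)).count (r.val + 1) = 0 := by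
    intro l hl
    rw [List.count_eq_zero]
    intro hmem
    obtain ⟨x, hx, h2⟩ := List.mem_flatMap.1 hmem
    have h3 := (List.mem_replicate.1 h2).2
    exact hl x hx (Fin.ext (by omega))
  rw [columnLetters_eq, h, List.flatMap_append, List.flatMap_cons, List.count_append,
    List.count_append, h1 l₁ fun x hx => (((finRange_split h).1 x).1 hx).ne,
    h1 l₂ fun x hx => (((finRange_split h).2 x).1 hx).ne', List.count_replicate_self]
  simp

theorem count_rowWord (M : Matrix (Fin m) (Fin n) ℕ) (r : Fin m) :
    (rowWord M).count (r.val + 1) = ∑ c, M r c := by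
  rw [rowWord_eq_flatMap, List.count_flatMap, Fin.sum_univ_def]
  congr 1
  exact List.map_congr_left fun c _ => count_columnLetters M r c

theorem mem_rowWord {x : ℕ} (h : x ∈ rowWord M) : 1 ≤ x ∧ x ≤ m := by
  obtain ⟨c, -, rfl⟩ := List.mem_map.1 h
  have := c.1.isLt
  omega

theorem rowWord_perm_of_colLower (h : colLower j M = some M') :
    (rowWord M).Perm (rowWord M') := by
  rw [List.perm_iff_count]
  intro x
  by_cases hx : 1 ≤ x ∧ x ≤ m
  · obtain ⟨r, rfl⟩ : ∃ r : Fin m, r.val + 1 = x := ⟨⟨x - 1, by omega⟩, by simp; omega⟩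
    rw [count_rowWord, count_rowWord]
    exact_mod_cast (sum_row_of_colLower h r).symm
  · rw [List.count_eq_zero_of_not_mem fun h => hx (mem_rowWord h),
      List.count_eq_zero_of_not_mem fun h => hx (mem_rowWord h)]

theorem isHighestWord_rowWord (h : ∀ i N, rowLower i N ≠ some M) : IsHighestWord 1 (rowWord M) := by
  refine ⟨fun x hx => (mem_rowWord hx).1, fun i hi => ?_⟩
  by_cases him : i < m
  · by_contra h0
    obtain ⟨N, hN⟩ := (exists_rowLower_to_iff ⟨hi, him⟩).2 (Nat.pos_of_ne_zero h0)
    exact h i N hN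
  · exact wordEps_eq_zero_of_notMem fun hmem => by
      have := (mem_rowWord hmem).2
      omega

/-- Column operators preserve the Knuth class of the row word. -/
theorem knuthEquiv_rowWord_of_colLower (h : colLower j M = some M') :
    KnuthEquiv (rowWord M) (rowWord M') := by
  induction hs : (rowWord M).sum using Nat.strong_induction_on generalizing M M' with
  | _ s ih =>
    by_cases hM : ∃ i N, rowLower i N = some M
    · obtain ⟨i, N, hN⟩ := hM
      -- The column step is pulled back to a square with smaller letter sum; lowering both ends
      -- again preserves Knuth equivalence.
      obtain ⟨N', h1, h2⟩ := exists_colLower_of_rowLower hN h |>.imp fun N' h => h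
      have hw := wordLower_of_rowLower hN
      have := hw.sum_eq
      exact (ih _ (by omega) h1 rfl).of_wordLower hw (wordLower_of_rowLower h2)
    -- If `M` cannot be raised, neither can `M'`, and two highest-weight words of equal content are
    -- equivalent.
    · have hM' : ∀ i N, rowLower i N ≠ some M' := by
        intro i N hN
        obtain ⟨N', -, h2⟩ := exists_common_source hN h
        exact hM ⟨i, N', h2⟩
      refine (isHighestWord_rowWord fun i N hN => hM ⟨i, N, hN⟩).knuthEquiv_of_perm
        (isHighestWord_rowWord hM') (rowWord_perm_of_colLower h)

/-- A matrix is determined by its row word and its column sums. -/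
theorem eq_of_rowWord_eq (h : rowWord M = rowWord M') (hs : ∀ c, ∑ r, M r c = ∑ r, M' r c) :
    M = M' := by
  have hlen : ∀ (M : Matrix (Fin m) (Fin n) ℕ) c, (columnLetters M c).length = ∑ r, M r c := by
    intro M c
    rw [columnLetters_eq, List.length_flatMap, Fin.sum_univ_def]
    simp
  -- The column sums are the lengths into which the row word is to be cut.
  have key : ∀ l : List (Fin n), l.flatMap (columnLetters M) = l.flatMap (columnLetters M') →
      ∀ c ∈ l, columnLetters M c = columnLetters M' c := by
    intro l
    induction l with
    | nil => simp
    | cons x l ih =>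
      intro hl c hc
      rw [List.flatMap_cons, List.flatMap_cons] at hl
      obtain ⟨h1, h2⟩ := List.append_inj hl (by rw [hlen, hlen, hs])
      rcases List.mem_cons.1 hc with rfl | hc
      · exact h1
      · exact ih h2 c hc
  rw [rowWord_eq_flatMap, rowWord_eq_flatMap] at h
  funext r c
  rw [← count_columnLetters M, ← count_columnLetters M', key _ h c (List.mem_finRange c)]

end Operators

/-! ### Blocks of letters -/

namespace Cuts

variable {m : ℕ} (I : Cuts m)

theorem exists_block_of_pos {x : ℕ} (h1 : 1 ≤ x) (hm : x ≤ m) :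
    ∃ k, I.lo k ≤ x ∧ x ≤ I.hi k := by
  have key : ∀ k : Fin (I.r + 1), x ≤ I.cut k → ∃ k, I.lo k ≤ x ∧ x ≤ I.hi k := by
    intro k
    induction k using Fin.induction with
    | zero => intro h; rw [I.cut_zero] at h; omega
    | succ k ih =>
      intro h
      by_cases hk : x ≤ I.cut k.castSucc
      · exact ih hk
      · exact ⟨k, by rw [lo]; omega, h⟩
  exact key (Fin.last _) (by rwa [I.cut_last])

theorem hi_lt_lo {k k' : Fin I.r} (h : k < k') : I.hi k < I.lo k' := by
  have : I.cut k.succ ≤ I.cut k'.castSucc :=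
    I.strictMono.monotone (by rw [Fin.le_def]; simpa using h)
  rw [hi, lo]
  omega

theorem block_unique {k k' : Fin I.r} {x : ℕ} (h : I.lo k ≤ x ∧ x ≤ I.hi k)
    (h' : I.lo k' ≤ x ∧ x ≤ I.hi k') : k = k' := by
  rcases lt_trichotomy k k' with hk | hk | hk
  · have := I.hi_lt_lo hk
    omega
  · exact hk
  · have := I.hi_lt_lo hk
    omega

theorem exists_block {i : ℕ} (h : i ∉ I.toSet) (h1 : 1 ≤ i ∧ i < m) :
    ∃ k, I.lo k ≤ i ∧ i < I.hi k := by
  obtain ⟨k, hk1, hk2⟩ := I.exists_block_of_pos h1.1 h1.2.le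
  refine ⟨k, hk1, lt_of_le_of_ne hk2 ?_⟩
  rintro rfl
  exact h ⟨k.succ, rfl⟩

theorem hi_le (k : Fin I.r) : I.hi k ≤ m := by
  have := I.strictMono.monotone (Fin.le_last k.succ)
  rwa [I.cut_last] at this

theorem lo_pos (k : Fin I.r) : 1 ≤ I.lo k := Nat.le_add_left _ _

theorem index_of_block {k : Fin I.r} {i : ℕ} (h : I.lo k ≤ i ∧ i < I.hi k) : 1 ≤ i ∧ i < m := by
  have := I.lo_pos k
  have := I.hi_le k
  omega

theorem notMem_of_block {k : Fin I.r} {i : ℕ} (h : I.lo k ≤ i ∧ i < I.hi k) : i ∉ I.toSet := by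
  rintro ⟨l, rfl⟩
  rw [lo, hi, Nat.succ_le_iff, I.strictMono.lt_iff_lt, I.strictMono.lt_iff_lt, Fin.lt_def,
    Fin.lt_def] at h
  simp at h
  omega

theorem mem_filterWord {w : List ℕ} {k : Fin I.r} {x : ℕ} :
    x ∈ I.filterWord w k ↔ x ∈ w ∧ I.lo k ≤ x ∧ x ≤ I.hi k := by
  simp [filterWord]

variable {I} {k k' : Fin I.r} {i : ℕ} {w w' : List ℕ}

theorem wordLower_filterWord (hk : I.lo k ≤ i ∧ i < I.hi k) (h : WordLower i w w') :
    WordLower i (I.filterWord w k) (I.filterWord w' k) :=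
  h.filter (by simp; omega) (by simp; omega)

theorem filterWord_eq_of_wordLower (hk : I.lo k ≤ i ∧ i < I.hi k) (hne : k' ≠ k)
    (h : WordLower i w w') : I.filterWord w k' = I.filterWord w' k' := by
  apply h.filter_eq
  · simp only [decide_eq_false_iff_not]
    exact fun h' => hne (I.block_unique h' ⟨hk.1, hk.2.le⟩)
  · simp only [decide_eq_false_iff_not]
    exact fun h' => hne (I.block_unique h' ⟨hk.1.trans (Nat.le_succ i), hk.2⟩)

theorem signature_filterWord (hk : I.lo k ≤ i ∧ i < I.hi k) (w : List ℕ) :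
    wordPhi i (I.filterWord w k) = wordPhi i w ∧ wordEps i (I.filterWord w k) = wordEps i w :=
  word_signature_filter (by simp; omega) (by simp; omega) w

variable (I) in
/-- Letters in the same block. -/
def SameBlock (x y : ℕ) : Prop := ∀ k, (I.lo k ≤ x ∧ x ≤ I.hi k) ↔ (I.lo k ≤ y ∧ y ≤ I.hi k)

theorem sameBlock_succ (hk : I.lo k ≤ i ∧ i < I.hi k) : I.SameBlock i (i + 1) := by
  intro k'
  constructor
  · intro h
    rw [I.block_unique h ⟨hk.1, hk.2.le⟩]
    omega
  · intro h
    rw [I.block_unique h ⟨hk.1.trans (Nat.le_succ i), hk.2⟩]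
    omega

theorem forall₂_sameBlock (hk : I.lo k ≤ i ∧ i < I.hi k) (h : WordLower i w w') :
    List.Forall₂ I.SameBlock w w' := by
  obtain ⟨u, t, rfl, rfl, -, -⟩ := h
  have hr : ∀ l : List ℕ, List.Forall₂ I.SameBlock l l := fun l =>
    List.forall₂_same.2 fun _ _ _ => Iff.rfl
  exact List.rel_append (hr u) (.cons (sameBlock_succ hk) (hr t))

/-- A word is determined by its block pattern and its filtration. -/
theorem eq_of_filterWord_eq (h : List.Forall₂ I.SameBlock w w')
    (hw : ∀ x ∈ w, 1 ≤ x ∧ x ≤ m) (hf : ∀ k, I.filterWord w k = I.filterWord w' k) : w = w' := by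
  induction h with
  | nil => rfl
  | @cons x y w w' hxy h ih =>
    obtain ⟨k, hk⟩ := I.exists_block_of_pos (hw x (by simp)).1 (hw x (by simp)).2
    have hxe : x = y := by
      have := hf k
      rw [filterWord, filterWord, List.filter_cons_of_pos (by simpa using hk),
        List.filter_cons_of_pos (by simpa using (hxy k).1 hk)] at this
      exact (List.cons.inj this).1
    subst hxe
    rw [ih (fun z hz => hw z (by simp [hz])) fun k' => ?_]
    have := hf k'
    simp only [filterWord, List.filter_cons] at this
    split_ifs at this
    · exact (List.cons.inj this).2
    · exact this

end Cuts

/-! ### Connectedness under row and column operators -/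

section Connected

variable {m n : ℕ} {I : Cuts m} {J : Cuts n} {M M' N N' : Matrix (Fin m) (Fin n) ℕ} {i : ℕ}

/-- The tableaux of the filtration of the row word. -/
noncomputable def rowTableaux (I : Cuts m) (M : Matrix (Fin m) (Fin n) ℕ) (k : Fin I.r) : Tableau :=
  knuthTableau (I.filterWord (rowWord M) k)

theorem filterRSK_eq (I : Cuts m) (J : Cuts n) (M : Matrix (Fin m) (Fin n) ℕ) :
    filterRSK I J M = (rowTableaux I M, rowTableaux J M.transpose) := by
  rw [filterRSK, colWord_eq_rowWord_transpose]
  rfl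

/-- An edge `i^row` of the filtered matrix bicrystal. -/
def RowStep (I : Cuts m) (M M' : Matrix (Fin m) (Fin n) ℕ) : Prop :=
  ∃ i, i ∉ I.toSet ∧ rowLower i M = some M'

/-- An edge `j^col` of the filtered matrix bicrystal. -/
def ColStep (J : Cuts n) (M M' : Matrix (Fin m) (Fin n) ℕ) : Prop :=
  RowStep J M.transpose M'.transpose

theorem colStep_iff : ColStep J M M' ↔ ∃ j, j ∉ J.toSet ∧ colLower j M = some M' := by
  simp only [ColStep, RowStep, colLower_iff]

/-- Connectedness under row operators. -/
def RowConnected (I : Cuts m) : Matrix (Fin m) (Fin n) ℕ → Matrix (Fin m) (Fin n) ℕ → Prop :=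
  Relation.ReflTransGen fun M M' => RowStep I M M' ∨ RowStep I M' M

/-- Connectedness under column operators. -/
def ColConnected (J : Cuts n) : Matrix (Fin m) (Fin n) ℕ → Matrix (Fin m) (Fin n) ℕ → Prop :=
  Relation.ReflTransGen fun M M' => ColStep J M M' ∨ ColStep J M' M

theorem RowConnected.refl (M : Matrix (Fin m) (Fin n) ℕ) : RowConnected I M M :=
  Relation.ReflTransGen.refl

theorem RowConnected.trans (h : RowConnected I M M') (h' : RowConnected I M' N) :
    RowConnected I M N :=
  Relation.ReflTransGen.trans h h'

theorem RowConnected.symm (h : RowConnected I M M') : RowConnected I M' M := by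
  induction h with
  | refl => exact .refl _
  | tail _ h ih => exact .trans (.single h.symm) ih

theorem RowStep.connected (h : RowStep I M M') : RowConnected I M M' := .single (.inl h)

theorem ColConnected.transpose (h : ColConnected J M M') :
    RowConnected J M.transpose M'.transpose := by
  induction h with
  | refl => exact .refl _
  | tail _ h ih => exact .tail ih h

theorem RowConnected.transpose (h : RowConnected I M M') :
    ColConnected I M.transpose M'.transpose := by
  induction h with
  | refl => exact .refl
  | tail _ h ih => exact .tail ih h

theorem ColConnected.symm (h : ColConnected J M M') : ColConnected J M' M :=
  h.transpose.symm.transpose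

theorem RowStep.exists_block (h : RowStep I M M') : ∃ k i, (I.lo k ≤ i ∧ i < I.hi k) ∧
    rowLower i M = some M' := by
  obtain ⟨i, hi, h⟩ := h
  obtain ⟨k, hk⟩ := I.exists_block hi (index_of_rowLower h)
  exact ⟨k, i, hk, h⟩

theorem rowStep_of_block {k : Fin I.r} (hk : I.lo k ≤ i ∧ i < I.hi k)
    (h : rowLower i M = some M') : RowStep I M M' :=
  ⟨i, I.notMem_of_block hk, h⟩

/-- Column operators preserve the row tableaux. -/
theorem rowTableaux_eq_of_colLower {j : ℕ} (h : colLower j M = some M') :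
    rowTableaux I M = rowTableaux I M' :=
  funext fun k => knuthTableau_eq_iff.2
    ((knuthEquiv_rowWord_of_colLower h).filter (I.lo k) (I.hi k))

theorem ColConnected.rowTableaux_eq (h : ColConnected J M M') :
    rowTableaux I M = rowTableaux I M' := by
  induction h with
  | refl => rfl
  | tail _ h ih =>
    rcases h with h | h
    · obtain ⟨j, -, h⟩ := colStep_iff.1 h
      exact ih.trans (rowTableaux_eq_of_colLower h)
    · obtain ⟨j, -, h⟩ := colStep_iff.1 h
      exact ih.trans (rowTableaux_eq_of_colLower h).symm

theorem RowConnected.colTableaux_eq (h : RowConnected I M M') :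
    rowTableaux J M.transpose = rowTableaux J M'.transpose :=
  h.transpose.rowTableaux_eq

theorem RowStep.wordConnected (h : RowStep I M M') (k : Fin I.r) :
    WordConnected (fun _ => True) (I.filterWord (rowWord M) k) (I.filterWord (rowWord M') k) := by
  obtain ⟨k', i, hk', h⟩ := h.exists_block
  by_cases hk : k = k'
  · subst hk
    exact .rel _ _ ⟨i, trivial, Cuts.wordLower_filterWord hk' (wordLower_of_rowLower h)⟩
  · rw [Cuts.filterWord_eq_of_wordLower hk' hk (wordLower_of_rowLower h)]
    exact .refl _

theorem RowConnected.wordConnected (h : RowConnected I M M') (k : Fin I.r) :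
    WordConnected (fun _ => True) (I.filterWord (rowWord M) k) (I.filterWord (rowWord M') k) := by
  induction h with
  | refl => exact .refl _
  | tail _ h ih =>
    refine .trans _ _ _ ih ?_
    rcases h with h | h
    · exact h.wordConnected k
    · exact .symm _ _ (h.wordConnected k)

theorem RowConnected.forall₂_sameBlock (h : RowConnected I M M') :
    List.Forall₂ I.SameBlock (rowWord M) (rowWord M') := by
  have htrans : ∀ {u v w : List ℕ}, List.Forall₂ I.SameBlock u v → List.Forall₂ I.SameBlock v w →
      List.Forall₂ I.SameBlock u w := by
    intro u v w h
    induction h generalizing w with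
    | nil => exact id
    | cons hxy _ ih =>
      intro h
      cases h with
      | cons hyz h => exact .cons (fun k => (hxy k).trans (hyz k)) (ih h)
  induction h with
  | refl => exact List.forall₂_same.2 fun _ _ _ => Iff.rfl
  | tail _ h ih =>
    refine htrans ih ?_
    rcases h with h | h
    · obtain ⟨k, i, hk, h⟩ := h.exists_block
      exact Cuts.forall₂_sameBlock hk (wordLower_of_rowLower h)
    · obtain ⟨k, i, hk, h⟩ := h.exists_block
      refine List.Forall₂.flip ((Cuts.forall₂_sameBlock hk (wordLower_of_rowLower h)).imp ?_)
      exact fun x y hxy k => (hxy k).symm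

theorem RowConnected.sum_col_eq (h : RowConnected I M M') (c : Fin n) :
    ∑ r, M r c = ∑ r, M' r c := by
  have key : ∀ {M M' : Matrix (Fin m) (Fin n) ℕ}, RowStep I M M' → ∑ r, M r c = ∑ r, M' r c := by
    rintro M M' ⟨i, -, h⟩
    have h' : colLower i M.transpose = some M'.transpose := colLower_iff.2 h
    exact_mod_cast (sum_row_of_colLower h' c).symm
  induction h with
  | refl => rfl
  | tail _ h ih =>
    rcases h with h | h
    · exact ih.trans (key h)
    · exact ih.trans (key h).symm

/-- A matrix is determined by its row tableaux and its connected component under row operators. -/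
theorem RowConnected.eq_of_rowTableaux_eq (h : RowConnected I M M')
    (ht : rowTableaux I M = rowTableaux I M') : M = M' := by
  -- Row steps preserve column sums and the block pattern of the row word, so only the filtered
  -- subwords have to be compared; each pair is connected and Knuth equivalent, hence equal.
  refine eq_of_rowWord_eq ?_ h.sum_col_eq
  refine Cuts.eq_of_filterWord_eq h.forall₂_sameBlock (fun x hx => mem_rowWord hx) fun k => ?_
  exact (h.wordConnected k).eq_of_knuthEquiv (knuthTableau_eq_iff.1 (congrFun ht k))

theorem ColConnected.eq_of_rowTableaux_eq (h : ColConnected J M M')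
    (ht : rowTableaux J M.transpose = rowTableaux J M'.transpose) : M = M' :=
  Matrix.transpose_injective (h.transpose.eq_of_rowTableaux_eq ht)

/-- Row and column steps in any direction commute. -/
theorem exists_swap_step (h : ColStep J M N ∨ ColStep J N M) (h' : RowStep I N M' ∨ RowStep I M' N) :
    ∃ N', (RowStep I M N' ∨ RowStep I N' M) ∧ (ColStep J N' M' ∨ ColStep J M' N') := by
  simp only [colStep_iff] at h ⊢
  rcases h with ⟨j, hj, h⟩ | ⟨j, hj, h⟩ <;> rcases h' with ⟨i, hi, h'⟩ | ⟨i, hi, h'⟩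
  · obtain ⟨K, h1, h2⟩ := exists_rowLower_of_colLower h h'
    exact ⟨K, .inl ⟨i, hi, h1⟩, .inl ⟨j, hj, h2⟩⟩
  · obtain ⟨K, h1, h2⟩ := exists_common_source h' h
    exact ⟨K, .inr ⟨i, hi, h2⟩, .inl ⟨j, hj, h1⟩⟩
  · obtain ⟨K, h1, h2⟩ := rowLower_colLower_comm h' h
    exact ⟨K, .inl ⟨i, hi, h2⟩, .inr ⟨j, hj, h1⟩⟩
  · obtain ⟨K, h1, h2⟩ := exists_colLower_of_rowLower h' h
    exact ⟨K, .inr ⟨i, hi, h2⟩, .inr ⟨j, hj, h1⟩⟩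

/-- The rectangle spanned by the two paths is tiled by commuting unit squares, one strip at a time.
-/
theorem ColConnected.exists_swap (h : ColConnected J M N) (h' : RowConnected I N M') :
    ∃ N', RowConnected I M N' ∧ ColConnected J N' M' := by
  have strip : ∀ {M N M' : Matrix (Fin m) (Fin n) ℕ}, ColConnected J M N →
      (RowStep I N M' ∨ RowStep I M' N) →
      ∃ N', (RowStep I M N' ∨ RowStep I N' M) ∧ ColConnected J N' M' := by
    intro M N M' h
    induction h generalizing M' with
    | refl => exact fun h' => ⟨M', h', .refl⟩
    | tail _ h ih =>
      intro h'
      obtain ⟨K, h1, h2⟩ := exists_swap_step h h'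
      obtain ⟨L, h3, h4⟩ := ih h1
      exact ⟨L, h3, .tail h4 h2⟩
  induction h' with
  | refl => exact ⟨M, .refl _, h⟩
  | tail _ h' ih =>
    obtain ⟨K, h1, h2⟩ := ih
    obtain ⟨L, h3, h4⟩ := strip h2 h'
    exact ⟨L, .tail h1 h3, h4⟩

/-- Connectedness in the filtered matrix bicrystal. -/
def Biconnected (I : Cuts m) (J : Cuts n) (M M' : Matrix (Fin m) (Fin n) ℕ) : Prop :=
  ∃ N, RowConnected I M N ∧ ColConnected J N M'

theorem Biconnected.refl (M : Matrix (Fin m) (Fin n) ℕ) : Biconnected I J M M :=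
  ⟨M, .refl _, .refl⟩

theorem RowConnected.biconnected (h : RowConnected I M M') : Biconnected I J M M' := ⟨M', h, .refl⟩

theorem ColConnected.biconnected (h : ColConnected J M M') : Biconnected I J M M' := ⟨M, .refl _, h⟩

theorem Biconnected.trans (h : Biconnected I J M M') (h' : Biconnected I J M' N) :
    Biconnected I J M N := by
  obtain ⟨K, h1, h2⟩ := h
  obtain ⟨L, h3, h4⟩ := h'
  obtain ⟨K', h5, h6⟩ := h2.exists_swap h3
  exact ⟨K', h1.trans h5, Relation.ReflTransGen.trans h6 h4⟩

theorem Biconnected.symm (h : Biconnected I J M M') : Biconnected I J M' M := by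
  obtain ⟨K, h1, h2⟩ := h
  exact h2.symm.biconnected.trans h1.symm.biconnected

/-- A matrix is determined by its filtered RSK image and its connected component. -/
theorem Biconnected.eq_of_filterRSK_eq (h : Biconnected I J M M')
    (hr : filterRSK I J M = filterRSK I J M') : M = M' := by
  rw [filterRSK_eq, filterRSK_eq, Prod.mk.injEq] at hr
  obtain ⟨N, h1, h2⟩ := h
  -- Column steps keep the row tableaux, so the intermediate matrix has those of `M` and the row
  -- part of the path is closed; only the column part is left.
  obtain rfl := h1.eq_of_rowTableaux_eq (hr.1.trans h2.rowTableaux_eq.symm)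
  exact h2.eq_of_rowTableaux_eq hr.2

end Connected

/-! ### Tableaux of matrices along the operators -/

/-- The crystal lowering operator on tableaux of arbitrary shape, as a relation. -/
def TableauLower (i : ℕ) (T T' : Tableau) : Prop :=
  T.1 = T'.1 ∧ WordLower i T.2.word T'.2.word

theorem Tableau.eq_of_word_eq {T T' : Tableau} (h : T.1 = T'.1) (hw : T.2.word = T'.2.word) :
    T = T' := by
  obtain ⟨lam, T⟩ := T
  obtain ⟨mu, T'⟩ := T'
  obtain rfl : lam = mu := h
  exact congrArg _ (SemistandardYoungTableau.word_injective hw)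

theorem TableauLower.right_unique {i : ℕ} {T T₁ T₂ : Tableau} (h₁ : TableauLower i T T₁)
    (h₂ : TableauLower i T T₂) : T₁ = T₂ :=
  Tableau.eq_of_word_eq (h₁.1.symm.trans h₂.1) (h₁.2.right_unique h₂.2)

/-- The step is transported to the reading word, which remains a reading word of the same shape;
uniqueness identifies its tableau. -/
theorem WordLower.tableauLower {i : ℕ} {w w' : List ℕ} (h : WordLower i w w') :
    TableauLower i (knuthTableau w) (knuthTableau w') := by
  obtain ⟨v, hv, hk⟩ := (knuthEquiv_knuthTableau w).exists_wordLower h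
  obtain ⟨T', hT'⟩ := (knuthTableau w).2.exists_word_eq_of_wordLower hv
  have : knuthTableau w' = ⟨(knuthTableau w).1, T'⟩ :=
    knuthTableau_eq_of_knuthEquiv (by rwa [hT'])
  rw [this]
  exact ⟨rfl, by rwa [hT']⟩

section Tableaux

variable {m n : ℕ} {I : Cuts m} {M M' N : Matrix (Fin m) (Fin n) ℕ} {i : ℕ} {k k' : Fin I.r}

theorem tableauLower_of_rowLower (hk : I.lo k ≤ i ∧ i < I.hi k) (h : rowLower i M = some M') :
    TableauLower i (rowTableaux I M k) (rowTableaux I M' k) :=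
  (Cuts.wordLower_filterWord hk (wordLower_of_rowLower h)).tableauLower

theorem rowTableaux_eq_of_rowLower (hk : I.lo k ≤ i ∧ i < I.hi k) (hne : k' ≠ k)
    (h : rowLower i M = some M') : rowTableaux I M k' = rowTableaux I M' k' := by
  rw [rowTableaux, rowTableaux, Cuts.filterWord_eq_of_wordLower hk hne (wordLower_of_rowLower h)]

theorem rowTableaux_knuthEquiv (I : Cuts m) (M : Matrix (Fin m) (Fin n) ℕ) (k : Fin I.r) :
    KnuthEquiv (I.filterWord (rowWord M) k) (rowTableaux I M k).2.word :=
  knuthEquiv_knuthTableau _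

theorem mem_word_rowTableaux {x : ℕ} (h : x ∈ (rowTableaux I M k).2.word) :
    I.lo k ≤ x ∧ x ≤ I.hi k :=
  (I.mem_filterWord.1 ((rowTableaux_knuthEquiv I M k).perm.mem_iff.2 h)).2

theorem rowTableaux_bound (I : Cuts m) (M : Matrix (Fin m) (Fin n) ℕ) (k : Fin I.r) (r c : ℕ)
    (h : (r, c) ∈ (rowTableaux I M k).1) :
    I.lo k ≤ (rowTableaux I M k).2 r c ∧ (rowTableaux I M k).2 r c ≤ I.hi k :=
  mem_word_rowTableaux ((rowTableaux I M k).2.mem_word h)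

/-- The first column increases strictly inside the block, so it is no longer than the block. -/
theorem colLen_rowTableaux_le (I : Cuts m) (M : Matrix (Fin m) (Fin n) ℕ) (k : Fin I.r) :
    I.cut k.castSucc + (rowTableaux I M k).1.colLen 0 ≤ I.cut k.succ := by
  rcases Nat.eq_zero_or_pos ((rowTableaux I M k).1.colLen 0) with h | h
  · rw [h]
    exact I.strictMono.monotone (by rw [Fin.le_def]; simp)
  · have hc : ((rowTableaux I M k).1.colLen 0 - 1, 0) ∈ (rowTableaux I M k).1 :=
      YoungDiagram.mem_iff_lt_colLen.2 (by omega)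
    have h1 := (rowTableaux I M k).2.add_le_entry (fun r c h => (rowTableaux_bound I M k r c h).1) hc
    have h2 := (rowTableaux_bound I M k _ _ hc).2
    rw [Cuts.lo] at h1
    rw [Cuts.hi] at h2
    omega

/-- The shapes of the row tableaux. -/
noncomputable def rowShape (I : Cuts m) (M : Matrix (Fin m) (Fin n) ℕ) : I.PartitionTuple :=
  fun k => ⟨(rowTableaux I M k).1, colLen_rowTableaux_le I M k⟩

theorem RowConnected.shape_eq (h : RowConnected I M M') (k : Fin I.r) :
    (rowTableaux I M k).1 = (rowTableaux I M' k).1 := by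
  have key : ∀ {M M' : Matrix (Fin m) (Fin n) ℕ}, RowStep I M M' →
      (rowTableaux I M k).1 = (rowTableaux I M' k).1 := by
    intro M M' h
    obtain ⟨k', i, hk', h⟩ := h.exists_block
    by_cases hk : k = k'
    · subst hk
      exact (tableauLower_of_rowLower hk' h).1
    · rw [rowTableaux_eq_of_rowLower hk' hk h]
  induction h with
  | refl => rfl
  | tail _ h ih =>
    rcases h with h | h
    · exact ih.trans (key h)
    · exact ih.trans (key h).symm

/-- Sources under the row operators are recognized by their row tableaux. -/
theorem rowTableaux_eq_highestTableau_iff : (∀ N, ¬ RowStep I N M) ↔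
    ∀ k, rowTableaux I M k = ⟨_, highestTableau (rowTableaux I M k).1 (I.lo k)⟩ := by
  constructor
  · intro h k
    have hT : IsHighestWord (I.lo k) (rowTableaux I M k).2.word := by
      refine ⟨fun x hx => (mem_word_rowTableaux hx).1, fun i hi => ?_⟩
      by_cases hik : i < I.hi k
      · rw [← (rowTableaux_knuthEquiv I M k).wordEps_eq_zero_iff i,
          (Cuts.signature_filterWord ⟨hi, hik⟩ _).2]
        by_contra h0
        obtain ⟨N, hN⟩ := (exists_rowLower_to_iff (I.index_of_block ⟨hi, hik⟩)).2
          (Nat.pos_of_ne_zero h0)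
        exact h N (rowStep_of_block ⟨hi, hik⟩ hN)
      · exact wordEps_eq_zero_of_notMem fun hmem => by
          have := (mem_word_rowTableaux hmem).2
          omega
    rw [← (rowTableaux I M k).2.eq_highestTableau hT]
  · rintro h N hN
    obtain ⟨k, i, hk, hN⟩ := hN.exists_block
    have h1 := (tableauLower_of_rowLower hk hN).2.wordEps_pos
    rw [h k, (isHighestWord_highestTableau _ _).2 i hk.1] at h1
    exact lt_irrefl _ h1

/-- A set of matrices stable under the row operators. -/
def RowClosed (I : Cuts m) (S : Set (Matrix (Fin m) (Fin n) ℕ)) : Prop :=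
  ∀ M ∈ S, ∀ N, RowStep I M N ∨ RowStep I N M → N ∈ S

variable {S : Set (Matrix (Fin m) (Fin n) ℕ)}

theorem RowClosed.exists_source (hS : RowClosed I S) (hM : M ∈ S) :
    ∃ M₀ ∈ S, RowConnected I M M₀ ∧ ∀ N, ¬ RowStep I N M₀ := by
  induction hs : (rowWord M).sum using Nat.strong_induction_on generalizing M with
  | _ s ih =>
    by_cases h : ∃ N, RowStep I N M
    · obtain ⟨N, hN⟩ := h
      obtain ⟨i, hi, h⟩ := id hN
      have := (wordLower_of_rowLower h).sum_eq
      obtain ⟨M₀, h1, h2, h3⟩ := ih _ (by omega) (hS M hM N (.inr hN)) rfl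
      exact ⟨M₀, h1, hN.connected.symm.trans h2, h3⟩
    · exact ⟨M, hM, .refl _, fun N hN => h ⟨N, hN⟩⟩

/-- Every tuple of tableaux is reached from a highest-weight matrix of the same shape. -/
theorem RowClosed.exists_rowTableaux_eq (hS : RowClosed I S) {M₀ : Matrix (Fin m) (Fin n) ℕ}
    (hM₀ : M₀ ∈ S) {lam : Fin I.r → YoungDiagram}
    (h₀ : ∀ k, rowTableaux I M₀ k = ⟨lam k, highestTableau (lam k) (I.lo k)⟩)
    (P : (k : Fin I.r) → SemistandardYoungTableau (lam k))
    (hP : ∀ k, ∀ x ∈ (P k).word, I.lo k ≤ x ∧ x ≤ I.hi k) :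
    ∃ M ∈ S, RowConnected I M M₀ ∧ rowTableaux I M = fun k => ⟨lam k, P k⟩ := by
  induction hs : ∑ k, (P k).word.sum using Nat.strong_induction_on generalizing P with
  | _ s ih =>
    by_cases h : ∀ k, IsHighestWord (I.lo k) (P k).word
    · refine ⟨M₀, hM₀, .refl _, funext fun k => ?_⟩
      rw [h₀, (P k).eq_highestTableau (h k)]
    · push Not at h
      obtain ⟨k, hk⟩ := h
      have hb : ∀ x ∈ (P k).word, I.lo k ≤ x ∧ x ≤ I.hi k := hP k
      obtain ⟨i, hi, h0⟩ : ∃ i, I.lo k ≤ i ∧ wordEps i (P k).word ≠ 0 := by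
        by_contra hcon
        push Not at hcon
        exact hk ⟨fun x hx => (hb x hx).1, hcon⟩
      obtain ⟨w, hw⟩ := exists_wordLower_to_iff.2 (Nat.pos_of_ne_zero h0)
      have hik : I.lo k ≤ i ∧ i < I.hi k := by
        refine ⟨hi, ?_⟩
        obtain ⟨u, t, -, h2, -, -⟩ := hw
        exact (hb (i + 1) (by simp [h2])).2
      -- `T` is `P k` raised once. The tuple with `T` in place of `P k` is reached by induction, and
      -- the step from `T` back to `P k` is then performed on the matrix.
      obtain ⟨T, rfl⟩ := (P k).exists_word_eq_of_wordRaise hw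
      have hT : ∀ k', ∀ x ∈ (Function.update P k T k').word, I.lo k' ≤ x ∧ x ≤ I.hi k' := by
        intro k'
        by_cases hk' : k' = k
        · subst hk'
          rw [Function.update_self]
          exact (hw.forall_mem_iff (P := fun x => I.lo k' ≤ x ∧ x ≤ I.hi k') ⟨hik.1, hik.2.le⟩
            ⟨by omega, hik.2⟩).2 hb
        · rw [Function.update_of_ne hk']
          exact hP k'
      have hlt : ∑ k', (Function.update P k T k').word.sum < s := by
        rw [← hs]
        refine Finset.sum_lt_sum (fun k' _ => ?_) ⟨k, Finset.mem_univ k, ?_⟩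
        · by_cases hk' : k' = k
          · subst hk'
            rw [Function.update_self]
            have := hw.sum_eq
            omega
          · rw [Function.update_of_ne hk']
        · rw [Function.update_self]
          have := hw.sum_eq
          omega
      obtain ⟨M', hM', hc, ht⟩ := ih _ hlt _ hT rfl
      have htk : rowTableaux I M' k = ⟨lam k, T⟩ := by
        rw [ht]
        simp only [Function.update_self]
      have h1 : WordLower i (rowTableaux I M' k).2.word (P k).word := by
        rw [htk]
        exact hw
      obtain ⟨v, hv, -⟩ := (rowTableaux_knuthEquiv I M' k).symm.exists_wordLower h1
      have h2 := hv.wordPhi_pos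
      rw [(Cuts.signature_filterWord hik _).1] at h2
      obtain ⟨M, hM⟩ := (exists_rowLower_iff (I.index_of_block hik)).2 h2
      have hstep := rowStep_of_block hik hM
      refine ⟨M, hS M' hM' M (.inl hstep), hstep.connected.symm.trans hc, funext fun k' => ?_⟩
      by_cases hk' : k' = k
      · subst hk'
        exact (tableauLower_of_rowLower hik hM).right_unique ⟨by rw [htk], h1⟩
      · rw [← rowTableaux_eq_of_rowLower hik hk' hM, ht]
        simp only [Function.update_of_ne hk']

/-- Row operators act on matrices as soon as they act on the row tableaux. -/
theorem exists_rowLower_of_tableauLower (hk : I.lo k ≤ i ∧ i < I.hi k) {T : Tableau}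
    (h : TableauLower i (rowTableaux I M k) T) : ∃ M', rowLower i M = some M' := by
  obtain ⟨v, hv, -⟩ := (rowTableaux_knuthEquiv I M k).symm.exists_wordLower h.2
  have h2 := hv.wordPhi_pos
  rw [(Cuts.signature_filterWord hk _).1] at h2
  exact (exists_rowLower_iff (I.index_of_block hk)).2 h2

end Tableaux

/-! ### Vertices of filtered tableau crystals -/

section Vertices

variable {m n : ℕ} {I : Cuts m} {M M' : Matrix (Fin m) (Fin n) ℕ} {i : ℕ} {lam : I.PartitionTuple}

namespace Cuts

theorem tableaux_injective : Function.Injective (I.tableaux (lam := lam)) := by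
  intro P P' h
  funext k
  have := congrFun h k
  rw [tableaux, tableaux, Sigma.mk.injEq] at this
  exact Subtype.ext (eq_of_heq this.2)

theorem tableaux_bound (P : (I.tableauCrystal lam).V) (k : Fin I.r) {x : ℕ}
    (hx : x ∈ (I.tableaux P k).2.word) : I.lo k ≤ x ∧ x ≤ I.hi k :=
  (SSYTIn.word (show SSYTIn (lam k).1 (I.lo k) (I.hi k) from P k)).2 x hx

theorem tableauCrystal_edge_iff {P P' : (I.tableauCrystal lam).V} :
    (I.tableauCrystal lam).edge i P P' ↔ ∃ k, (I.lo k ≤ i ∧ i < I.hi k) ∧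
      TableauLower i (I.tableaux P k) (I.tableaux P' k) ∧
      ∀ k', k' ≠ k → I.tableaux P k' = I.tableaux P' k' := by
  constructor
  · rintro ⟨k, ⟨h1, h2, h3⟩, h4⟩
    refine ⟨k, ⟨h1, h2⟩, ⟨rfl, wordLower_eq_some_iff.1 h3⟩, fun k' hk' => ?_⟩
    rw [tableaux, tableaux, h4 k' hk']
  · rintro ⟨k, ⟨h1, h2⟩, ⟨-, h3⟩, h4⟩
    refine ⟨k, ⟨h1, h2, wordLower_eq_some_iff.2 h3⟩, fun k' hk' => ?_⟩
    have := h4 k' hk'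
    rw [tableaux, tableaux, Sigma.mk.injEq] at this
    exact Subtype.ext (eq_of_heq this.2)

theorem flatten_map_range' {α : Type*} (f : ℕ → α) : ∀ {r : ℕ} (c : Fin (r + 1) → ℕ), Monotone c →
    (List.ofFn fun k : Fin r => (List.range' (c k.castSucc + 1)
      (c k.succ + 1 - (c k.castSucc + 1))).map f).flatten =
    (List.range' (c 0 + 1) (c (Fin.last r) - c 0)).map f
  | 0, c, _ => by simp
  | r + 1, c, hc => by
    have h1 : c 0 ≤ c 1 := hc (Fin.zero_le _)
    have h2 : c 1 ≤ c (Fin.last (r + 1)) := hc (Fin.le_last _)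
    have ih := flatten_map_range' f (fun k => c k.succ) fun a b h => hc (Fin.succ_le_succ_iff.2 h)
    rw [List.ofFn_succ, List.flatten_cons]
    simp only [Fin.succ_castSucc] at ih
    rw [ih, ← List.map_append]
    congr 1
    simp only [Fin.castSucc_zero, Fin.succ_zero_eq_one, Fin.succ_last]
    rw [show c (Fin.last (r + 1)) - c 0 = (c 1 + 1 - (c 0 + 1)) + (c (Fin.last (r + 1)) - c 1) by
      omega, ← List.range'_append_1]
    congr 2
    omega

theorem flatten_content (w : List ℕ) :
    (List.ofFn fun k => content (I.lo k) (I.hi k) w).flatten = content 1 m w := by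
  have := flatten_map_range' (fun x => w.count x) I.cut I.strictMono.monotone
  rw [I.cut_last, I.cut_zero] at this
  exact this

end Cuts

theorem count_word_rowTableaux {k : Fin I.r} {x : ℕ} (hx : I.lo k ≤ x ∧ x ≤ I.hi k) :
    (rowTableaux I M k).2.word.count x = (rowWord M).count x := by
  rw [← (rowTableaux_knuthEquiv I M k).perm.count_eq, Cuts.filterWord,
    List.count_filter (by simpa using hx)]

theorem cwt_eq_of_rowTableaux_eq {P : (I.tableauCrystal lam).V} (h : rowTableaux I M = I.tableaux P) :
    (I.tableauCrystal lam).cwt P = content 1 m (rowWord M) := by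
  rw [← I.flatten_content]
  change (List.ofFn fun k => content (I.lo k) (I.hi k) (I.tableaux P k).2.word).flatten = _
  congr 2
  funext k
  rw [← h]
  refine List.map_congr_left fun x hx => ?_
  rw [List.mem_range'_1] at hx
  exact count_word_rowTableaux (by omega)

theorem edge_of_rowLower {P P' : (I.tableauCrystal lam).V} (hP : rowTableaux I M = I.tableaux P)
    (hP' : rowTableaux I M' = I.tableaux P') (hi : i ∉ I.toSet) (h : rowLower i M = some M') :
    (I.tableauCrystal lam).edge i P P' := by
  obtain ⟨k, hk⟩ := I.exists_block hi (index_of_rowLower h)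
  rw [Cuts.tableauCrystal_edge_iff, ← hP, ← hP']
  exact ⟨k, hk, tableauLower_of_rowLower hk h, fun k' hk' => rowTableaux_eq_of_rowLower hk hk' h⟩

theorem exists_rowLower_of_edge {P P' : (I.tableauCrystal lam).V}
    (hP : rowTableaux I M = I.tableaux P) (h : (I.tableauCrystal lam).edge i P P') :
    ∃ M', i ∉ I.toSet ∧ rowLower i M = some M' ∧ rowTableaux I M' = I.tableaux P' := by
  obtain ⟨k, hk, h1, h2⟩ := Cuts.tableauCrystal_edge_iff.1 h
  rw [← hP] at h1
  obtain ⟨M', hM'⟩ := exists_rowLower_of_tableauLower hk h1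
  refine ⟨M', I.notMem_of_block hk, hM', funext fun k' => ?_⟩
  by_cases hk' : k' = k
  · subst hk'
    exact (tableauLower_of_rowLower hk hM').right_unique h1
  · rw [← rowTableaux_eq_of_rowLower hk hk' hM', hP, h2 k' hk']

/-- The row tableaux as a vertex of a filtered tableau crystal. -/
noncomputable def rowVertex (I : Cuts m) (M : Matrix (Fin m) (Fin n) ℕ) :
    (I.tableauCrystal (rowShape I M)).V :=
  fun k => ⟨(rowTableaux I M k).2, rowTableaux_bound I M k⟩

theorem rowTableaux_eq_highestTuple_iff : rowTableaux I M = I.highestTuple lam ↔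
    (∀ N, ¬ RowStep I N M) ∧ ∀ k, (rowTableaux I M k).1 = (lam k).1 := by
  rw [rowTableaux_eq_highestTableau_iff]
  constructor
  · intro h
    have hs : ∀ k, (rowTableaux I M k).1 = (lam k).1 := fun k => by rw [h]; rfl
    refine ⟨fun k => ?_, hs⟩
    rw [hs, h]
    rfl
  · rintro ⟨h, hs⟩
    funext k
    rw [h, hs]
    rfl

variable {S : Set (Matrix (Fin m) (Fin n) ℕ)}

theorem RowClosed.exists_highestTuple (hS : RowClosed I S) (hM : M ∈ S) :
    ∃ M₀ ∈ S, RowConnected I M M₀ ∧ rowTableaux I M₀ = I.highestTuple (rowShape I M) := by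
  obtain ⟨M₀, h1, h2, h3⟩ := hS.exists_source hM
  exact ⟨M₀, h1, h2, rowTableaux_eq_highestTuple_iff.2 ⟨h3, fun k => (h2.shape_eq k).symm⟩⟩

theorem RowClosed.exists_tableaux (hS : RowClosed I S) (hM : M ∈ S)
    (h : rowTableaux I M = I.highestTuple lam) (P : (I.tableauCrystal lam).V) :
    ∃ M' ∈ S, RowConnected I M' M ∧ rowTableaux I M' = I.tableaux P :=
  hS.exists_rowTableaux_eq hM (fun k => congrFun h k) (fun k => (I.tableaux P k).2)
    fun k _ hx => I.tableaux_bound P k hx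

end Vertices

/-! ### Components of bicrystal closed sets of matrices -/

section Closed

variable {m n : ℕ} {I : Cuts m} {J : Cuts n} {M M' : Matrix (Fin m) (Fin n) ℕ}
  {S : Set (Matrix (Fin m) (Fin n) ℕ)} {lam : I.PartitionTuple} {mu : J.PartitionTuple}

/-- Raise by row operators first and by column operators afterwards; the second phase leaves the row
tableaux, already of highest weight, unchanged. -/
theorem exists_biconnected_highestTuple (hR : RowClosed I S) (hC : RowClosed J {M | M.transpose ∈ S})
    (hM : M ∈ S) : ∃ M₀ ∈ S, Biconnected I J M M₀ ∧
      filterRSK I J M₀ = (I.highestTuple (rowShape I M), J.highestTuple (rowShape J M.transpose)) := by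
  obtain ⟨N, h1, h2, h3⟩ := hR.exists_highestTuple hM
  obtain ⟨M₀, h4, h5, h6⟩ := hC.exists_highestTuple (M := N.transpose) h1
  refine ⟨M₀.transpose, h4, h2.biconnected.trans (h5.transpose.biconnected), ?_⟩
  rw [filterRSK_eq, ← h3, ← h5.transpose.rowTableaux_eq, M₀.transpose_transpose, h6]
  have hs : rowShape J N.transpose = rowShape J M.transpose := funext fun k =>
    Subtype.ext (congrArg Sigma.fst (congrFun h2.colTableaux_eq.symm k))
  rw [hs, N.transpose_transpose]

theorem exists_biconnected_tableaux (hR : RowClosed I S) (hC : RowClosed J {M | M.transpose ∈ S})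
    (hM : M ∈ S) (h : filterRSK I J M = (I.highestTuple lam, J.highestTuple mu))
    (P : (I.tableauCrystal lam).V) (Q : (J.tableauCrystal mu).V) :
    ∃ M' ∈ S, Biconnected I J M' M ∧ filterRSK I J M' = (I.tableaux P, J.tableaux Q) := by
  rw [filterRSK_eq, Prod.mk.injEq] at h
  obtain ⟨N, h1, h2, h3⟩ := hR.exists_tableaux hM h.1 P
  obtain ⟨M', h4, h5, h6⟩ := hC.exists_tableaux (M := N.transpose) h1
    (h2.colTableaux_eq.trans h.2) Q
  refine ⟨M'.transpose, h4, h5.transpose.biconnected.trans h2.biconnected, ?_⟩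
  rw [filterRSK_eq, h5.transpose.rowTableaux_eq, M'.transpose_transpose, h6]
  exact congrArg (·, _) h3

theorem Biconnected.shape_eq (h : Biconnected I J M M') :
    (∀ k, (rowTableaux I M k).1 = (rowTableaux I M' k).1) ∧
    ∀ k, (rowTableaux J M.transpose k).1 = (rowTableaux J M'.transpose k).1 := by
  obtain ⟨N, h1, h2⟩ := h
  constructor
  · intro k
    rw [h1.shape_eq, h2.rowTableaux_eq]
  · intro k
    rw [h1.colTableaux_eq, h2.transpose.shape_eq]

theorem isHighestWeight_iff : IsHighestWeight I J M ↔
    (∀ N, ¬ RowStep I N M) ∧ ∀ N, ¬ RowStep J N M.transpose := by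
  constructor
  · refine fun h => ⟨fun N hN => ?_, fun N hN => ?_⟩
    · obtain ⟨i, hi⟩ := hN
      exact h (.inl i) N hi
    · obtain ⟨j, hj⟩ := colStep_iff.1 (show ColStep J N.transpose M from hN)
      exact h (.inr j) N.transpose hj
  · rintro ⟨h1, h2⟩ (i | j) N hN
    · exact h1 N ⟨i, hN⟩
    · exact h2 _ (colStep_iff.2 ⟨j, hN⟩)

theorem filterRSK_eq_highestTuple_iff :
    filterRSK I J M = (I.highestTuple lam, J.highestTuple mu) ↔
      IsHighestWeight I J M ∧ HasShape I J M lam mu := by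
  rw [HasShape, filterRSK_eq, Prod.mk.injEq, rowTableaux_eq_highestTuple_iff,
    rowTableaux_eq_highestTuple_iff, isHighestWeight_iff, and_and_and_comm]

/-- An entry is at most its row sum, which is the multiplicity of a letter in one of the tableaux,
so all entries are bounded in terms of `T`. -/
theorem finite_setOf_rowTableaux_eq (T : Fin I.r → Tableau) :
    {M : Matrix (Fin m) (Fin n) ℕ | rowTableaux I M = T}.Finite := by
  refine (Set.finite_Icc (0 : Fin m → Fin n → ℕ)
    fun _ _ => ∑ k, (T k).2.word.length).subset fun M hM => ?_
  refine ⟨fun _ _ => Nat.zero_le _, fun r c => ?_⟩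
  obtain ⟨k, hk⟩ := I.exists_block_of_pos (Nat.succ_pos r.val) r.isLt
  calc M r c ≤ ∑ c, M r c := Finset.single_le_sum (fun _ _ => Nat.zero_le _) (Finset.mem_univ c)
    _ = (T k).2.word.count (r.val + 1) := by
      subst hM
      exact ((count_word_rowTableaux hk).trans (count_rowWord M r)).symm
    _ ≤ (T k).2.word.length := List.count_le_length
    _ ≤ _ := Finset.single_le_sum (f := fun k => (T k).2.word.length) (fun _ _ => Nat.zero_le _)
      (Finset.mem_univ k)

end Closed

/-! ### The isomorphism -/

section Isomorphism

variable {m n : ℕ} {I : Cuts m} {J : Cuts n} {M M' : Matrix (Fin m) (Fin n) ℕ}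
  {S : Set (Matrix (Fin m) (Fin n) ℕ)}

/-- The matrices in `S` that filtered RSK sends to the highest-weight tableau-tuple of a given
shape. -/
def highestIn (I : Cuts m) (J : Cuts n) (S : Set (Matrix (Fin m) (Fin n) ℕ))
    (lam : I.PartitionTuple) (mu : J.PartitionTuple) : Set (Matrix (Fin m) (Fin n) ℕ) :=
  {M ∈ S | filterRSK I J M = (I.highestTuple lam, J.highestTuple mu)}

theorem finite_highestIn (lam : I.PartitionTuple) (mu : J.PartitionTuple) :
    (highestIn I J S lam mu).Finite := by
  refine (finite_setOf_rowTableaux_eq (I := I) (n := n) (I.highestTuple lam)).subset ?_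
  rintro M ⟨-, hM⟩
  rw [filterRSK_eq, Prod.mk.injEq] at hM
  exact hM.1

/-- The number of highest-weight matrices in `S` of a given shape. -/
noncomputable def multiplicityIn (I : Cuts m) (J : Cuts n) (S : Set (Matrix (Fin m) (Fin n) ℕ))
    (lam : I.PartitionTuple) (mu : J.PartitionTuple) : ℕ :=
  (highestIn I J S lam mu).ncard

variable (I J S) in
/-- An enumeration of the highest-weight matrices in `S` of a given shape. -/
noncomputable def highestEquiv (lam : I.PartitionTuple) (mu : J.PartitionTuple) :
    highestIn I J S lam mu ≃ Fin (multiplicityIn I J S lam mu) :=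
  haveI : Finite (highestIn I J S lam mu) := finite_highestIn lam mu
  Finite.equivFinOfCardEq rfl

/-- The highest-weight matrix attached to the component of a vertex. -/
noncomputable def componentSource : (tableauGraph I J (multiplicityIn I J S)).V →
    Matrix (Fin m) (Fin n) ℕ
  | ⟨s, t, _⟩ => ((highestEquiv I J S s.1 s.2).symm t).1

/-- A matrix and a vertex correspond to each other if filtered RSK sends one to the other and they
belong to the same component. -/
def Corresponds (M : Matrix (Fin m) (Fin n) ℕ) (x : (tableauGraph I J (multiplicityIn I J S)).V) :
    Prop :=
  filterRSK I J M = tableauPair x ∧ Biconnected I J M (componentSource x)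

theorem corresponds_mk_iff {s : I.PartitionTuple × J.PartitionTuple}
    {t : Fin (multiplicityIn I J S s.1 s.2)} {P : (I.tableauCrystal s.1).V}
    {Q : (J.tableauCrystal s.2).V} :
    Corresponds (S := S) M ⟨s, t, P, Q⟩ ↔ rowTableaux I M = I.tableaux P ∧
      rowTableaux J M.transpose = J.tableaux Q ∧
      Biconnected I J M ((highestEquiv I J S s.1 s.2).symm t).1 := by
  change filterRSK I J M = (I.tableaux P, J.tableaux Q) ∧
    Biconnected I J M ((highestEquiv I J S s.1 s.2).symm t).1 ↔ _
  rw [filterRSK_eq, Prod.mk.injEq, and_assoc]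

/-- Shapes are constant on components, and the two representatives are connected with equal filtered
RSK image, hence equal. Exhibiting common indices `s`, `t` avoids transport between dependent types.
-/
theorem Corresponds.exists_eq {x y : (tableauGraph I J (multiplicityIn I J S)).V}
    (hx : Corresponds M x) (hy : Corresponds M' y) (h : Biconnected I J M M') :
    ∃ (s : I.PartitionTuple × J.PartitionTuple) (t : Fin (multiplicityIn I J S s.1 s.2))
      (P P' : (I.tableauCrystal s.1).V) (Q Q' : (J.tableauCrystal s.2).V),
      x = ⟨s, t, P, Q⟩ ∧ y = ⟨s, t, P', Q'⟩ := by
  obtain ⟨⟨lam, mu⟩, t, P, Q⟩ := x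
  obtain ⟨⟨lam', mu'⟩, t', P', Q'⟩ := y
  obtain ⟨h1, h2, h3⟩ := corresponds_mk_iff.1 hx
  obtain ⟨h1', h2', h3'⟩ := corresponds_mk_iff.1 hy
  obtain ⟨h4, h5⟩ := h.shape_eq
  obtain rfl : lam = lam' := funext fun k => Subtype.ext <| by
    have := h4 k
    rwa [h1, h1'] at this
  obtain rfl : mu = mu' := funext fun k => Subtype.ext <| by
    have := h5 k
    rwa [h2, h2'] at this
  obtain rfl : t = t' := by
    refine (highestEquiv I J S lam mu).symm.injective (Subtype.ext ?_)
    refine ((h3.symm.trans h).trans h3').eq_of_filterRSK_eq ?_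
    exact ((highestEquiv I J S lam mu).symm t).2.2.trans
      ((highestEquiv I J S lam mu).symm t').2.2.symm
  exact ⟨_, t, P, P', Q, Q', rfl, rfl⟩

theorem Corresponds.right_unique {x y : (tableauGraph I J (multiplicityIn I J S)).V}
    (hx : Corresponds M x) (hy : Corresponds M y) : x = y := by
  obtain ⟨s, t, P, P', Q, Q', rfl, rfl⟩ := hx.exists_eq hy (.refl M)
  obtain ⟨h1, h2, -⟩ := corresponds_mk_iff.1 hx
  obtain ⟨h1', h2', -⟩ := corresponds_mk_iff.1 hy
  obtain rfl := Cuts.tableaux_injective (h1.symm.trans h1')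
  obtain rfl := Cuts.tableaux_injective (h2.symm.trans h2')
  rfl

theorem Corresponds.left_unique {x : (tableauGraph I J (multiplicityIn I J S)).V}
    (h : Corresponds M x) (h' : Corresponds M' x) : M = M' :=
  (h.2.trans h'.2.symm).eq_of_filterRSK_eq (h.1.trans h'.1.symm)

theorem exists_corresponds_of_mem (hR : RowClosed I S) (hC : RowClosed J {M | M.transpose ∈ S})
    (hM : M ∈ S) : ∃ x : (tableauGraph I J (multiplicityIn I J S)).V, Corresponds M x := by
  obtain ⟨M₀, h1, h2, h3⟩ := exists_biconnected_highestTuple hR hC hM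
  refine ⟨⟨(rowShape I M, rowShape J M.transpose), highestEquiv I J S _ _ ⟨M₀, h1, h3⟩,
    rowVertex I M, rowVertex J M.transpose⟩, corresponds_mk_iff.2 ⟨rfl, rfl, ?_⟩⟩
  rwa [Equiv.symm_apply_apply]

theorem exists_mem_corresponds (hR : RowClosed I S) (hC : RowClosed J {M | M.transpose ∈ S})
    (x : (tableauGraph I J (multiplicityIn I J S)).V) : ∃ M ∈ S, Corresponds M x := by
  obtain ⟨s, t, P, Q⟩ := x
  obtain ⟨h1, h2⟩ := ((highestEquiv I J S s.1 s.2).symm t).2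
  obtain ⟨M, h3, h4, h5⟩ := exists_biconnected_tableaux hR hC h1 h2 P Q
  exact ⟨M, h3, h5, h4⟩

theorem Corresponds.cwt_eq {x : (tableauGraph I J (multiplicityIn I J S)).V}
    (h : Corresponds M x) :
    (tableauGraph I J (multiplicityIn I J S)).cwt x = (filteredBicrystal I J).cwt M := by
  obtain ⟨s, t, P, Q⟩ := x
  obtain ⟨h1, h2, -⟩ := corresponds_mk_iff.1 h
  change (I.tableauCrystal s.1).cwt P ++ (J.tableauCrystal s.2).cwt Q =
    content 1 m (rowWord M) ++ content 1 n (colWord M)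
  rw [cwt_eq_of_rowTableaux_eq h1, cwt_eq_of_rowTableaux_eq h2, colWord_eq_rowWord_transpose]

theorem Corresponds.edge {x y : (tableauGraph I J (multiplicityIn I J S)).V} {l : ℕ ⊕ ℕ}
    (hx : Corresponds M x) (hy : Corresponds M' y) (h : (filteredBicrystal I J).edge l M M') :
    (tableauGraph I J (multiplicityIn I J S)).edge l x y := by
  have hb : Biconnected I J M M' := by
    rcases l with i | j
    · exact RowConnected.biconnected (RowStep.connected ⟨i, h⟩)
    · exact ColConnected.biconnected (RowConnected.transpose
        (RowStep.connected (colStep_iff.2 ⟨j, h⟩)))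
  obtain ⟨s, t, P, P', Q, Q', rfl, rfl⟩ := hx.exists_eq hy hb
  obtain ⟨h1, h2, -⟩ := corresponds_mk_iff.1 hx
  obtain ⟨h1', h2', -⟩ := corresponds_mk_iff.1 hy
  refine .mk s _ _ (.mk t _ _ ?_)
  rcases l with i | j
  · obtain ⟨hi, h⟩ : i ∉ I.toSet ∧ rowLower i M = some M' := h
    refine ⟨edge_of_rowLower h1 h1' hi h, Cuts.tableaux_injective ?_⟩
    exact h2.symm.trans ((RowStep.connected ⟨i, hi, h⟩).colTableaux_eq.trans h2')
  · obtain ⟨hj, h⟩ : j ∉ J.toSet ∧ colLower j M = some M' := h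
    refine ⟨Cuts.tableaux_injective ?_, edge_of_rowLower h2 h2' hj (colLower_iff.1 h)⟩
    exact h1.symm.trans ((rowTableaux_eq_of_colLower h).trans h1')

/-- Edges lift because an operator acts on a matrix whenever it acts on the tableaux. Membership of
`M'` in `S` is left open; it follows later from uniqueness of the matrix corresponding to `y`. -/
theorem Corresponds.exists_edge {x y : (tableauGraph I J (multiplicityIn I J S)).V} {l : ℕ ⊕ ℕ}
    (hx : Corresponds M x) (h : (tableauGraph I J (multiplicityIn I J S)).edge l x y) :
    ∃ M', Corresponds M' y ∧ (filteredBicrystal I J).edge l M M' := by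
  obtain ⟨s, _, _, ⟨t, ⟨P, Q⟩, ⟨P', Q'⟩, h⟩⟩ := h
  obtain ⟨h1, h2, h3⟩ := corresponds_mk_iff.1 hx
  rcases l with i | j
  · obtain ⟨he, rfl⟩ : (I.tableauCrystal s.1).edge i P P' ∧ Q = Q' := h
    obtain ⟨M', hi, hM', h4⟩ := exists_rowLower_of_edge h1 he
    have hc := RowStep.connected ⟨i, hi, hM'⟩
    exact ⟨M', corresponds_mk_iff.2 ⟨h4, hc.colTableaux_eq.symm.trans h2,
      hc.symm.biconnected.trans h3⟩, hi, hM'⟩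
  · obtain ⟨rfl, he⟩ : P = P' ∧ (J.tableauCrystal s.2).edge j Q Q' := h
    obtain ⟨M', hj, hM', h4⟩ := exists_rowLower_of_edge h2 he
    have hM'' : colLower j M = some M'.transpose := colLower_iff.2 hM'
    have hc := (RowStep.connected ⟨j, hj, hM'⟩).symm.transpose
    exact ⟨M'.transpose, corresponds_mk_iff.2 ⟨(rowTableaux_eq_of_colLower hM'').symm.trans h1, h4,
      hc.biconnected.trans h3⟩, hj, hM''⟩

/-- Decomposition of a bicrystal closed set of matrices into tableau crystals. -/
theorem exists_isIso_tableauGraph (hR : RowClosed I S) (hC : RowClosed J {M | M.transpose ∈ S}) :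
    ∃ Φ : S ≃ (tableauGraph I J (multiplicityIn I J S)).V,
      PreCrystalGraph.IsIso ((filteredBicrystal I J).induce S)
        (tableauGraph I J (multiplicityIn I J S)) Φ ∧
      ∀ M : S, tableauPair (Φ M) = filterRSK I J M.1 := by
  choose f hf using fun M : S => exists_corresponds_of_mem hR hC M.2
  choose g hgS hg using exists_mem_corresponds hR hC
  have hleft : ∀ M, (⟨g (f M), hgS _⟩ : S) = M := fun M =>
    Subtype.ext ((hg (f M)).left_unique (hf M))
  have hright : ∀ x, f ⟨g x, hgS x⟩ = x := fun x => (hf ⟨g x, hgS x⟩).right_unique (hg x)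
  refine ⟨⟨f, fun x => ⟨g x, hgS x⟩, hleft, hright⟩, ⟨⟨fun M => (hf M).cwt_eq, ?_⟩,
    fun x => (hg x).cwt_eq.symm, ?_⟩, fun M => (hf M).1.symm⟩
  · exact fun l M M' h => (hf M).edge (hf M') h
  · intro l x y h
    obtain ⟨M', h1, h2⟩ := (hg x).exists_edge h
    -- The lifted endpoint and the chosen preimage `g y` both correspond to `y`, so they agree.
    obtain rfl := h1.left_unique (hg y)
    exact h2

end Isomorphism

theorem theorem5 {m n : ℕ} (I : Cuts m) (J : Cuts n)
    (X : Set (Matrix (Fin m) (Fin n) ℂ)) (hX : IsVariety X)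
    (ord : MonomialOrder.{0, v} (Fin m × Fin n)) (hclosed : IsBicrystalClosed ord I J X) :
    (∃ Φ : (stdGraph ord I J X).V ≃ (tableauGraph I J (stdMultiplicity ord I J X)).V,
      PreCrystalGraph.IsIso (stdGraph ord I J X) (tableauGraph I J (stdMultiplicity ord I J X)) Φ ∧
      ∀ M : stdMonomials ord X, tableauPair (Φ M) = filterRSK I J M.1) ∧
    ∀ (lam : I.PartitionTuple) (mu : J.PartitionTuple),
      (highestStd ord I J X lam mu).Finite ∧
      stdMultiplicity ord I J X lam mu =
        {M ∈ stdMonomials ord X | IsHighestWeight I J M ∧ HasShape I J M lam mu}.ncard := by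
  have hR : RowClosed I (stdMonomials ord X) := by
    rintro M hM N (⟨i, hi, h⟩ | ⟨i, hi, h⟩)
    · exact (hclosed M hM).1 i hi N (.inr h)
    -- An incoming lowering edge is an outgoing raising step, so closure under raising handles
    -- reversed edges.
    · exact (hclosed M hM).1 i hi N (.inl (rowRaise_iff.2 h))
  have hC : RowClosed J {M | M.transpose ∈ stdMonomials ord X} := by
    rintro M hM N (⟨j, hj, h⟩ | ⟨j, hj, h⟩)
    · exact (hclosed _ hM).2 j hj _ (.inr (colLower_iff.2 h))
    · exact (hclosed _ hM).2 j hj _ (.inl (colRaise_iff.2 (colLower_iff.2 h)))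
  -- For `S` the set of standard monomials, `multiplicityIn` and `highestIn` agree by definition
  -- with `stdMultiplicity` and `highestStd`.
  refine ⟨exists_isIso_tableauGraph hR hC, fun lam mu => ⟨finite_highestIn lam mu, ?_⟩⟩
  rw [stdMultiplicity, highestStd]
  simp only [filterRSK_eq_highestTuple_iff]
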